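/- Let $\mathfrak g$ be a finite-dimensional real Lie algebra which is almost abelian, i.e. non-abelian with an abelian subalgebra of codimension $1$. Let $\mathbb R^\times\mathrm{Aut}(\mathfrak g)=\{c\varphi : c\in\mathbb R\setminus\{0\},\ \varphi\in\mathrm{Aut}(\mathfrak g)\}\subset \mathrm{GL}(\mathfrak g)$, acting on bilinear forms by $(\psi.\omega)(x,y)=\omega(\psi^{-1}x,\psi^{-1}y)$, and write $[\omega]$ for the orbit of $\omega$ under this group. A symplectic form on $\mathfrak g$ is a nondegenerate alternating bilinear form $\omega$ which is closed, i.e. $\omega(x,[y,z])+\omega(z,[x,y])+\omega(y,[z,x])=0$ for all $x,y,z\in\mathfrak g$. (1) The moduli space $\{[\omega] : \omega \text{ a symplectic form on } \mathfrak g\}$ is finite. (2) Let $e_1,\dots,e_D$ be any basis of $\mathfrak g$ such that $[e_i,e_j]=0$ for all $i,j\ge 2$ and such that $\mathrm{ad}_{e_1}$ maps $\mathrm{Span}(e_2,\dots,e_D)$ to itself, with matrix in the basis $e_2,\dots,e_D$ in real Jordan normal form, i.e. a direct sum, in some order, of blocks $J_n(\lambda)$ ($\lambda\in\mathbb R$ on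 the diagonal, $1$ on the superdiagonal) and $C_n(a,b)$ ($b>0$; the $2\times2$ blocks $\begin{pmatrix}a&b\\-b&a\end{pmatrix}$ on the block diagonal, $I_2$ on the block superdiagonal). Then for every symplectic form $\omega$ on $\mathfrak g$ the dimension $D=2r$ is even, and there is a permutation matrix $\bar P$ (with respect to $e_1,\dots,e_D$) with $\bar P e_1=e_1$ such that $[\omega]=[\bar P.\omega_0]$, where $\omega_0=\sum_{i=1}^{r}\varepsilon^i\wedge\varepsilon^{r+i}$ and $\varepsilon^1,\dots,\varepsilon^D$ is the dual basis. -/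

import Mathlib

namespace AlmostAbelian

section Forms

variable (g : Type*) [LieRing g] [LieAlgebra ℝ g]

/-- A Lie algebra is almost abelian if it is not abelian and contains an abelian subalgebra of
codimension one. -/
def IsAlmostAbelian : Prop :=
  ¬ IsLieAbelian g ∧
    ∃ L : LieSubalgebra ℝ g, IsLieAbelian L ∧ Module.finrank ℝ (g ⧸ L.toSubmodule) = 1

/-- The group `ℝˣ · Aut(g)`: the linear automorphisms of `g` that are a nonzero scalar times a
Lie algebra automorphism. -/
def scaledAut : Subgroup (g ≃ₗ[ℝ] g) where
  carrier := {ψ | ∃ (c : ℝˣ) (φ : g ≃ₗ⁅ℝ⁆ g), ∀ x, ψ x = (c : ℝ) • φ x}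
  one_mem' := ⟨1, LieEquiv.refl, fun x => by simp⟩
  mul_mem' := by
    rintro ψ₁ ψ₂ ⟨c₁, φ₁, h₁⟩ ⟨c₂, φ₂, h₂⟩
    refine ⟨c₁ * c₂, φ₂.trans φ₁, fun x => ?_⟩
    rw [LinearEquiv.mul_apply, h₂, map_smul, h₁, smul_smul, mul_comm, Units.val_mul,
      LieEquiv.trans_apply, mul_comm]
  inv_mem' := by
    rintro ψ ⟨c, φ, h⟩
    refine ⟨c⁻¹, φ.symm, fun x => ψ.injective ?_⟩
    have h1 : ψ (ψ⁻¹ x) = x := ψ.apply_symm_apply x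
    rw [h1, map_smul, h, smul_smul, Units.inv_mul, one_smul, LieEquiv.apply_symm_apply]

/-- The symplectic forms on `g`: the closed nondegenerate alternating bilinear forms. -/
def symplecticForms : Set (LinearMap.BilinForm ℝ g) :=
  {ω | ω.IsAlt ∧ ω.Nondegenerate ∧ ∀ x y z : g, ω x ⁅y, z⁆ + ω z ⁅x, y⁆ + ω y ⁅z, x⁆ = 0}

variable {g}

/-- The action of a linear automorphism on bilinear forms: `(ψ.ω)(x, y) = ω(ψ⁻¹ x, ψ⁻¹ y)`. -/
def act (ψ : g ≃ₗ[ℝ] g) (ω : LinearMap.BilinForm ℝ g) : LinearMap.BilinForm ℝ g :=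
  LinearMap.BilinForm.congr ψ ω

/-- The class `[ω]`: the orbit of `ω` under `ℝˣ · Aut(g)`. -/
def formClass (ω : LinearMap.BilinForm ℝ g) : Set (LinearMap.BilinForm ℝ g) :=
  {η | ∃ ψ ∈ scaledAut g, η = act ψ ω}

variable (g) in
/-- The moduli space of symplectic forms on `g`: the set of orbits of symplectic forms. -/
def symplecticModuli : Set (Set (LinearMap.BilinForm ℝ g)) :=
  {O | ∃ ω ∈ symplecticForms g, O = formClass ω}

/-- The wedge product of two linear forms. -/
def wedge (α β : Module.Dual ℝ g) : LinearMap.BilinForm ℝ g :=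
  LinearMap.BilinForm.linMulLin α β - LinearMap.BilinForm.linMulLin β α

/-- The canonical 2-form `∑_{i < r} εⁱ ∧ ε^{r+i}` with respect to a basis `e` with `D = 2r`
elements and dual basis `ε` (indices start at 0). -/
noncomputable def canonicalForm {D r : ℕ} (h : D = 2 * r) (e : Module.Basis (Fin D) ℝ g) :
    LinearMap.BilinForm ℝ g :=
  ∑ i : Fin r, wedge (e.coord ⟨i, by omega⟩) (e.coord ⟨r + i, by omega⟩)

/-- The linear automorphism given in the basis `e` by the permutation matrix of `σ`:
it sends `e i` to `e (σ i)`. -/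
noncomputable def permEquiv {D : ℕ} (e : Module.Basis (Fin D) ℝ g) (σ : Equiv.Perm (Fin D)) :
    g ≃ₗ[ℝ] g :=
  e.equiv e σ

end Forms

section Jordan

/-- The blocks of a real Jordan normal form: `J_n(l)` for a real eigenvalue `l`, and
`C_n(a, b)`, of size `2n`, for a pair of conjugate eigenvalues `a ± ib` with `b > 0`. -/
inductive RealJordanBlock : Type
  | real (n : ℕ) (l : ℝ) : RealJordanBlock
  | complex (n : ℕ) (a b : ℝ) (hb : 0 < b) : RealJordanBlock

/-- The number of rows of a block. -/
def RealJordanBlock.size : RealJordanBlock → ℕ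
  | .real n _ => n
  | .complex n _ _ _ => n * 2

/-- `J_n(l)`: `l` on the diagonal and `1` on the superdiagonal. -/
def realBlock (n : ℕ) (l : ℝ) : Matrix (Fin n) (Fin n) ℝ :=
  Matrix.of fun i j => if i = j then l else if (i : ℕ) + 1 = j then 1 else 0

/-- `C_n(a, b)`: the 2 × 2 block `[a, b; -b, a]` on the block diagonal and the 2 × 2 identity on
the block superdiagonal; the index `(i, s)` stands for row `s` of block row `i`. -/
def complexBlock (n : ℕ) (a b : ℝ) : Matrix (Fin n × Fin 2) (Fin n × Fin 2) ℝ :=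
  Matrix.of fun i j =>
    if i.1 = j.1 then !![a, b; -b, a] i.2 j.2
    else if (i.1 : ℕ) + 1 = j.1 then (1 : Matrix (Fin 2) (Fin 2) ℝ) i.2 j.2
    else 0

/-- The matrix of a block. -/
def RealJordanBlock.matrix : (B : RealJordanBlock) → Matrix (Fin B.size) (Fin B.size) ℝ
  | .real n l => realBlock n l
  | .complex n a b _ => Matrix.reindex finProdFinEquiv finProdFinEquiv (complexBlock n a b)

variable {p : ℕ}

/-- The size of the direct sum of the blocks `B 0, …, B (p - 1)`. -/
def jordanSize (B : Fin p → RealJordanBlock) : ℕ := ∑ k, (B k).size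

/-- The direct sum (block diagonal matrix) of the blocks `B 0, …, B (p - 1)`, in this order. -/
def jordanMatrix (B : Fin p → RealJordanBlock) :
    Matrix (Fin (jordanSize B)) (Fin (jordanSize B)) ℝ :=
  Matrix.reindex finSigmaFinEquiv finSigmaFinEquiv
    (Matrix.blockDiagonal' fun k => (B k).matrix)

/-- The basis `e` identifies `g` with `ℝ e₁ ⋉ Span(e₂, …, e_D)`, where the second factor is an
abelian ideal on which `ad e₁` acts by the real Jordan matrix with blocks `B`
(`e 0` is `e₁`). -/
structure IsJordanBasis {g : Type*} [LieRing g] [LieAlgebra ℝ g] (B : Fin p → RealJordanBlock)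
    (e : Module.Basis (Fin (jordanSize B + 1)) ℝ g) : Prop where
  abelian : ∀ i j : Fin (jordanSize B), ⁅e i.succ, e j.succ⁆ = 0
  ad : ∀ j : Fin (jordanSize B), ⁅e 0, e j.succ⁆ = ∑ i, jordanMatrix B i j • e i.succ

end Jordan

end AlmostAbelian

namespace AlmostAbelian

open Polynomial

/-! ### Square roots of polynomials modulo prime powers and the involution `X ↦ -X`. -/

section PolynomialSquareRoots

/-! Let `V` be an abelian ideal of codimension one, `e` a vector outside it and `A = ad e` on `V`.
The restriction `β` of a symplectic form to `V` has a one-dimensional radical, and closedness makes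
`A` skew for `β`. The heart of the proof is that such a pair `(A, β)` admits a real Jordan basis of
`A` containing a radical vector, on whose other members the Gram matrix of `β` is monomial with
entries `±1` (`exists_option_family`). Subtracting an element of `V` from `e` and rescaling gives a
first vector orthogonal to all of these but the radical vector, with which it pairs to `1`
(`Frame.exists_monomial_basis`).

Real Jordan bases of `A` are unique up to a permutation and an automorphism commuting with `A`
(`IsBlockFamily.exists_equiv`). Hence any given Jordan basis is carried to a reordering of the
monomial one by an element of `ℝˣ · Aut(g)`; the scalar absorbs the normalisation of the first
vector. In the given basis the transported form is monomial, so it is a permutation of the canonical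
form, and there are only finitely many permutations.

To find monomial Jordan bases, view `V` as an `ℝ[X]`-module. Skewness says that the adjoint of
`p(A)` is `p(-A)`, so everything is governed by the involution `X ↦ -X`. In the nondegenerate case
(`exists_monomial_family`) one splits off cyclic pieces of maximal height and inducts on orthogonal
complements. If a prime `q` is coprime to its reflection, two isotropic cyclic spaces are paired
perfectly, and the basis dual to a Jordan chain is again one, because minus the transpose of a block
is a block up to signs and order. If `q = X` and the height is odd, the two chains can be corrected
to be isotropic. If `q = X` with even height, or `q = X² + b²`, a single cyclic space is
nondegenerate. Replacing its generator `z` by `r(A) z` multiplies the form by the norm `r(-X) r(X)`,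
and a square root modulo `q ^ n` makes it `±1` on one antidiagonal.

In the degenerate case one isolates a longest Jordan chain ending at the radical vector, together
with the vector representing a functional that detects its end, and applies the nondegenerate case
to a complement. -/

lemma exists_inv_sqrt_approx (m : ℕ) :
    ∃ h : ℝ[X], X ^ (m + 1) ∣ h ^ 2 * (1 + X) - 1 ∧ X ∣ h - 1 := by
  induction m with
  | zero => exact ⟨1, by simp, by simp⟩
  | succ m ih =>
    obtain ⟨h, ⟨k, hk⟩, k', hk'⟩ := ih
    -- Newton step: with `y = X ^ (m + 1) * k`, the product `(1 + y) * (1 - y / 2) ^ 2` is `1` up to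
    -- a multiple of `y ^ 2`.
    refine ⟨h * (1 - C (1 / 2) * (X ^ (m + 1) * k)), ?_, ?_⟩
    · have h2 : (C (1 / 2) : ℝ[X]) * 2 = 1 := by
        rw [← C_ofNat, ← C_mul]; norm_num
      have e : (h * (1 - C (1 / 2) * (X ^ (m + 1) * k))) ^ 2 * (1 + X) - 1
          = X ^ (m + 2) * (X ^ m * k ^ 2 * (-(C (1 / 2) * 2) + C (1 / 2) ^ 2
            + C (1 / 2) ^ 2 * (X ^ (m + 1) * k)))
            + X ^ (m + 1) * k * (1 - C (1 / 2) * 2) := by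
        have hk' : h ^ 2 * (1 + X) = 1 + X ^ (m + 1) * k := by rw [← hk]; ring
        calc _ = (h ^ 2 * (1 + X)) * (1 - C (1 / 2) * (X ^ (m + 1) * k)) ^ 2 - 1 := by ring
          _ = _ := by rw [hk']; ring
      rw [e, h2]
      simp only [sub_self, mul_zero, add_zero]
      exact Dvd.intro _ rfl
    · refine ⟨k' - h * C (1 / 2) * X ^ m * k, ?_⟩
      linear_combination hk'

lemma exists_inv_sqrt_mod {q y : ℝ[X]} (n : ℕ) (hq : q ∣ y) :
    ∃ h : ℝ[X], q ^ n ∣ (h.comp y) ^ 2 * (1 + y) - 1 ∧ q ∣ h.comp y - 1 := by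
  obtain ⟨h, ⟨k, hk⟩, k', hk'⟩ := exists_inv_sqrt_approx n
  refine ⟨h, ?_, ?_⟩
  · have : (h.comp y) ^ 2 * (1 + y) - 1 = y ^ (n + 1) * k.comp y := by
      have := congrArg (fun p => p.comp y) hk
      simpa using this
    rw [this]
    exact Dvd.dvd.mul_right ((pow_dvd_pow_of_dvd hq n).trans (pow_dvd_pow _ n.le_succ)) _
  · have : h.comp y - 1 = y * k'.comp y := by
      have := congrArg (fun p => p.comp y) hk'
      simpa using this
    rw [this]
    exact hq.mul_right _

lemma comp_sub_comp_dvd (g a b : ℝ[X]) : a - b ∣ g.comp a - g.comp b := by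
  have := sub_dvd_eval_sub a b (g.map C)
  simpa [eval_map, comp] using this

lemma algEquivAevalNegX_apply' (p : ℝ[X]) : algEquivAevalNegX p = p.comp (-X) := by
  simp [algEquivAevalNegX, comp_eq_aeval]

lemma algEquivAevalNegX_X : algEquivAevalNegX (X : ℝ[X]) = -X := by
  simp

lemma algEquivAevalNegX_C (c : ℝ) : algEquivAevalNegX (C c : ℝ[X]) = C c := by
  simp

lemma algEquivAevalNegX_comp (p q : ℝ[X]) :
    algEquivAevalNegX (p.comp q) = p.comp (algEquivAevalNegX q) := by
  rw [algEquivAevalNegX_apply', algEquivAevalNegX_apply', comp_assoc]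

lemma algEquivAevalNegX_algEquivAevalNegX (p : ℝ[X]) :
    algEquivAevalNegX (algEquivAevalNegX p) = p := by
  rw [algEquivAevalNegX_apply', algEquivAevalNegX_apply', comp_assoc]
  simp

/-- An even polynomial with nonzero constant residue modulo `q` is, up to sign, a norm
`r(-X) r(X)` modulo `q ^ n`. -/
lemma exists_norm_mod {q p : ℝ[X]} {c : ℝ} (n : ℕ) (hc : c ≠ 0) (hp : q ∣ p - C c)
    (hev : q ^ n ∣ algEquivAevalNegX p - p) :
    ∃ (r : ℝ[X]) (ε : ℝ), (ε = 1 ∨ ε = -1) ∧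
      q ^ n ∣ algEquivAevalNegX r * r - C ε * p := by
  wlog hpos : 0 < c generalizing p c
  · have hneg : c < 0 := lt_of_le_of_ne (not_lt.mp hpos) hc
    obtain ⟨r, ε, hε, hr⟩ := this (p := -p) (c := -c) (neg_ne_zero.mpr hc)
      (by rw [C_neg]; have := (dvd_neg).mpr hp; convert this using 1; ring)
      (by rw [map_neg]; have := (dvd_neg).mpr hev; convert this using 1; ring)
      (neg_pos.mpr hneg)
    refine ⟨r, -ε, by rcases hε with h | h <;> simp [h], ?_⟩
    rw [C_neg]
    convert hr using 1; ring
  · have hcc : (C c⁻¹ : ℝ[X]) * C c = 1 := by rw [← C_mul, inv_mul_cancel₀ hc, C_1]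
    obtain ⟨h, hh, -⟩ := exists_inv_sqrt_mod (q := q) (y := C c⁻¹ * p - 1) n
      (by
        have := hp.mul_left (C c⁻¹)
        rwa [mul_sub, hcc] at this)
    -- `g(p)` is `p / √c` times an approximate `(p / c) ^ (-1/2)`, hence a square root of `p`. Being
    -- a polynomial in `p`, it is even modulo `q ^ n`, so its norm agrees with its square.
    set g : ℝ[X] := C (√c)⁻¹ * X * h.comp (C c⁻¹ * X - 1) with hg
    have hs : (C (√c)⁻¹ : ℝ[X]) ^ 2 = C c⁻¹ := by
      rw [← C_pow, inv_pow, Real.sq_sqrt hpos.le]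
    have hgp : g.comp p = C (√c)⁻¹ * p * h.comp (C c⁻¹ * p - 1) := by
      simp [hg, comp_assoc]
    refine ⟨g.comp p, 1, Or.inl rfl, ?_⟩
    have h1 : q ^ n ∣ algEquivAevalNegX (g.comp p) - g.comp p := by
      rw [algEquivAevalNegX_comp]
      exact hev.trans (comp_sub_comp_dvd _ _ _)
    have h2 : q ^ n ∣ g.comp p ^ 2 - p := by
      rw [hgp, mul_pow, mul_pow, hs]
      have := hh.mul_left p
      convert this using 1
      ring
    have := (h1.mul_right (g.comp p)).add h2
    convert this using 1
    rw [C_1]; ring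

end PolynomialSquareRoots

/-! ### Frobenius forms on `ℝ[X] / (q ^ n)`. -/

section Frobenius

lemma exists_isCoprime_of_not_pow_dvd {q p : ℝ[X]} (hq : Prime q) {n : ℕ} (h : ¬ q ^ n ∣ p) :
    ∃ a b : ℝ[X], ∃ i < n, a * p + b * q ^ n = q ^ i := by
  have hp : p ≠ 0 := by rintro rfl; simp at h
  obtain ⟨i, p', hp', hpe⟩ := WfDvdMonoid.max_power_factor hp hq.irreducible
  have hi : i < n := by
    by_contra hi
    exact h (hpe ▸ (pow_dvd_pow q (not_lt.mp hi)).mul_right _)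
  have hco : IsCoprime p' (q ^ (n - i)) :=
    ((hq.irreducible.coprime_iff_not_dvd).mpr hp').symm.pow_right
  obtain ⟨a, b, hab⟩ := hco
  refine ⟨a, b, i, hi, ?_⟩
  have : q ^ n = q ^ (n - i) * q ^ i := by rw [← pow_add]; congr 1; omega
  rw [this, hpe]
  linear_combination q ^ i * hab

/-- A linear functional on `ℝ[X] / (q ^ n)` not vanishing on the socle is a Frobenius form. -/
lemma pow_dvd_of_functional {q : ℝ[X]} (hq : Prime q) {n : ℕ} {l : ℝ[X] →ₗ[ℝ] ℝ}
    (h0 : ∀ t, l (q ^ n * t) = 0) (h1 : ∃ t, l (q ^ (n - 1) * t) ≠ 0) {p : ℝ[X]}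
    (hp : ∀ t, l (p * t) = 0) : q ^ n ∣ p := by
  by_contra h
  obtain ⟨a, b, i, hi, hab⟩ := exists_isCoprime_of_not_pow_dvd hq h
  obtain ⟨t, ht⟩ := h1
  apply ht
  have : q ^ (n - 1) * t = p * (a * q ^ (n - 1 - i) * t) + q ^ n * (b * q ^ (n - 1 - i) * t) := by
    have : q ^ (n - 1) = q ^ i * q ^ (n - 1 - i) := by rw [← pow_add]; congr 1; omega
    rw [this, ← hab]; ring
  rw [this, map_add, hp, h0, add_zero]

/-- The polynomials `π` span `ℝ[X]` modulo `m`. -/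
def SpansMod {ι : Type*} [Fintype ι] (m : ℝ[X]) (π : ι → ℝ[X]) : Prop :=
  ∀ t, ∃ c : ι → ℝ, m ∣ t - ∑ i, C (c i) * π i

lemma functional_eq_sum {ι : Type*} [Fintype ι] {m : ℝ[X]} {l : ℝ[X] →ₗ[ℝ] ℝ}
    (h0 : ∀ t, l (m * t) = 0) {π : ι → ℝ[X]} {t : ℝ[X]} {c : ι → ℝ}
    (h : m ∣ t - ∑ i, C (c i) * π i) (p : ℝ[X]) :
    l (p * t) = ∑ i, c i * l (p * π i) := by
  obtain ⟨k, hk⟩ := h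
  have : p * t = m * (p * k) + ∑ i, c i • (p * π i) := by
    rw [sub_eq_iff_eq_add] at hk
    rw [hk, mul_add, Finset.mul_sum]
    congr 1
    · ring
    · refine Finset.sum_congr rfl fun i _ => ?_
      rw [smul_eq_C_mul]; ring
  rw [this, map_add, h0, zero_add, map_sum]
  simp

/-- The Frobenius property makes `p ↦ l (p * ·)` injective on residues modulo `q ^ n`. Domain and
target have the same dimension, so every prescription of values on the `π i` is attained. -/
lemma exists_functional_eq {ι : Type*} [Fintype ι] {q : ℝ[X]} (hq : Prime q) {n : ℕ}
    {l : ℝ[X] →ₗ[ℝ] ℝ} (h0 : ∀ t, l (q ^ n * t) = 0) (h1 : ∃ t, l (q ^ (n - 1) * t) ≠ 0)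
    {π : ι → ℝ[X]} (hcard : Fintype.card ι = (q ^ n).natDegree) (hπ : SpansMod (q ^ n) π)
    (c : ι → ℝ) : ∃ p, ∀ i, l (p * π i) = c i := by
  let Φ : degreeLT ℝ (q ^ n).natDegree →ₗ[ℝ] (ι → ℝ) :=
    { toFun := fun p i => l (p * π i)
      map_add' := fun p p' => by ext i; simp [add_mul]
      map_smul' := fun r p => by ext i; simp }
  have hinj : Function.Injective Φ := by
    rw [injective_iff_map_eq_zero]
    rintro ⟨p, hp⟩ h
    have hz : ∀ t, l (p * t) = 0 := fun t => by
      obtain ⟨c, hc⟩ := hπ t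
      rw [functional_eq_sum h0 hc]
      exact Finset.sum_eq_zero fun i _ => by
        have := congrFun h i
        simp only [Φ, LinearMap.coe_mk, AddHom.coe_mk, Pi.zero_apply] at this
        rw [this, mul_zero]
    have hd := pow_dvd_of_functional hq h0 h1 hz
    have : p = 0 := by
      by_contra hp0
      have h1 := natDegree_le_of_dvd hd hp0
      rw [mem_degreeLT, degree_eq_natDegree hp0] at hp
      have : p.natDegree < (q ^ n).natDegree := by exact_mod_cast hp
      omega
    exact Subtype.ext this
  have hfin : Module.finrank ℝ (degreeLT ℝ (q ^ n).natDegree) = Module.finrank ℝ (ι → ℝ) := by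
    rw [(degreeLTEquiv ℝ _).finrank_eq]; simp [hcard]
  have : FiniteDimensional ℝ (degreeLT ℝ (q ^ n).natDegree) :=
    (degreeLTEquiv ℝ _).symm.finiteDimensional
  obtain ⟨p, hp⟩ := (LinearMap.injective_iff_surjective_of_finrank_eq_finrank hfin).mp hinj c
  exact ⟨p, fun i => congrFun hp i⟩

/-- An odd Frobenius form on `ℝ[X] / (q ^ n)`, with `q` even up to sign, can be normalised by a
rescaling with a norm `r(-X) r(X)`. -/
lemma exists_normalised_functional {ι : Type*} [Fintype ι] [DecidableEq ι] {q : ℝ[X]}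
    (hq : Prime q) {n : ℕ} (hn : 0 < n)
    {l : ℝ[X] →ₗ[ℝ] ℝ} (h0 : ∀ t, l (q ^ n * t) = 0) (h1 : ∃ t, l (q ^ (n - 1) * t) ≠ 0)
    (hodd : ∀ t, l (algEquivAevalNegX t) = - l t)
    {π : ι → ℝ[X]} (hcard : Fintype.card ι = (q ^ n).natDegree) (hπ : SpansMod (q ^ n) π)
    {σ : ι → ℝ} (hσ : ∀ i, algEquivAevalNegX (π i) = C (σ i) * π i) {i₀ : ι} (hi₀ : σ i₀ = -1)
    (hdiv : q ^ (n - 1) ∣ π i₀)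
    (hconst : ∀ p : ℝ[X], q ^ n ∣ algEquivAevalNegX p - p → ∃ c : ℝ, q ∣ p - C c) :
    ∃ (r : ℝ[X]) (ε : ℝ), (ε = 1 ∨ ε = -1) ∧ ¬ q ∣ r ∧
      ∀ i, l (algEquivAevalNegX r * r * π i) = if i = i₀ then ε else 0 := by
  -- This `p` rescales `l` to the functional dual to `π i₀`. Since `l` and `π i₀` are odd, the
  -- reflection of `p` has the same values, so `p` is even modulo `q ^ n` and is a norm up to sign.
  obtain ⟨p, hp⟩ := exists_functional_eq hq h0 h1 hcard hπ (fun i => if i = i₀ then 1 else 0)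
  have hev : q ^ n ∣ algEquivAevalNegX p - p := by
    refine pow_dvd_of_functional hq h0 h1 fun t => ?_
    obtain ⟨c, hc⟩ := hπ t
    rw [functional_eq_sum h0 hc]
    refine Finset.sum_eq_zero fun i _ => ?_
    have e : algEquivAevalNegX p * π i = C (σ i) * algEquivAevalNegX (p * π i) := by
      have : π i = C (σ i) * algEquivAevalNegX (π i) := by
        have := congrArg algEquivAevalNegX (hσ i)
        rwa [algEquivAevalNegX_algEquivAevalNegX, map_mul, algEquivAevalNegX_C] at this
      rw [map_mul]
      nth_rw 1 [this]
      ring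
    rw [sub_mul, map_sub, e, ← smul_eq_C_mul, map_smul, hodd, hp]
    by_cases h : i = i₀
    · subst h; simp [hi₀]
    · simp [h]
  obtain ⟨c, hc⟩ := hconst p hev
  -- Here `hdiv` matters: if `q` divided `p`, then `p * π i₀` would be divisible by `q ^ n` and `l`
  -- could not be `1` on it.
  have hc0 : c ≠ 0 := by
    rintro rfl
    rw [C_0, sub_zero] at hc
    obtain ⟨k, hk⟩ := mul_dvd_mul hc hdiv
    have h2 := hp i₀
    rw [← pow_succ', Nat.sub_add_cancel hn] at hk
    rw [hk, h0] at h2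
    simp at h2
  obtain ⟨r, ε, hε, hr⟩ := exists_norm_mod n hc0 hc hev
  refine ⟨r, ε, hε, ?_, fun i => ?_⟩
  · intro hqr
    have h3 : q ∣ C ε * p := by
      have := (dvd_sub_comm).mp ((dvd_pow_self q hn.ne').trans hr)
      have h4 := dvd_add this (hqr.mul_left (algEquivAevalNegX r))
      simpa using h4
    have h5 : q ∣ p := by
      rcases hε with h | h
      · simpa [h] using h3
      · simpa [h] using h3
    have : q ∣ C c := by
      have := dvd_sub h5 hc
      simpa using this
    exact hq.not_isUnit (isUnit_of_dvd_unit this (isUnit_C.mpr (isUnit_iff_ne_zero.mpr hc0)))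
  · obtain ⟨k, hk⟩ := hr
    have : algEquivAevalNegX r * r * π i = q ^ n * (k * π i) + ε • (p * π i) := by
      rw [sub_eq_iff_eq_add] at hk
      rw [hk, smul_eq_C_mul]; ring
    rw [this, map_add, h0, map_smul, hp]
    simp

end Frobenius

/-! ### Real Jordan blocks as multiplication by `X` on `ℝ[X] / (q ^ n)`. -/

section Blocks

namespace RealJordanBlock

/-- The monic irreducible polynomial of which a power is the characteristic polynomial of the
block. -/
noncomputable def poly : RealJordanBlock → ℝ[X]
  | .real _ l => X - C l
  | .complex _ a b _ => (X - C a) ^ 2 + C (b ^ 2)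

/-- The multiplicity of `poly` in the characteristic polynomial of the block. -/
def mult : RealJordanBlock → ℕ
  | .real n _ => n
  | .complex n _ _ _ => n

lemma monic_poly (b : RealJordanBlock) : b.poly.Monic := by
  cases b with
  | real n l => exact monic_X_sub_C l
  | complex n a b hb =>
    have : ((X - C a) ^ 2 + C (b ^ 2) : ℝ[X]).Monic := by
      apply ((monic_X_sub_C a).pow 2).add_of_left
      rw [degree_pow, degree_X_sub_C]
      exact lt_of_le_of_lt degree_C_le (by norm_num)
    exact this

lemma natDegree_poly_complex (n : ℕ) (a b : ℝ) (hb : 0 < b) :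
    (complex n a b hb).poly.natDegree = 2 := by
  simp only [poly]
  rw [natDegree_add_C, natDegree_pow, natDegree_X_sub_C]

lemma size_eq (b : RealJordanBlock) : b.size = b.mult * b.poly.natDegree := by
  cases b with
  | real n l => simp [size, mult, poly]
  | complex n a b hb => rw [natDegree_poly_complex]; rfl

lemma natDegree_poly_pow (b : RealJordanBlock) : (b.poly ^ b.mult).natDegree = b.size := by
  rw [natDegree_pow, size_eq]

lemma prime_poly (b : RealJordanBlock) : Prime b.poly := by
  cases b with
  | real n l => exact prime_X_sub_C l
  | complex n a b hb =>
    have hd := natDegree_poly_complex n a b hb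
    refine Irreducible.prime ?_
    rw [(monic_poly _).irreducible_iff_roots_eq_zero_of_degree_le_three (by omega) (by omega)]
    rw [Multiset.eq_zero_iff_forall_notMem]
    intro x hx
    have := (mem_roots'.mp hx).2
    simp only [poly, IsRoot.def, eval_add, eval_pow, eval_sub, eval_X, eval_C] at this
    nlinarith [sq_nonneg (x - a), pow_pos hb 2]

end RealJordanBlock

lemma sum_realBlock_smul {E : Type*} [AddCommGroup E] [Module ℝ E] (n : ℕ) (l : ℝ)
    (w : Fin n → E) (j : Fin n) :
    ∑ i, realBlock n l i j • w i
      = l • w j + if h : 0 < (j : ℕ) then w ⟨j - 1, by omega⟩ else 0 := by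
  have : ∀ i, realBlock n l i j • w i
      = (if i = j then l • w j else 0) + (if (i : ℕ) + 1 = j then w i else 0) := by
    intro i
    simp only [realBlock, Matrix.of_apply]
    split_ifs with h1 h2 h2
    · subst h1; omega
    · subst h1; simp
    · simp
    · simp
  simp_rw [this, Finset.sum_add_distrib]
  congr 1
  · simp
  · split_ifs with h
    · rw [Finset.sum_eq_single ⟨j - 1, by omega⟩]
      · simp only; rw [if_pos (by omega)]
      · intro i _ hi
        rw [if_neg]
        intro h'
        exact hi (Fin.ext (by simp; omega))
      · simp
    · exact Finset.sum_eq_zero fun i _ => if_neg (by omega)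

lemma sum_complexBlock_smul {E : Type*} [AddCommGroup E] [Module ℝ E] (n : ℕ) (a b : ℝ)
    (w : Fin n × Fin 2 → E) (j : Fin n) (s : Fin 2) :
    ∑ i, complexBlock n a b i (j, s) • w i
      = !![a, b; -b, a] 0 s • w (j, 0) + !![a, b; -b, a] 1 s • w (j, 1)
        + if h : 0 < (j : ℕ) then w (⟨j - 1, by omega⟩, s) else 0 := by
  have : ∀ i : Fin n, ∑ t : Fin 2, complexBlock n a b (i, t) (j, s) • w (i, t)
      = (if i = j then !![a, b; -b, a] 0 s • w (j, 0) + !![a, b; -b, a] 1 s • w (j, 1) else 0)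
        + (if (i : ℕ) + 1 = j then w (i, s) else 0) := by
    intro i
    simp only [complexBlock, Matrix.of_apply, Fin.sum_univ_two]
    by_cases h1 : i = j
    · subst h1; simp
    · by_cases h2 : (i : ℕ) + 1 = j
      · have e : ∀ t, (1 : Matrix (Fin 2) (Fin 2) ℝ) t s = if t = s then 1 else 0 :=
          fun t => Matrix.one_apply
        fin_cases s <;> simp_all
      · simp [h1, h2]
  rw [Fintype.sum_prod_type]
  simp_rw [this, Finset.sum_add_distrib]
  congr 1
  · simp
  · split_ifs with h
    · rw [Finset.sum_eq_single ⟨j - 1, by omega⟩]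
      · simp only; rw [if_pos (by omega)]
      · intro i _ hi
        rw [if_neg]
        intro h'
        exact hi (Fin.ext (by simp; omega))
      · simp
    · exact Finset.sum_eq_zero fun i _ => if_neg (by omega)

lemma sum_complex_matrix_smul {E : Type*} [AddCommGroup E] [Module ℝ E] (n : ℕ) (a b : ℝ)
    (hb : 0 < b) (w : Fin n × Fin 2 → E) (j : Fin n × Fin 2) :
    ∑ i : Fin (RealJordanBlock.complex n a b hb).size,
      (RealJordanBlock.complex n a b hb).matrix i (finProdFinEquiv j) •
        w (finProdFinEquiv.symm i)
      = ∑ i, complexBlock n a b i j • w i := by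
  change ∑ i : Fin (n * 2), Matrix.reindex finProdFinEquiv finProdFinEquiv (complexBlock n a b) i
    (finProdFinEquiv j) • w (finProdFinEquiv.symm i) = _
  rw [← finProdFinEquiv.sum_comp]
  simp

/-- The polynomials `π` satisfy modulo `poly ^ mult` the relations of a Jordan block, and span. -/
def IsBlockPoly (b : RealJordanBlock) (π : Fin b.size → ℝ[X]) : Prop :=
  (∀ j, b.poly ^ b.mult ∣ X * π j - ∑ i, b.matrix i j • π i) ∧ SpansMod (b.poly ^ b.mult) π

/-- The span of the `π i` modulo `m` contains `1` and is stable under multiplication by `X`. -/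
lemma spansMod_of_mul_X {ι : Type*} [Fintype ι] [DecidableEq ι] {m : ℝ[X]} {π : ι → ℝ[X]}
    {M : Matrix ι ι ℝ} (h : ∀ j, m ∣ X * π j - ∑ i, M i j • π i) {i₀ : ι} (h1 : π i₀ = 1) :
    SpansMod m π := by
  have hadd : ∀ t t' : ℝ[X], (∃ c : ι → ℝ, m ∣ t - ∑ i, C (c i) * π i) →
      (∃ c : ι → ℝ, m ∣ t' - ∑ i, C (c i) * π i) →
      ∃ c : ι → ℝ, m ∣ (t + t') - ∑ i, C (c i) * π i := by
    rintro t t' ⟨c, hc⟩ ⟨c', hc'⟩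
    refine ⟨c + c', ?_⟩
    have := dvd_add hc hc'
    convert this using 1
    simp only [Pi.add_apply, C_add, add_mul, Finset.sum_add_distrib]
    ring
  have hX : ∀ t : ℝ[X], (∃ c : ι → ℝ, m ∣ t - ∑ i, C (c i) * π i) →
      ∃ c : ι → ℝ, m ∣ X * t - ∑ i, C (c i) * π i := by
    rintro t ⟨c, hc⟩
    refine ⟨fun i => ∑ j, M i j * c j, ?_⟩
    have h2 : m ∣ ∑ j, C (c j) * (X * π j - ∑ i, M i j • π i) :=
      Finset.dvd_sum fun j _ => (h j).mul_left _
    have := dvd_add (hc.mul_left X) h2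
    convert this using 1
    simp only [mul_sub, Finset.sum_sub_distrib, Finset.mul_sum, map_sum, Finset.sum_mul]
    rw [Finset.sum_comm (f := fun i j => C (M i j * c j) * π i)]
    have : ∀ j, X * (C (c j) * π j) = C (c j) * (X * π j) := fun j => by ring
    simp only [this, sub_add_sub_cancel]
    congr 1
    refine Finset.sum_congr rfl fun j _ => Finset.sum_congr rfl fun i _ => ?_
    rw [smul_eq_C_mul, C_mul]; ring
  have h1' : ∀ a : ℝ, ∃ c : ι → ℝ, m ∣ C a - ∑ i, C (c i) * π i := fun a =>
    ⟨fun i => if i = i₀ then a else 0, by simp [h1, apply_ite (C : ℝ → ℝ[X])]⟩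
  intro t
  induction t using Polynomial.induction_on with
  | C a => exact h1' a
  | add p q hp hq => exact hadd p q hp hq
  | monomial k a ih =>
    have := hX _ ih
    rwa [show X * (C a * X ^ k) = C a * X ^ (k + 1) by ring] at this

/-- With ones on the superdiagonal the eigenvector comes first, so the exponents decrease: index `0`
carries the socle element `(X - l) ^ (n - 1)` and the last index carries `1`. -/
lemma isBlockPoly_real (n : ℕ) (l : ℝ) :
    IsBlockPoly (.real n l) (fun i : Fin n => (X - C l) ^ (n - 1 - (i : ℕ))) := by
  have h1 : ∀ j : Fin n, (X - C l : ℝ[X]) ^ n ∣ X * (X - C l) ^ (n - 1 - (j : ℕ)) -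
      ∑ i : Fin n, realBlock n l i j • (X - C l : ℝ[X]) ^ (n - 1 - (i : ℕ)) := by
    intro j
    rw [sum_realBlock_smul n l (fun i : Fin n => (X - C l : ℝ[X]) ^ (n - 1 - (i : ℕ)))]
    have e : (X - C l) * (X - C l : ℝ[X]) ^ (n - 1 - (j : ℕ)) = (X - C l : ℝ[X]) ^ (n - j) := by
      rw [← pow_succ']; congr 1; omega
    have : X * (X - C l : ℝ[X]) ^ (n - 1 - (j : ℕ)) - l • (X - C l : ℝ[X]) ^ (n - 1 - (j : ℕ))
      = (X - C l : ℝ[X]) ^ (n - j) := by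
      rw [← e, smul_eq_C_mul]; ring
    split_ifs with h
    · rw [← sub_sub, this]
      simp only
      rw [show n - 1 - (j - 1 : ℕ) = n - j by omega, sub_self]
      exact dvd_zero _
    · rw [add_zero, this, show n - (j : ℕ) = n by omega]
  refine ⟨h1, ?_⟩
  rcases Nat.eq_zero_or_pos n with rfl | hn
  · intro t
    exact ⟨0, by simp [RealJordanBlock.poly, RealJordanBlock.mult]⟩
  · exact spansMod_of_mul_X (m := (X - C l) ^ n) (i₀ := (⟨n - 1, by omega⟩ : Fin n)) h1 (by simp)

/-- A square root `j` of `-1` modulo `q ^ n`, where `q` is irreducible quadratic, congruent to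
the class of `-(X - a) / b` modulo `q`. -/
lemma exists_sq_eq_neg_one_mod (n : ℕ) (a b : ℝ) (hb : 0 < b) :
    ∃ j : ℝ[X], ((X - C a) ^ 2 + C (b ^ 2)) ^ n ∣ j ^ 2 + 1 ∧
      ((X - C a) ^ 2 + C (b ^ 2)) ∣ X - C a + C b * j ∧
      (a = 0 → algEquivAevalNegX j = -j) := by
  set q : ℝ[X] := (X - C a) ^ 2 + C (b ^ 2) with hq
  have hbb : (C b⁻¹ : ℝ[X]) * C b = 1 := by rw [← C_mul, inv_mul_cancel₀ hb.ne', C_1]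
  set y : ℝ[X] := -(C b⁻¹ ^ 2 * q) with hy
  obtain ⟨h, hh, hh1⟩ := exists_inv_sqrt_mod (q := q) (y := y) n
    ((Dvd.intro_left _ rfl).neg_right)
  -- `j₀ ^ 2` equals `-(1 + y)` with `y` divisible by `q`, so dividing `j₀` by a square root of `1 +
  -- y` gives an exact `-1` modulo `q ^ n`.
  set j₀ : ℝ[X] := -(C b⁻¹ * (X - C a)) with hj₀
  have hj : 1 + y = - j₀ ^ 2 := by
    rw [hy, hj₀, hq, C_pow]
    linear_combination -(C b⁻¹ * C b + 1) * hbb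
  refine ⟨j₀ * h.comp y, ?_, ?_, ?_⟩
  · have := hh.neg_right
    convert this using 1
    rw [hj]; ring
  · have := hh1.mul_left (-(X - C a))
    convert this using 1
    rw [hj₀]
    linear_combination (-(X - C a) * h.comp y) * hbb
  · rintro rfl
    have hqe : algEquivAevalNegX q = q := by
      rw [hq, map_add, map_pow, map_sub, algEquivAevalNegX_X, algEquivAevalNegX_C,
        algEquivAevalNegX_C]
      simp
    have hye : algEquivAevalNegX y = y := by
      rw [hy, map_neg, map_mul, map_pow, hqe, algEquivAevalNegX_C]
    rw [map_mul, algEquivAevalNegX_comp, hye, hj₀, map_neg, map_mul, map_sub,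
      algEquivAevalNegX_X, algEquivAevalNegX_C, algEquivAevalNegX_C, C_0]
    ring

/-- The block polynomials `j ^ s * N ^ (n - 1 - i)` of a complex block. -/
noncomputable def complexPoly (n : ℕ) (a b : ℝ) (j : ℝ[X]) (i : Fin n × Fin 2) : ℝ[X] :=
  j ^ (i.2 : ℕ) * (X - C a + C b * j) ^ (n - 1 - (i.1 : ℕ))

/-- Modulo `q ^ n` one has `X = a - b j + N` with `j ^ 2 = -1` and `N` nilpotent, the additive
Jordan decomposition. The pair `1, j` reproduces the columns of `[a, b; -b, a]` and powers of `N`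
give the superdiagonal identities; this fixes the sign of `j`. -/
lemma isBlockPoly_complex (n : ℕ) (a b : ℝ) (hb : 0 < b) {j : ℝ[X]}
    (h1 : ((X - C a) ^ 2 + C (b ^ 2)) ^ n ∣ j ^ 2 + 1)
    (h2 : ((X - C a) ^ 2 + C (b ^ 2)) ∣ X - C a + C b * j) :
    IsBlockPoly (.complex n a b hb)
      (fun i => complexPoly n a b j (finProdFinEquiv.symm i)) := by
  set q : ℝ[X] := (X - C a) ^ 2 + C (b ^ 2) with hq
  set N : ℝ[X] := X - C a + C b * j with hN
  have hNn : q ^ n ∣ N ^ n := pow_dvd_pow_of_dvd h2 n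
  have key : ∀ k : Fin n × Fin 2, q ^ n ∣ X * complexPoly n a b j k -
      ∑ i, complexBlock n a b i k • complexPoly n a b j i := by
    rintro ⟨k, s⟩
    rw [sum_complexBlock_smul]
    have e : N * N ^ (n - 1 - (k : ℕ)) = N ^ (n - (k : ℕ)) := by
      rw [← pow_succ']; congr 1; omega
    have e2 : q ^ n ∣ j ^ (s : ℕ) * N ^ (n - (k : ℕ)) -
        if h : 0 < (k : ℕ) then complexPoly n a b j (⟨k - 1, by omega⟩, s) else 0 := by
      split_ifs with h
      · simp only [complexPoly]
        rw [show n - 1 - (k - 1 : ℕ) = n - k by omega, sub_self]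
        exact dvd_zero _
      · rw [sub_zero, show n - (k : ℕ) = n by omega]
        exact hNn.mul_left _
    have e3 : q ^ n ∣ X * complexPoly n a b j (k, s) -
        (!![a, b; -b, a] 0 s • complexPoly n a b j (k, 0) +
          !![a, b; -b, a] 1 s • complexPoly n a b j (k, 1)) - j ^ (s : ℕ) * N ^ (n - (k : ℕ)) := by
      rw [← e]
      fin_cases s
      · convert dvd_zero (q ^ n) using 1
        simp only [complexPoly, smul_eq_C_mul, ← hN]
        simp
        rw [hN]; ring
      · have := (h1.mul_left (-(C b * N ^ (n - 1 - (k : ℕ)))))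
        convert this using 1
        simp only [complexPoly, smul_eq_C_mul, ← hN]
        simp
        rw [hN]; ring
    have := dvd_add e3 e2
    convert this using 1
    ring
  have h3 : ∀ k, (RealJordanBlock.complex n a b hb).poly ^
      (RealJordanBlock.complex n a b hb).mult ∣
      X * complexPoly n a b j (finProdFinEquiv.symm k) -
      ∑ i, (RealJordanBlock.complex n a b hb).matrix i k •
        complexPoly n a b j (finProdFinEquiv.symm i) := by
    intro k
    obtain ⟨k, rfl⟩ := finProdFinEquiv.surjective k
    rw [sum_complex_matrix_smul, Equiv.symm_apply_apply]
    exact key k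
  refine ⟨h3, ?_⟩
  rcases Nat.eq_zero_or_pos n with rfl | hn
  · intro t
    exact ⟨0, by simp [RealJordanBlock.poly, RealJordanBlock.mult]⟩
  · exact spansMod_of_mul_X (i₀ := finProdFinEquiv (⟨n - 1, by omega⟩, 0)) h3
      (by simp [complexPoly])

lemma exists_isBlockPoly (b : RealJordanBlock) : ∃ π, IsBlockPoly b π := by
  cases b with
  | real n l => exact ⟨_, isBlockPoly_real n l⟩
  | complex n a b hb =>
    obtain ⟨j, h1, h2, -⟩ := exists_sq_eq_neg_one_mod n a b hb
    exact ⟨_, isBlockPoly_complex n a b hb h1 h2⟩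

end Blocks

/-! ### Monomial Gram matrices. -/

section Monomial

/-- A matrix with exactly one nonzero entry in each row, which is `1` or `-1`. -/
def IsMonomial {ι : Type*} (G : ι → ι → ℝ) : Prop :=
  ∃ (ρ : ι → ι) (s : ι → ℝ), (∀ i, s i = 1 ∨ s i = -1) ∧
    ∀ i k, (k = ρ i → G i k = s i) ∧ (k ≠ ρ i → G i k = 0)

lemma IsMonomial.comp_equiv {ι κ : Type*} {G : ι → ι → ℝ} (h : IsMonomial G) (e : κ ≃ ι) :
    IsMonomial (fun i k => G (e i) (e k)) := by
  obtain ⟨ρ, s, hs, h⟩ := h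
  refine ⟨fun i => e.symm (ρ (e i)), fun i => s (e i), fun i => hs _, fun i k => ⟨?_, ?_⟩⟩
  · rintro rfl
    exact (h _ _).1 (by simp)
  · intro hk
    refine (h _ _).2 fun h' => hk ?_
    beta_reduce
    rw [← h', Equiv.symm_apply_apply]

end Monomial

/-! ### Normal forms of odd functionals at the self-dual primes `X` and `X ^ 2 + b ^ 2`. -/

section SelfDual

lemma neg_one_pow_eq_or' (n : ℕ) : (-1 : ℝ) ^ n = 1 ∨ (-1 : ℝ) ^ n = -1 :=
  neg_one_pow_eq_or ℝ n

/-- For even `n` the socle element `X ^ (n - 1)` is odd, as normalisation against it requires; the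
residue of any polynomial modulo `X` is constant. -/
lemma exists_normalised_real {n : ℕ} (hn : 0 < n) (heven : Even n) {l : ℝ[X] →ₗ[ℝ] ℝ}
    (h0 : ∀ t, l (X ^ n * t) = 0) (h1 : ∃ t, l (X ^ (n - 1) * t) ≠ 0)
    (hodd : ∀ t, l (algEquivAevalNegX t) = - l t) :
    ∃ (r : ℝ[X]) (ε : ℝ), (ε = 1 ∨ ε = -1) ∧ ¬ X ∣ r ∧
      ∀ m, l (algEquivAevalNegX r * r * X ^ m) = if m + 1 = n then ε else 0 := by
  have hπ := (isBlockPoly_real n 0).2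
  simp only [RealJordanBlock.poly, RealJordanBlock.mult, C_0, sub_zero] at hπ
  obtain ⟨r, ε, hε, hr, h⟩ := exists_normalised_functional (ι := Fin n) prime_X hn h0 h1 hodd
    (by rw [natDegree_X_pow]; exact Fintype.card_fin n) hπ (σ := fun i => (-1) ^ (n - 1 - (i : ℕ)))
    (fun i => by rw [map_pow, algEquivAevalNegX_X, neg_pow, C_pow, C_neg, C_1])
    (i₀ := ⟨0, hn⟩) (by
      have : Odd (n - 1) := Nat.Even.sub_odd hn heven odd_one
      simpa using this.neg_one_pow) (by simp)
    (fun p _ => ⟨p.coeff 0, by simp [X_dvd_iff]⟩)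
  refine ⟨r, ε, hε, hr, fun m => ?_⟩
  by_cases hm : m < n
  · have := h ⟨n - 1 - m, by omega⟩
    simp only [Fin.mk.injEq] at this
    rw [show n - 1 - (n - 1 - m) = m by omega] at this
    rw [this]
    exact if_congr (by omega) rfl rfl
  · rw [if_neg (by omega)]
    rw [show algEquivAevalNegX r * r * X ^ m
      = X ^ n * (algEquivAevalNegX r * r * X ^ (m - n)) by
        rw [show m = n + (m - n) by omega, pow_add]
        rw [show n + (m - n) - n = m - n by omega]; ring]
    exact h0 _

/-- Both `j` and `N` are odd, so each `j ^ s * N ^ m` is an eigenvector of the involution. For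
either parity of `n` one of the socle elements `N ^ (n - 1)`, `j * N ^ (n - 1)` is odd, so no parity
condition is needed. -/
lemma exists_normalised_complex {n : ℕ} (hn : 0 < n) {b : ℝ} (hb : 0 < b) {l : ℝ[X] →ₗ[ℝ] ℝ}
    (h0 : ∀ t, l ((RealJordanBlock.complex n 0 b hb).poly ^ n * t) = 0)
    (h1 : ∃ t, l ((RealJordanBlock.complex n 0 b hb).poly ^ (n - 1) * t) ≠ 0)
    (hodd : ∀ t, l (algEquivAevalNegX t) = - l t) :
    ∃ (r : ℝ[X]) (π : Fin (RealJordanBlock.complex n 0 b hb).size → ℝ[X]),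
      IsBlockPoly (.complex n 0 b hb) π ∧
      IsMonomial (fun i k => l (algEquivAevalNegX (π k * r) * (π i * r))) := by
  obtain ⟨j, hj1, hj2, hj3⟩ := exists_sq_eq_neg_one_mod n 0 b hb
  have hj3 := hj3 rfl
  set q : ℝ[X] := (X - C 0) ^ 2 + C (b ^ 2) with hq
  set N : ℝ[X] := X - C 0 + C b * j with hN
  have hqpoly : (RealJordanBlock.complex n 0 b hb).poly = q := rfl
  have hbp := isBlockPoly_complex n 0 b hb hj1 hj2
  have hNneg : algEquivAevalNegX N = - N := by
    rw [hN, map_add, map_mul, map_sub, hj3, algEquivAevalNegX_X, algEquivAevalNegX_C,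
      algEquivAevalNegX_C, C_0]
    ring
  have hqneg : algEquivAevalNegX q = q := by
    rw [hq, map_add, map_pow, map_sub, algEquivAevalNegX_X, algEquivAevalNegX_C,
      algEquivAevalNegX_C]
    simp
  have hqp : Prime q := (RealJordanBlock.complex n 0 b hb).prime_poly
  have hqd : q.natDegree = 2 := RealJordanBlock.natDegree_poly_complex n 0 b hb
  -- Chosen so that `j ^ s₀ * N ^ (n - 1)` is the odd socle element.
  let s₀ : Fin 2 := if Even n then 0 else 1
  let σ : Fin n × Fin 2 → ℝ := fun i => (-1) ^ ((i.2 : ℕ) + (n - 1 - (i.1 : ℕ)))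
  have hσ : ∀ i, algEquivAevalNegX (complexPoly n 0 b j i) = C (σ i) * complexPoly n 0 b j i := by
    intro i
    simp only [complexPoly, ← hN, map_mul, map_pow, hNneg, hj3, σ]
    rw [neg_pow, neg_pow N, C_neg, C_1, pow_add]; ring
  have hspan : SpansMod (q ^ n) (complexPoly n 0 b j) := by
    intro t
    obtain ⟨c, hc⟩ := hbp.2 t
    refine ⟨fun i => c (finProdFinEquiv i), ?_⟩
    have e : ∑ i : Fin (n * 2), C (c i) * complexPoly n 0 b j (finProdFinEquiv.symm i)
        = ∑ i, C (c (finProdFinEquiv i)) * complexPoly n 0 b j i := by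
      rw [← finProdFinEquiv.sum_comp]; simp
    rw [← e]
    exact hc
  obtain ⟨r, ε, hε, -, h⟩ := exists_normalised_functional (ι := Fin n × Fin 2) hqp hn h0 h1 hodd
    (by rw [natDegree_pow, hqd]; simp) hspan hσ (i₀ := (⟨0, hn⟩, s₀))
    (by
      simp only [σ, s₀]
      split_ifs with he
      · have : Odd (n - 1) := Nat.Even.sub_odd hn he odd_one
        simpa using this.neg_one_pow
      · have : Odd n := Nat.not_even_iff_odd.mp he
        have : 1 + (n - 1) = n := by omega
        simp only [Fin.isValue, Fin.val_one, tsub_zero, this]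
        exact Odd.neg_one_pow ‹_›)
    (by
      simp only [complexPoly, tsub_zero]
      exact (pow_dvd_pow_of_dvd hj2 _).mul_left _)
    (fun p hp => by
      have hmonic : q.Monic := RealJordanBlock.monic_poly (.complex n 0 b hb)
      have hd : (p %ₘ q).natDegree < 2 := by
        have := natDegree_modByMonic_lt p hmonic (by intro h; rw [h] at hqd; simp at hqd)
        omega
      obtain ⟨d, c, hdc⟩ := exists_eq_X_add_C_of_natDegree_le_one
        (show (p %ₘ q).natDegree ≤ 1 by omega)
      have hpd : q ∣ p - (C d * X + C c) := by
        rw [← hdc]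
        exact ⟨p /ₘ q, by linear_combination -(modByMonic_add_div p q)⟩
      -- Evenness puts `2 d X` in the ideal of the quadratic `q`, which forces `d = 0` by degree.
      have hd0 : d = 0 := by
        have h2 : q ∣ algEquivAevalNegX p - (C d * (-X) + C c) := by
          obtain ⟨k, hk⟩ := hpd
          have := congrArg algEquivAevalNegX hk
          rw [map_mul, hqneg, map_sub, map_add, map_mul, algEquivAevalNegX_C,
            algEquivAevalNegX_C, algEquivAevalNegX_X] at this
          exact ⟨_, this⟩
        have h3 : q ∣ C (2 * d) * X := by
          have := dvd_sub (dvd_add ((dvd_pow_self q hn.ne').trans hp) hpd) h2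
          have h4 : C (2 * d) * X = -(algEquivAevalNegX p - p + (p - (C d * X + C c)) -
            (algEquivAevalNegX p - (C d * (-X) + C c))) := by
            rw [C_mul, C_ofNat]; ring
          rw [h4]; exact this.neg_right
        by_contra hd0
        have h5 : (C (2 * d) * X : ℝ[X]) ≠ 0 :=
          mul_ne_zero (C_ne_zero.mpr (mul_ne_zero two_ne_zero hd0)) X_ne_zero
        have := natDegree_le_of_dvd h3 h5
        have h6 : (C (2 * d) * X : ℝ[X]).natDegree ≤ 1 :=
          (natDegree_C_mul_le _ _).trans natDegree_X_le
        omega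
      exact ⟨c, by simpa [hd0] using hpd⟩)
  set L : ℝ[X] → ℝ := fun p => l (algEquivAevalNegX r * r * p) with hL
  have hLdvd : ∀ p, q ^ n ∣ p → L p = 0 := by
    rintro p ⟨k, rfl⟩
    simp only [hL]
    rw [show algEquivAevalNegX r * r * (q ^ n * k) = q ^ n * (algEquivAevalNegX r * r * k) by ring]
    exact h0 _
  have hLm : ∀ (m : ℕ) (s : Fin 2), L (j ^ (s : ℕ) * N ^ m) =
      if m + 1 = n ∧ s = s₀ then ε else 0 := by
    intro m s
    by_cases hm : m < n
    · have := h (⟨n - 1 - m, by omega⟩, s)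
      simp only [complexPoly, ← hN, Prod.mk.injEq, Fin.mk.injEq] at this
      rw [show n - 1 - (n - 1 - m) = m by omega] at this
      rw [hL]
      simp only
      rw [this]
      exact if_congr (and_congr_left fun _ => by omega) rfl rfl
    · rw [if_neg (by omega)]
      refine hLdvd _ (Dvd.dvd.mul_left ?_ _)
      exact (pow_dvd_pow_of_dvd hj2 n).trans (pow_dvd_pow _ (not_lt.mp hm))
  -- Since `j ^ 2 = -1` modulo `q ^ n`, the exponent `2` arising from two factors `j` folds back to
  -- `0` with a sign.
  have hL2 : ∀ m, L (j ^ 2 * N ^ m) = - L (j ^ ((0 : Fin 2) : ℕ) * N ^ m) := by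
    intro m
    have := hLdvd ((j ^ 2 + 1) * N ^ m) (hj1.mul_right _)
    simp only [hL] at this ⊢
    rw [show algEquivAevalNegX r * r * ((j ^ 2 + 1) * N ^ m) = algEquivAevalNegX r * r *
      (j ^ 2 * N ^ m) + algEquivAevalNegX r * r * (j ^ ((0 : Fin 2) : ℕ) * N ^ m) by simp; ring,
      map_add] at this
    linarith
  refine ⟨r, _, hbp, ?_⟩
  refine IsMonomial.comp_equiv (G := fun i k => l (algEquivAevalNegX (complexPoly n 0 b j k * r) *
      (complexPoly n 0 b j i * r))) ?_ finProdFinEquiv.symm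
  have hG : ∀ i k, l (algEquivAevalNegX (complexPoly n 0 b j k * r) *
      (complexPoly n 0 b j i * r)) = σ k * L (j ^ ((i.2 : ℕ) + (k.2 : ℕ)) *
        N ^ ((n - 1 - (i.1 : ℕ)) + (n - 1 - (k.1 : ℕ)))) := by
    intro i k
    have : algEquivAevalNegX (complexPoly n 0 b j k * r) * (complexPoly n 0 b j i * r)
        = σ k • (algEquivAevalNegX r * r * (j ^ ((i.2 : ℕ) + (k.2 : ℕ)) *
        N ^ ((n - 1 - (i.1 : ℕ)) + (n - 1 - (k.1 : ℕ))))) := by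
      rw [map_mul, hσ, smul_eq_C_mul]
      simp only [complexPoly, ← hN]
      rw [pow_add, pow_add]; ring
    rw [this, map_smul]; rfl
  have hσ1 : ∀ k, σ k = 1 ∨ σ k = -1 := fun k => neg_one_pow_eq_or' _
  -- The functional sees only total `N`-exponent `n - 1` and total `j`-exponent `s₀` modulo `2`,
  -- which leaves one partner per index.
  refine ⟨fun i => (Fin.rev i.1, s₀ - i.2), fun i => σ (Fin.rev i.1, s₀ - i.2) *
    (if (i.2 : ℕ) + ((s₀ - i.2 : Fin 2) : ℕ) = 2 then -ε else ε), ?_, ?_⟩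
  · intro i
    rcases hσ1 (Fin.rev i.1, s₀ - i.2) with h | h <;> rcases hε with h' | h' <;>
      beta_reduce <;> rw [h, h'] <;> split_ifs <;> simp
  · rintro ⟨i, s⟩ ⟨k, t⟩
    have hs2 : ∀ s t : Fin 2, (s : ℕ) + (t : ℕ) = 2 ∨
        ∃ u : Fin 2, (s : ℕ) + (t : ℕ) = u ∧ u = s + t := by decide
    have hs3 : ∀ s t : Fin 2, (s : ℕ) + (t : ℕ) = 2 → s + t = 0 := by decide
    have hs4 : ∀ s t s₀ : Fin 2, s + t = s₀ ↔ t = s₀ - s := by decide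
    have hs5 : ∀ u : Fin 2, (u : ℕ) ≠ 2 := by decide
    have hmain : L (j ^ ((s : ℕ) + (t : ℕ)) * N ^ ((n - 1 - (i : ℕ)) + (n - 1 - (k : ℕ)))) =
        if k = Fin.rev i ∧ t = s₀ - s then
          (if (s : ℕ) + (t : ℕ) = 2 then -ε else ε) else 0 := by
      have hc1 : (n - 1 - (i : ℕ)) + (n - 1 - (k : ℕ)) + 1 = n ↔ k = Fin.rev i := by
        rw [Fin.ext_iff, Fin.val_rev]; omega
      rcases hs2 s t with h | ⟨u, hu, hu'⟩
      · rw [h, hL2, hLm, if_pos rfl, if_congr (and_congr hc1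
          (show (0 : Fin 2) = s₀ ↔ t = s₀ - s by rw [← hs4, hs3 s t h])) rfl rfl]
        split_ifs <;> simp
      · rw [hu, hLm, if_neg (hs5 _), if_congr (and_congr hc1
          (show u = s₀ ↔ t = s₀ - s by rw [hu', hs4])) rfl rfl]
    beta_reduce
    rw [hG]
    refine ⟨?_, ?_⟩
    · intro h
      rw [Prod.mk.injEq] at h
      simp only at h ⊢
      rw [hmain, if_pos h]
      obtain ⟨rfl, rfl⟩ := h
      rfl
    · intro h
      rw [ne_eq, Prod.mk.injEq] at h
      simp only at h ⊢
      rw [hmain, if_neg h, mul_zero]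

end SelfDual

/-! ### Jordan families and cyclic subspaces. -/

section Families

variable {V : Type*} [AddCommGroup V] [Module ℝ V]

/-- The matrix of `A` on the family `v` is a direct sum of real Jordan blocks, up to a reindexing
of the family. -/
def IsBlockFamily {ι : Type} (A : Module.End ℝ V) (v : ι → V) : Prop :=
  ∃ (κ : Type) (_ : Fintype κ) (B : κ → RealJordanBlock) (ε : (Σ k, Fin (B k).size) ≃ ι),
    ∀ k j, A (v (ε ⟨k, j⟩)) = ∑ i, (B k).matrix i j • v (ε ⟨k, i⟩)

lemma IsBlockFamily.of_block {A : Module.End ℝ V} {b : RealJordanBlock} {v : Fin b.size → V}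
    (h : ∀ j, A (v j) = ∑ i, b.matrix i j • v i) : IsBlockFamily A v :=
  ⟨Unit, inferInstance, fun _ => b, Equiv.uniqueSigma (fun _ : Unit => Fin b.size),
    fun _ j => h j⟩

lemma IsBlockFamily.sum {ι κ : Type} {A : Module.End ℝ V} {v : ι → V} {w : κ → V}
    (hv : IsBlockFamily A v) (hw : IsBlockFamily A w) : IsBlockFamily A (Sum.elim v w) := by
  obtain ⟨K, hK, B, ε, h⟩ := hv
  obtain ⟨K', hK', B', ε', h'⟩ := hw
  refine ⟨K ⊕ K', inferInstance, Sum.elim B B',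
    (Equiv.sumSigmaDistrib _).trans (Equiv.sumCongr ε ε'), ?_⟩
  rintro (k | k) j
  · exact h k j
  · exact h' k j

lemma IsBlockFamily.span_invariant {ι : Type} {A : Module.End ℝ V} {v : ι → V}
    (hv : IsBlockFamily A v) {y : V} (hy : y ∈ Submodule.span ℝ (Set.range v)) :
    A y ∈ Submodule.span ℝ (Set.range v) := by
  obtain ⟨K, hK, B, ε, h⟩ := hv
  induction hy using Submodule.span_induction with
  | mem y hy =>
    obtain ⟨i, rfl⟩ := hy
    obtain ⟨⟨k, j⟩, rfl⟩ := ε.surjective i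
    rw [h]
    exact Submodule.sum_mem _ fun i _ => Submodule.smul_mem _ _ (Submodule.subset_span ⟨_, rfl⟩)
  | zero => simp
  | add x y _ _ hx hy => rw [map_add]; exact Submodule.add_mem _ hx hy
  | smul a x _ hx => rw [map_smul]; exact Submodule.smul_mem _ _ hx

/-- The cyclic subspace generated by `x`. -/
noncomputable def cyc (A : Module.End ℝ V) (x : V) : Submodule ℝ V :=
  LinearMap.range ((LinearMap.applyₗ x).comp (aeval A).toLinearMap)

lemma mem_cyc {A : Module.End ℝ V} {x y : V} : y ∈ cyc A x ↔ ∃ p : ℝ[X], aeval A p x = y := by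
  simp [cyc]

lemma aeval_mem_of_invariant {A : Module.End ℝ V} {W : Submodule ℝ V}
    (hW : ∀ w ∈ W, A w ∈ W) (p : ℝ[X]) {w : V} (hw : w ∈ W) : aeval A p w ∈ W := by
  induction p using Polynomial.induction_on generalizing w with
  | C a => simpa [Module.algebraMap_end_apply] using W.smul_mem a hw
  | add p q hp hq =>
    rw [map_add, LinearMap.add_apply]; exact W.add_mem (hp hw) (hq hw)
  | monomial n a ih =>
    rw [pow_succ, ← mul_assoc, map_mul, aeval_X, Module.End.mul_apply]
    exact ih (hW w hw)

lemma aeval_apply_eq_zero_of_dvd {A : Module.End ℝ V} {p q : ℝ[X]} (h : p ∣ q) {x : V}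
    (hx : aeval A p x = 0) : aeval A q x = 0 := by
  obtain ⟨k, rfl⟩ := h
  rw [mul_comm, map_mul, Module.End.mul_apply, hx, map_zero]

lemma aeval_sum_smul (A : Module.End ℝ V) {ι : Type*} [Fintype ι] (c : ι → ℝ) (π : ι → ℝ[X])
    (x : V) : aeval A (∑ i, c i • π i) x = ∑ i, c i • aeval A (π i) x := by
  simp [LinearMap.sum_apply]

lemma IsBlockPoly.family {A : Module.End ℝ V} {b : RealJordanBlock} {π : Fin b.size → ℝ[X]}
    (hπ : IsBlockPoly b π) {x : V} (hx : aeval A (b.poly ^ b.mult) x = 0) (j : Fin b.size) :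
    A (aeval A (π j) x) = ∑ i, b.matrix i j • aeval A (π i) x := by
  have := aeval_apply_eq_zero_of_dvd (hπ.1 j) hx
  rwa [map_sub, LinearMap.sub_apply, sub_eq_zero, map_mul, aeval_X, Module.End.mul_apply,
    aeval_sum_smul] at this

lemma SpansMod.span_eq_cyc {ι : Type*} [Fintype ι] {A : Module.End ℝ V} {m : ℝ[X]}
    {π : ι → ℝ[X]} (hπ : SpansMod m π) {x : V} (hx : aeval A m x = 0) :
    Submodule.span ℝ (Set.range fun i => aeval A (π i) x) = cyc A x := by
  apply le_antisymm
  · rw [Submodule.span_le]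
    rintro _ ⟨i, rfl⟩
    exact mem_cyc.mpr ⟨_, rfl⟩
  · intro y hy
    obtain ⟨p, rfl⟩ := mem_cyc.mp hy
    obtain ⟨c, hc⟩ := hπ p
    have := aeval_apply_eq_zero_of_dvd hc hx
    simp_rw [← smul_eq_C_mul] at this
    rw [map_sub, LinearMap.sub_apply, sub_eq_zero, aeval_sum_smul] at this
    rw [this]
    exact Submodule.sum_mem _ fun i _ => Submodule.smul_mem _ _ (Submodule.subset_span ⟨_, rfl⟩)

end Families

/-! ### Minus the transpose of a Jordan block. -/

section DualBlock

/-- Reversing the chain undoes the transposition of the superdiagonal, and alternating signs undo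
the negation there; the eigenvalue changes sign. For a complex block, minus the transpose of `[a, b;
-b, a]` is `[-a, b; -b, -a]`, so the pair inside each block row keeps its order and `b` stays
positive. -/
lemma RealJordanBlock.exists_dual (b : RealJordanBlock) :
    ∃ (b' : RealJordanBlock) (ρ : Fin b'.size ≃ Fin b.size) (s : Fin b'.size → ℝ),
      (∀ i, s i = 1 ∨ s i = -1) ∧
      ∀ i j, b'.matrix i j = -(s i * s j * b.matrix (ρ j) (ρ i)) := by
  have hsgn : ∀ i j : ℕ, i + 1 = j → (-1 : ℝ) ^ i * (-1) ^ j = -1 := by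
    rintro i _ rfl
    rw [pow_succ, ← mul_assoc, ← mul_pow]; simp
  have hsq : ∀ i : ℕ, (-1 : ℝ) ^ i * (-1) ^ i = 1 := by
    intro i; rw [← mul_pow]; simp
  cases b with
  | real n l =>
    refine ⟨.real n (-l), (Fin.revPerm : Equiv.Perm (Fin n)),
      fun i : Fin n => (-1) ^ (i : ℕ), fun i => neg_one_pow_eq_or' _, ?_⟩
    intro (i : Fin n) (j : Fin n)
    change realBlock n (-l) i j = -((-1) ^ (i : ℕ) * (-1) ^ (j : ℕ) *
      realBlock n l (Fin.rev j) (Fin.rev i))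
    have : ((Fin.rev j : Fin n) : ℕ) + 1 = (Fin.rev i : Fin n) ↔ (i : ℕ) + 1 = j := by
      rw [Fin.val_rev, Fin.val_rev]; omega
    simp only [realBlock, Matrix.of_apply, Fin.rev_inj, eq_comm (a := j), this]
    split_ifs with h1 h2
    · subst h1; rw [hsq]; simp
    · rw [hsgn _ _ h2]; simp
    · simp
  | complex n a b hb =>
    let R : Fin (n * 2) ≃ Fin (n * 2) :=
      (finProdFinEquiv.symm.trans ((Fin.revPerm : Equiv.Perm (Fin n)).prodCongr
        (Equiv.refl (Fin 2)))).trans finProdFinEquiv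
    refine ⟨.complex n (-a) b hb, R,
      fun i : Fin (n * 2) => (-1) ^ ((finProdFinEquiv.symm i).1 : ℕ),
      fun i => neg_one_pow_eq_or' _, ?_⟩
    intro (i : Fin (n * 2)) (j : Fin (n * 2))
    obtain ⟨⟨i, s⟩, rfl⟩ := finProdFinEquiv.surjective i
    obtain ⟨⟨j, t⟩, rfl⟩ := finProdFinEquiv.surjective j
    have e1 : (RealJordanBlock.complex n (-a) b hb).matrix (finProdFinEquiv (i, s))
      (finProdFinEquiv (j, t)) = complexBlock n (-a) b (i, s) (j, t) := by
      change complexBlock n (-a) b (finProdFinEquiv.symm _) (finProdFinEquiv.symm _) = _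
      simp
    have e2 : (RealJordanBlock.complex n a b hb).matrix (R (finProdFinEquiv (j, t)))
      (R (finProdFinEquiv (i, s))) = complexBlock n a b (Fin.rev j, t) (Fin.rev i, s) := by
      change complexBlock n a b (finProdFinEquiv.symm _) (finProdFinEquiv.symm _) = _
      simp [R]
    have key : complexBlock n (-a) b (i, s) (j, t) =
        -((-1) ^ (i : ℕ) * (-1) ^ (j : ℕ) * complexBlock n a b (Fin.rev j, t) (Fin.rev i, s)) := by
      have : ((Fin.rev j : Fin n) : ℕ) + 1 = (Fin.rev i : Fin n) ↔ (i : ℕ) + 1 = j := by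
        rw [Fin.val_rev, Fin.val_rev]; omega
      simp only [complexBlock, Matrix.of_apply, Fin.rev_inj, eq_comm (a := j), this]
      split_ifs with h1 h2
      · subst h1; rw [hsq]; fin_cases s <;> fin_cases t <;> simp
      · rw [hsgn _ _ h2, Matrix.one_apply, Matrix.one_apply]; simp [eq_comm]; split_ifs <;> simp
      · simp
    refine e1.trans (key.trans ?_)
    rw [← e2]
    simp only [Equiv.symm_apply_apply]
    rfl

end DualBlock

/-! ### Skew endomorphisms: adjoints, pairings and dual Jordan families. -/

section Forms

variable {V : Type*} [AddCommGroup V] [Module ℝ V]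
  {A : Module.End ℝ V} {β : LinearMap.BilinForm ℝ V}

/-- Each factor `X` moved across the form contributes a sign, so adjunction is the substitution `X ↦
-X`. All later uses of skewness pass through this. -/
lemma aeval_adjoint (hA : ∀ y z, β (A y) z = -β y (A z)) (p : ℝ[X]) (y z : V) :
    β (aeval A p y) z = β y (aeval A (algEquivAevalNegX p) z) := by
  induction p using Polynomial.induction_on generalizing y z with
  | C a => simp [Module.algebraMap_end_apply]
  | add p q hp hq => simp only [map_add, LinearMap.add_apply, hp, hq]
  | monomial n a ih =>
    have : algEquivAevalNegX (C a * X ^ n * X) = -(X * algEquivAevalNegX (C a * X ^ n)) := by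
      rw [map_mul, algEquivAevalNegX_X]; ring
    rw [pow_succ, ← mul_assoc, this]
    generalize algEquivAevalNegX (C a * X ^ n) = w at ih ⊢
    rw [map_mul, aeval_X, Module.End.mul_apply, ih, map_neg, map_mul,
      aeval_X, LinearMap.neg_apply, Module.End.mul_apply, map_neg, ← hA, ← ih]

variable (A β) in
/-- The functional `t ↦ β (t(A) x, y)`. -/
noncomputable def pairing (x y : V) : ℝ[X] →ₗ[ℝ] ℝ :=
  (β.flip y).comp ((LinearMap.applyₗ x).comp (aeval A).toLinearMap)

lemma pairing_apply (x y : V) (t : ℝ[X]) : pairing A β x y t = β (aeval A t x) y := by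
  simp [pairing]

lemma pairing_mul_aeval (hA : ∀ y z, β (A y) z = -β y (A z)) (x y : V) (t p : ℝ[X]) :
    β (aeval A t x) (aeval A (algEquivAevalNegX p) y) = pairing A β x y (p * t) := by
  rw [pairing_apply, ← aeval_adjoint hA, map_mul, Module.End.mul_apply]

lemma pairing_self_odd (hs : ∀ y z, β y z = -β z y) (hA : ∀ y z, β (A y) z = -β y (A z))
    (x : V) (t : ℝ[X]) :
    pairing A β x x (algEquivAevalNegX t) = - pairing A β x x t := by
  rw [pairing_apply, pairing_apply, hs, aeval_adjoint hA]

/-- The dual of a cyclic Jordan family under a perfect pairing is a Jordan family. -/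
lemma exists_dual_family (hA : ∀ y z, β (A y) z = -β y (A z)) {b : RealJordanBlock}
    {π : Fin b.size → ℝ[X]} (hπ : IsBlockPoly b π) {x u : V}
    (hx : ∀ t, pairing A β x u (b.poly ^ b.mult * t) = 0)
    (hne : ∃ t, pairing A β x u (b.poly ^ (b.mult - 1) * t) ≠ 0)
    (hu : aeval A (algEquivAevalNegX b.poly ^ b.mult) u = 0) :
    ∃ (b' : RealJordanBlock) (g : Fin b'.size → V) (ρ : Fin b'.size ≃ Fin b.size)
      (s : Fin b'.size → ℝ), (∀ j, A (g j) = ∑ i, b'.matrix i j • g i) ∧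
      Submodule.span ℝ (Set.range g) = cyc A u ∧ (∀ j, s j = 1 ∨ s j = -1) ∧
      ∀ i j, β (aeval A (π i) x) (g j) = if i = ρ j then s j else 0 := by
  classical
  have hcard : Fintype.card (Fin b.size) = (b.poly ^ b.mult).natDegree := by
    rw [b.natDegree_poly_pow, Fintype.card_fin]
  -- The residues dual to the `π i`; their reflections, applied to `u`, form the basis of `cyc A u`
  -- dual to the chain of `x`. On that basis `A` acts by minus the transposed block.
  choose p hp using fun j => exists_functional_eq b.prime_poly hx hne hcard hπ.2
    (fun i => if i = j then (1 : ℝ) else 0)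
  have hzero : ∀ d : ℝ[X], (∀ k, pairing A β x u (d * π k) = 0) →
      aeval A (algEquivAevalNegX d) u = 0 := by
    intro d hd
    have : b.poly ^ b.mult ∣ d := by
      refine pow_dvd_of_functional b.prime_poly hx hne fun t => ?_
      obtain ⟨c, hc⟩ := hπ.2 t
      rw [functional_eq_sum hx hc]
      exact Finset.sum_eq_zero fun i _ => by rw [hd, mul_zero]
    obtain ⟨k, rfl⟩ := this
    rw [map_mul, map_pow]
    exact aeval_apply_eq_zero_of_dvd (Dvd.intro _ rfl) hu
  set f : Fin b.size → V := fun j => aeval A (algEquivAevalNegX (p j)) u with hf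
  have hAf : ∀ j, A (f j) = -∑ i, b.matrix j i • f i := by
    intro j
    have := hzero (-(X * p j) + ∑ i, b.matrix j i • p i) (by
      intro k
      have hc : b.poly ^ b.mult ∣ X * π k - ∑ i, C (b.matrix i k) * π i := by
        simpa only [smul_eq_C_mul] using hπ.1 k
      have h1 := functional_eq_sum hx hc (p j)
      rw [add_mul, map_add, Finset.sum_mul, map_sum,
        show -(X * p j) * π k = -(p j * (X * π k)) by ring, map_neg, h1]
      simp [hp])
    rw [map_add, map_add, LinearMap.add_apply, map_neg, map_mul, algEquivAevalNegX_X, neg_mul,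
      neg_neg, map_mul, aeval_X, Module.End.mul_apply, map_sum] at this
    simp_rw [map_smul] at this
    rw [aeval_sum_smul] at this
    exact eq_neg_of_add_eq_zero_left this
  have hspan : Submodule.span ℝ (Set.range f) = cyc A u := by
    apply le_antisymm
    · rw [Submodule.span_le]
      rintro _ ⟨i, rfl⟩
      exact mem_cyc.mpr ⟨_, rfl⟩
    · intro y hy
      obtain ⟨t, rfl⟩ := mem_cyc.mp hy
      have := hzero (algEquivAevalNegX t -
          ∑ i, pairing A β x u (algEquivAevalNegX t * π i) • p i) (by
        intro k
        rw [sub_mul, map_sub, Finset.sum_mul, map_sum]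
        simp [hp])
      rw [map_sub, map_sub, algEquivAevalNegX_algEquivAevalNegX, LinearMap.sub_apply, map_sum,
        sub_eq_zero] at this
      simp_rw [map_smul] at this
      rw [aeval_sum_smul] at this
      rw [this]
      exact Submodule.sum_mem _ fun i _ => Submodule.smul_mem _ _ (Submodule.subset_span ⟨i, rfl⟩)
  obtain ⟨b', ρ, s, hs, hM⟩ := b.exists_dual
  have hss : ∀ i, s i * s i = 1 := fun i => by rcases hs i with h | h <;> rw [h] <;> norm_num
  refine ⟨b', fun j => s j • f (ρ j), ρ, s, ?_, ?_, hs, ?_⟩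
  · intro j
    rw [map_smul, hAf, ← ρ.sum_comp, smul_neg, Finset.smul_sum, ← Finset.sum_neg_distrib]
    refine Finset.sum_congr rfl fun i _ => ?_
    rw [hM, smul_smul, smul_smul, ← neg_smul]
    congr 1
    linear_combination (s j * b.matrix (ρ j) (ρ i)) * hss i
  · rw [← hspan]
    apply le_antisymm
    · rw [Submodule.span_le]
      rintro _ ⟨i, rfl⟩
      exact Submodule.smul_mem _ _ (Submodule.subset_span ⟨_, rfl⟩)
    · rw [Submodule.span_le]
      rintro _ ⟨i, rfl⟩
      obtain ⟨i, rfl⟩ := ρ.surjective i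
      have : f (ρ i) = s i • (s i • f (ρ i)) := by rw [smul_smul, hss, one_smul]
      rw [this]
      exact Submodule.smul_mem _ _ (Submodule.subset_span ⟨i, rfl⟩)
  · intro i j
    rw [map_smul, hf]
    simp only
    rw [pairing_mul_aeval hA, hp]
    simp

end Forms

/-! ### Correcting a pair of nilpotent chains to isotropic ones. -/

section Isotropic

variable {V : Type*} [AddCommGroup V] [Module ℝ V]
  {A : Module.End ℝ V} {β : LinearMap.BilinForm ℝ V}

lemma functional_eq_zero_of_X_pow {l : ℝ[X] →ₗ[ℝ] ℝ} (h : ∀ i, l (X ^ i) = 0) (t : ℝ[X]) :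
    l t = 0 := by
  induction t using Polynomial.induction_on' with
  | add p q hp hq => rw [map_add, hp, hq, add_zero]
  | monomial n a => rw [← C_mul_X_pow_eq_monomial, ← smul_eq_C_mul, map_smul, h, smul_zero]

lemma pairing_add_left (x x' y : V) (t : ℝ[X]) :
    pairing A β (x + x') y t = pairing A β x y t + pairing A β x' y t := by
  simp [pairing_apply]

lemma pairing_add_right (x y y' : V) (t : ℝ[X]) :
    pairing A β x (y + y') t = pairing A β x y t + pairing A β x y' t := by
  simp [pairing_apply]

lemma pairing_aeval_left (x y : V) (p t : ℝ[X]) :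
    pairing A β (aeval A p x) y t = pairing A β x y (t * p) := by
  simp [pairing_apply]

lemma pairing_aeval_right (hA : ∀ y z, β (A y) z = -β y (A z)) (x y : V) (p t : ℝ[X]) :
    pairing A β x (aeval A p y) t = pairing A β x y (algEquivAevalNegX p * t) := by
  have := pairing_mul_aeval hA x y t (algEquivAevalNegX p)
  rwa [algEquivAevalNegX_algEquivAevalNegX] at this

lemma pairing_swap (hs : ∀ y z, β y z = -β z y) (hA : ∀ y z, β (A y) z = -β y (A z))
    (x y : V) (t : ℝ[X]) :
    pairing A β y x t = - pairing A β x y (algEquivAevalNegX t) := by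
  rw [pairing_apply, pairing_apply, hs, aeval_adjoint hA, algEquivAevalNegX_algEquivAevalNegX]

lemma algEquivAevalNegX_X_pow (n : ℕ) :
    algEquivAevalNegX (X ^ n : ℝ[X]) = ((-1 : ℝ) ^ n) • X ^ n := by
  rw [map_pow, algEquivAevalNegX_X, neg_pow, smul_eq_C_mul, C_pow, C_neg, C_1]

/-- If the top pairing of `u` with itself vanishes, then `u` can be modified by elements of
`A ⟨x⟩` so that its cyclic subspace becomes isotropic. -/
lemma exists_isotropic_generator (hs : ∀ y z, β y z = -β z y)
    (hA : ∀ y z, β (A y) z = -β y (A z)) {x u : V} {l : ℕ} (hl : 0 < l)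
    (hxx : ∀ t, pairing A β x x (X ^ l * t) = 0) (huu : ∀ t, pairing A β u u (X ^ l * t) = 0)
    (hxu : ∀ t, pairing A β x u (X ^ l * t) = 0) (hne : pairing A β x u (X ^ (l - 1)) ≠ 0)
    (htop : pairing A β u u (X ^ (l - 1)) = 0) :
    ∃ r : ℝ[X], ∀ t, pairing A β (u + aeval A (X * r) x) (u + aeval A (X * r) x) t = 0 := by
  -- Descending induction on the exponent: stage `m` makes the self-pairings with `X ^ i` vanish for
  -- all `i ≥ l - 1 - m`, starting from `htop`.
  have key : ∀ m, m ≤ l - 1 → ∃ r : ℝ[X], ∀ i, l - 1 - m ≤ i →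
      pairing A β (u + aeval A (X * r) x) (u + aeval A (X * r) x) (X ^ i) = 0 := by
    intro m
    induction m with
    | zero =>
      intro _
      refine ⟨0, fun i hi => ?_⟩
      rw [mul_zero, map_zero, LinearMap.zero_apply, add_zero]
      rcases Nat.lt_or_ge i l with h | h
      · rw [show i = l - 1 by omega]; exact htop
      · rw [← Nat.add_sub_cancel' h, pow_add]; exact huu _
    | succ m ih =>
      intro hm
      obtain ⟨r, hr⟩ := ih (by omega)
      obtain ⟨w, hw⟩ : ∃ w, w = u + aeval A (X * r) x := ⟨_, rfl⟩
      rw [← hw] at hr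
      have hxw : ∀ i, l - 1 ≤ i → pairing A β x w (X ^ i) = pairing A β x u (X ^ i) := by
        intro i hi
        rw [hw, pairing_add_right, pairing_aeval_right hA, map_mul algEquivAevalNegX,
          algEquivAevalNegX_X]
        rw [show -X * algEquivAevalNegX r * X ^ i
          = X ^ l * (-algEquivAevalNegX r * X ^ (i + 1 - l)) by
            have : (X : ℝ[X]) ^ (i + 1) = X ^ l * X ^ (i + 1 - l) := by
              rw [← pow_add]; congr 1; omega
            linear_combination (-algEquivAevalNegX r) * this, hxx, add_zero]
      have hxw0 : ∀ i, l ≤ i → pairing A β x w (X ^ i) = 0 := by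
        intro i hi
        rw [hxw i (by omega), ← Nat.add_sub_cancel' hi, pow_add]; exact hxu _
      -- The term quadratic in `a` carries `X` to a power at least `l` and vanishes. The two cross
      -- terms add when `i` is odd and cancel when `i` is even.
      have hexp : ∀ (a : ℝ) (i : ℕ), l - 1 - (m + 1) ≤ i →
          pairing A β (w + aeval A (C a * X ^ (m + 1)) x) (w + aeval A (C a * X ^ (m + 1)) x)
            (X ^ i) = pairing A β w w (X ^ i) + a * (1 - (-1) ^ i) *
              pairing A β x w (X ^ (i + (m + 1))) := by
        intro a i hi
        rw [pairing_add_left, pairing_add_right, pairing_add_right, pairing_aeval_left,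
          pairing_aeval_left, pairing_aeval_right hA, pairing_aeval_right hA,
          pairing_swap hs hA x w]
        have e1 : algEquivAevalNegX (algEquivAevalNegX (C a * X ^ (m + 1)) * X ^ i)
            = (a * (-1) ^ i) • (X : ℝ[X]) ^ (i + (m + 1)) := by
          rw [map_mul, algEquivAevalNegX_algEquivAevalNegX, algEquivAevalNegX_X_pow,
            smul_eq_C_mul, smul_eq_C_mul, C_mul, pow_add]; ring
        have e2 : X ^ i * (C a * X ^ (m + 1)) = a • (X : ℝ[X]) ^ (i + (m + 1)) := by
          rw [smul_eq_C_mul, pow_add]; ring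
        have e3 : algEquivAevalNegX (C a * X ^ (m + 1)) * (X ^ i * (C a * X ^ (m + 1)))
            = X ^ l * (algEquivAevalNegX (C a) * C a * C ((-1) ^ (m + 1)) *
              X ^ (i + (m + 1) + (m + 1) - l)) := by
          have : (X : ℝ[X]) ^ (i + (m + 1) + (m + 1)) =
              X ^ l * X ^ (i + (m + 1) + (m + 1) - l) := by
            rw [← pow_add]; congr 1; omega
          rw [map_mul, algEquivAevalNegX_X_pow, smul_eq_C_mul]
          rw [pow_add, pow_add] at this
          linear_combination (algEquivAevalNegX (C a) * C a * C ((-1) ^ (m + 1))) * this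
        rw [e1, e3, e2, hxx, map_smul, map_smul, smul_eq_mul, smul_eq_mul]
        ring
      have hmod : ∀ a : ℝ, w + aeval A (C a * X ^ (m + 1)) x
          = u + aeval A (X * (r + C a * X ^ m)) x := by
        intro a
        rw [hw, add_assoc, ← LinearMap.add_apply, ← map_add]
        congr 4; ring
      have hgen : ∀ a : ℝ, (pairing A β (w + aeval A (C a * X ^ (m + 1)) x)
          (w + aeval A (C a * X ^ (m + 1)) x) (X ^ (l - 1 - (m + 1))) = 0) →
          ∃ r : ℝ[X], ∀ i, l - 1 - (m + 1) ≤ i →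
          pairing A β (u + aeval A (X * r) x) (u + aeval A (X * r) x) (X ^ i) = 0 := by
        intro a ha
        refine ⟨r + C a * X ^ m, fun i hi => ?_⟩
        rw [← hmod]
        rcases Nat.eq_or_lt_of_le hi with h | h
        · rw [← h]; exact ha
        · rw [hexp a i hi, hr i (by omega), hxw0 _ (by omega)]; ring
      set i₀ := l - 1 - (m + 1) with hi₀
      -- An even coefficient is already zero by skewness. An odd one is removed by solving a linear
      -- equation for `a`, whose leading coefficient is nonzero by `hne`.
      rcases Nat.even_or_odd i₀ with he | ho
      · refine hgen 0 ?_
        rw [hexp 0 i₀ le_rfl]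
        have := pairing_swap hs hA w w (X ^ i₀)
        rw [algEquivAevalNegX_X_pow, he.neg_one_pow, one_smul] at this
        linarith
      · refine hgen (-(pairing A β w w (X ^ i₀)) / (2 * pairing A β x u (X ^ (l - 1)))) ?_
        rw [hexp _ i₀ le_rfl, ho.neg_one_pow, show i₀ + (m + 1) = l - 1 by omega,
          hxw _ le_rfl]
        field_simp
        ring
  obtain ⟨r, hr⟩ := key (l - 1) le_rfl
  exact ⟨r, functional_eq_zero_of_X_pow fun i => hr i (by omega)⟩

/-- If `⟨u⟩` is isotropic and pairs perfectly with `⟨x⟩`, then `x` can be modified by an element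
of `⟨u⟩` so that its cyclic subspace becomes isotropic. -/
lemma exists_isotropic_complement (hs : ∀ y z, β y z = -β z y)
    (hA : ∀ y z, β (A y) z = -β y (A z)) {x u : V} {l : ℕ}
    (hxx : ∀ t, pairing A β x x (X ^ l * t) = 0) (huu : ∀ t, pairing A β u u t = 0)
    (hxu : ∀ t, pairing A β x u (X ^ l * t) = 0) (hne : pairing A β x u (X ^ (l - 1)) ≠ 0) :
    ∃ p : ℝ[X], ∀ t, pairing A β (x + aeval A p u) (x + aeval A p u) t = 0 := by
  have hspan : SpansMod (X ^ l) (fun i : Fin l => (X : ℝ[X]) ^ (l - 1 - (i : ℕ))) := by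
    have := (isBlockPoly_real l 0).2
    simp only [RealJordanBlock.poly, RealJordanBlock.mult, C_0, sub_zero] at this
    exact this
  -- Factor `-1/2` because the two cross terms contribute equally; the quadratic term is zero as `u`
  -- generates an isotropic space.
  obtain ⟨p, hp⟩ := exists_functional_eq prime_X hxu ⟨1, by simpa using hne⟩
    (by rw [natDegree_X_pow]; exact Fintype.card_fin l) hspan
    (fun i => -(1 / 2) * pairing A β x x (X ^ (l - 1 - (i : ℕ))))
  have hp' : ∀ t, pairing A β x u (p * t) = -(1 / 2) * pairing A β x x t := by
    intro t
    have hz := functional_eq_zero_of_X_pow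
      (l := (pairing A β x u).comp (LinearMap.mulLeft ℝ p) + (1 / 2 : ℝ) • pairing A β x x) (by
        intro i
        simp only [LinearMap.add_apply, LinearMap.comp_apply, LinearMap.mulLeft_apply,
          LinearMap.smul_apply, smul_eq_mul]
        rcases Nat.lt_or_ge i l with h | h
        · have := hp ⟨l - 1 - i, by omega⟩
          simp only [show l - 1 - (l - 1 - i) = i by omega] at this
          rw [this]; ring
        · rw [← Nat.add_sub_cancel' h, pow_add, hxx,
            show p * (X ^ l * X ^ (i - l)) = X ^ l * (p * X ^ (i - l)) by ring, hxu]
          ring) t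
    simp only [LinearMap.add_apply, LinearMap.comp_apply, LinearMap.mulLeft_apply,
          LinearMap.smul_apply, smul_eq_mul] at hz
    linarith
  refine ⟨algEquivAevalNegX p, fun t => ?_⟩
  rw [pairing_add_left, pairing_add_right, pairing_add_right, pairing_aeval_left,
    pairing_aeval_left, pairing_aeval_right hA, pairing_aeval_right hA, huu,
    pairing_swap hs hA x u, map_mul algEquivAevalNegX,
    algEquivAevalNegX_algEquivAevalNegX, mul_comm _ p, hp', hp']
  have := pairing_swap hs hA x x t
  linarith

/-- Isotropic generators of a pair of cyclic subspaces which are paired perfectly. -/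
lemma exists_isotropic_pair (hs : ∀ y z, β y z = -β z y)
    (hA : ∀ y z, β (A y) z = -β y (A z)) {x u : V} {l : ℕ} (hl : 0 < l)
    (hxx : ∀ t, pairing A β x x (X ^ l * t) = 0) (huu : ∀ t, pairing A β u u (X ^ l * t) = 0)
    (hxu : ∀ t, pairing A β x u (X ^ l * t) = 0) (hne : pairing A β x u (X ^ (l - 1)) ≠ 0)
    (htop : pairing A β u u (X ^ (l - 1)) = 0) :
    ∃ (x' u' : V) (r p : ℝ[X]), u' = u + aeval A (X * r) x ∧ x' = x + aeval A p u' ∧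
      (∀ t, pairing A β x' x' t = 0) ∧ (∀ t, pairing A β u' u' t = 0) ∧
      (∀ t, pairing A β x' u' (X ^ l * t) = 0) ∧ pairing A β x' u' (X ^ (l - 1)) ≠ 0 := by
  obtain ⟨r, hr⟩ := exists_isotropic_generator hs hA hl hxx huu hxu hne htop
  have h1 : ∀ t, pairing A β x (u + aeval A (X * r) x) (X ^ l * t) = 0 := by
    intro t
    rw [pairing_add_right, hxu, pairing_aeval_right hA, mul_left_comm, hxx, add_zero]
  have h2 : pairing A β x (u + aeval A (X * r) x) (X ^ (l - 1)) ≠ 0 := by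
    rw [pairing_add_right, pairing_aeval_right hA, map_mul algEquivAevalNegX,
      algEquivAevalNegX_X]
    rw [show -X * algEquivAevalNegX r * X ^ (l - 1) = X ^ l * (-algEquivAevalNegX r) by
      have : (X : ℝ[X]) ^ l = X ^ (l - 1) * X := by rw [← pow_succ, Nat.sub_add_cancel hl]
      rw [this]; ring, hxx, add_zero]
    exact hne
  obtain ⟨p, hp⟩ := exists_isotropic_complement hs hA hxx hr h1 h2
  refine ⟨_, _, r, p, rfl, rfl, hp, hr, fun t => ?_, ?_⟩
  · rw [pairing_add_left, pairing_aeval_left, hr, h1, add_zero]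
  · rw [pairing_add_left, pairing_aeval_left, hr, add_zero]
    exact h2

end Isotropic

/-! ### Orthogonal projection and sums for monomial families. -/

section Split

variable {V : Type*} [AddCommGroup V] [Module ℝ V] {β : LinearMap.BilinForm ℝ V}

/-- A monomial Gram matrix is invertible, so there is an orthogonal projection onto the span, and
its coefficients can be read off from the partners. -/
lemma IsMonomial.exists_orthogonal_sub {ι : Type*} [Fintype ι] (hs : ∀ y z, β y z = -β z y)
    {v : ι → V} (hv : IsMonomial fun i k => β (v i) (v k)) (w : V) :
    ∃ w' ∈ Submodule.span ℝ (Set.range v), ∀ i, β (w - w') (v i) = 0 := by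
  classical
  obtain ⟨ρ, s, hs1, h⟩ := hv
  have hs0 : ∀ i, s i ≠ 0 := fun i => by rcases hs1 i with h | h <;> rw [h] <;> norm_num
  -- Skew-symmetry makes the partner map an involution: the transposed entry is also nonzero, so it
  -- must be the one in its row.
  have hρ : ∀ i, ρ (ρ i) = i := by
    intro i
    by_contra hi
    have h1 := (h i (ρ i)).1 rfl
    have h2 := (h (ρ i) i).2 (Ne.symm hi)
    simp only at h1 h2
    rw [hs, h2, neg_zero] at h1
    exact hs0 i h1.symm
  refine ⟨∑ k, (β w (v (ρ k)) / s k) • v k, Submodule.sum_mem _ fun i _ =>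
    Submodule.smul_mem _ _ (Submodule.subset_span ⟨i, rfl⟩), fun i => ?_⟩
  rw [map_sub, LinearMap.sub_apply, map_sum, LinearMap.sum_apply,
    Finset.sum_eq_single (ρ i)]
  · have := (h (ρ i) i).1 (hρ i).symm
    simp only at this
    rw [map_smul, LinearMap.smul_apply, this, hρ, smul_eq_mul, div_mul_cancel₀ _ (hs0 _), sub_self]
  · intro k _ hk
    have := (h k i).2 (by rintro rfl; exact hk (hρ k).symm)
    simp only at this
    rw [map_smul, LinearMap.smul_apply, this, smul_zero]
  · simp

lemma IsMonomial.sum_elim {ι κ : Type*} {v : ι → V} {w : κ → V}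
    (hv : IsMonomial fun i k => β (v i) (v k)) (hw : IsMonomial fun i k => β (w i) (w k))
    (h1 : ∀ i k, β (v i) (w k) = 0) (h2 : ∀ i k, β (w i) (v k) = 0) :
    IsMonomial fun i k => β (Sum.elim v w i) (Sum.elim v w k) := by
  obtain ⟨ρ, s, hs, h⟩ := hv
  obtain ⟨ρ', s', hs', h'⟩ := hw
  refine ⟨Sum.map ρ ρ', Sum.elim s s', ?_, ?_⟩
  · rintro (i | i)
    · exact hs i
    · exact hs' i
  · rintro (i | i) (k | k)
    · simpa using h i k
    · simpa using h1 i k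
    · simpa using h2 i k
    · simpa using h' i k

lemma IsMonomial.of_dual {ι κ : Type*} {v : ι → V} {w : κ → V} (hs : ∀ y z, β y z = -β z y)
    (ρ : κ ≃ ι) {s : κ → ℝ} (hs1 : ∀ i, s i = 1 ∨ s i = -1)
    (hv : ∀ i k, β (v i) (v k) = 0) (hw : ∀ i k, β (w i) (w k) = 0)
    [DecidableEq ι] (h : ∀ i j, β (v i) (w j) = if i = ρ j then s j else 0) :
    IsMonomial fun i k => β (Sum.elim v w i) (Sum.elim v w k) := by
  refine ⟨Sum.elim (fun i => Sum.inr (ρ.symm i)) (fun j => Sum.inl (ρ j)),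
    Sum.elim (fun i => s (ρ.symm i)) (fun j => - s j), ?_, ?_⟩
  · rintro (i | i)
    · exact hs1 _
    · rcases hs1 i with h | h <;> simp [h]
  · rintro (i | i) (k | k)
    · simpa using hv i k
    · simp only [Sum.elim_inl, Sum.elim_inr, Sum.inr.injEq, h]
      refine ⟨?_, ?_⟩
      · rintro rfl; simp
      · intro hk
        rw [if_neg (by rintro rfl; simp at hk)]
    · simp only [Sum.elim_inl, Sum.elim_inr, Sum.inl.injEq]
      rw [hs, h]
      refine ⟨?_, ?_⟩
      · rintro rfl; simp
      · intro hk
        rw [if_neg fun h => hk (by rw [h]), neg_zero]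
    · simpa using hw i k

end Split

/-! ### Monomial Jordan bases for nondegenerate forms. -/

section Nondegenerate

variable {V : Type*} [AddCommGroup V] [Module ℝ V]
  {A : Module.End ℝ V} {β : LinearMap.BilinForm ℝ V}

lemma exists_real_or_quadratic_dvd {m : ℝ[X]} (hm : 0 < m.natDegree) :
    (∃ l : ℝ, X - C l ∣ m) ∨
      ∃ (a b : ℝ) (hb : 0 < b), (RealJordanBlock.complex 0 a b hb).poly ∣ m := by
  have hm' : 0 < (m.map (algebraMap ℝ ℂ)).degree := by
    rw [degree_map]; exact natDegree_pos_iff_degree_pos.mp hm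
  obtain ⟨z, hz⟩ := Complex.exists_root hm'
  have hz' : aeval z m = 0 := by
    rwa [IsRoot.def, eval_map_algebraMap] at hz
  by_cases him : z.im = 0
  · left
    refine ⟨z.re, ?_⟩
    rw [dvd_iff_isRoot, IsRoot.def]
    have : z = (algebraMap ℝ ℂ) z.re := Complex.ext (by simp) (by simp [him])
    rw [this, aeval_algebraMap_apply] at hz'
    simpa using hz'
  · right
    refine ⟨z.re, |z.im|, abs_pos.mpr him, ?_⟩
    have := quadratic_dvd_of_aeval_eq_zero_im_ne_zero m hz' him
    convert this using 1
    simp only [RealJordanBlock.poly, sq_abs]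
    rw [Complex.sq_norm, Complex.normSq_apply]
    simp only [C_mul, C_add, C_pow, C_ofNat]
    ring

/-- Existence of generators of maximal height in a primary component. -/
lemma exists_primary_generator [FiniteDimensional ℝ V] (hs : ∀ y z, β y z = -β z y)
    (hA : ∀ y z, β (A y) z = -β y (A z)) {W : Submodule ℝ V} (hW : ∀ w ∈ W, A w ∈ W)
    (hnd : ∀ w ∈ W, (∀ z ∈ W, β w z = 0) → w = 0) {m : ℝ[X]} (hm0 : m ≠ 0)
    (hm : ∀ w ∈ W, aeval A m w = 0) (hmin : ∀ p : ℝ[X], (∀ w ∈ W, aeval A p w = 0) → m ∣ p)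
    {q : ℝ[X]} (hq : Prime q) (hqm : q ∣ m) :
    ∃ n, 0 < n ∧ (∃ x ∈ W, aeval A (q ^ n) x = 0 ∧ aeval A (q ^ (n - 1)) x ≠ 0) ∧
      ∀ x ∈ W, aeval A (q ^ n) x = 0 → aeval A (q ^ (n - 1)) x ≠ 0 →
        ∃ y ∈ W, aeval A (algEquivAevalNegX q ^ n) y = 0 ∧
          pairing A β x y (q ^ (n - 1)) ≠ 0 := by
  -- The height is the exact power of `q` in the minimal polynomial; the cofactor `m'` projects onto
  -- the primary component.
  obtain ⟨n, m', hm', hmn⟩ := WfDvdMonoid.max_power_factor hm0 hq.irreducible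
  have hn : 0 < n := by
    rcases Nat.eq_zero_or_pos n with rfl | h
    · rw [pow_zero, one_mul] at hmn; rw [hmn] at hqm; exact absurd hqm hm'
    · exact h
  refine ⟨n, hn, ?_, ?_⟩
  · have : ¬ ∀ w ∈ W, aeval A (q ^ (n - 1) * m') w = 0 := by
      intro h
      obtain ⟨k, hk⟩ := hmin _ h
      have hq1 : q ^ n = q ^ (n - 1) * q := by rw [← pow_succ, Nat.sub_add_cancel hn]
      rw [hmn, hq1] at hk
      have hne : q ^ (n - 1) * m' ≠ 0 :=
        mul_ne_zero (pow_ne_zero _ hq.ne_zero) (by rintro rfl; simp at hm')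
      have : q * k = 1 := by
        apply mul_left_cancel₀ hne
        linear_combination -hk
      exact hq.not_isUnit (IsUnit.of_mul_eq_one _ this)
    push Not at this
    obtain ⟨w, hw, hw'⟩ := this
    refine ⟨aeval A m' w, aeval_mem_of_invariant hW _ hw, ?_, ?_⟩
    · rw [← Module.End.mul_apply, ← map_mul, ← hmn]; exact hm w hw
    · rw [← Module.End.mul_apply, ← map_mul]; exact hw'
  · intro x hx hxn hxn1
    -- `m'` is coprime to `q`, so it acts injectively on vectors killed by a power of `q`. A partner
    -- `z` of this vector, multiplied by the reflected cofactor, lands in the component of the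
    -- reflected prime.
    have hz : aeval A (m' * q ^ (n - 1)) x ≠ 0 := by
      intro h
      obtain ⟨u, v, huv⟩ := ((hq.irreducible.coprime_iff_not_dvd).mpr hm').symm
      apply hxn1
      have e : q ^ (n - 1) = u * (m' * q ^ (n - 1)) + v * q ^ n := by
        have : q ^ n = q * q ^ (n - 1) := by rw [← pow_succ', Nat.sub_add_cancel hn]
        rw [this]
        linear_combination -q ^ (n - 1) * huv
      rw [e, map_add, LinearMap.add_apply, map_mul, Module.End.mul_apply, h, map_zero, map_mul,
        Module.End.mul_apply, hxn, map_zero, add_zero]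
    have : ∃ z ∈ W, β (aeval A (m' * q ^ (n - 1)) x) z ≠ 0 := by
      by_contra h
      push Not at h
      exact hz (hnd _ (aeval_mem_of_invariant hW _ hx) h)
    obtain ⟨z, hzW, hz'⟩ := this
    refine ⟨aeval A (algEquivAevalNegX m') z, aeval_mem_of_invariant hW _ hzW, ?_, ?_⟩
    · rw [← Module.End.mul_apply, ← map_mul, ← map_pow, ← map_mul, ← hmn]
      refine hnd _ (aeval_mem_of_invariant hW _ hzW) fun w hw => ?_
      rw [hs, ← aeval_adjoint hA, hm w hw]; simp
    · rw [pairing_aeval_right hA, algEquivAevalNegX_algEquivAevalNegX, pairing_apply]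
      exact hz'

/-- By Bézout `x` is a multiple of the reflection of `q ^ n` applied to `x`. Moved to the other side
of the form, that factor becomes `q ^ n` and kills `x`. -/
lemma pairing_self_eq_zero_of_isCoprime (hA : ∀ y z, β (A y) z = -β y (A z)) {q : ℝ[X]}
    (hq : IsCoprime q (algEquivAevalNegX q)) {n : ℕ} {x : V} (hx : aeval A (q ^ n) x = 0)
    (t : ℝ[X]) : pairing A β x x t = 0 := by
  obtain ⟨u, v, huv⟩ := (hq.pow (m := n) (n := n))
  have e : x = aeval A (v * algEquivAevalNegX (q ^ n)) x := by
    have := congrArg (fun p => aeval A p x) huv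
    simp only [map_add, LinearMap.add_apply, map_one, Module.End.one_apply] at this
    rw [map_mul (aeval A), Module.End.mul_apply, hx, map_zero, zero_add] at this
    rw [map_pow]; exact this.symm
  have : pairing A β x x t = pairing A β x (aeval A (v * algEquivAevalNegX (q ^ n)) x) t := by
    rw [← e]
  rw [this, pairing_aeval_right hA, map_mul algEquivAevalNegX,
    algEquivAevalNegX_algEquivAevalNegX, pairing_apply,
    show algEquivAevalNegX v * q ^ n * t = (algEquivAevalNegX v * t) * q ^ n by ring, map_mul,
    Module.End.mul_apply, hx]
  simp

lemma isotropic_cyc (hA : ∀ y z, β (A y) z = -β y (A z)) {x : V}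
    (hx : ∀ t, pairing A β x x t = 0) {y z : V} (hy : y ∈ cyc A x) (hz : z ∈ cyc A x) :
    β y z = 0 := by
  obtain ⟨p, rfl⟩ := mem_cyc.mp hy
  obtain ⟨p', rfl⟩ := mem_cyc.mp hz
  rw [← pairing_apply, pairing_aeval_right hA, hx]

/-- A pair of isotropic cyclic subspaces paired perfectly has a monomial Jordan family. -/
lemma exists_family_of_isotropic_pair (hs : ∀ y z, β y z = -β z y)
    (hA : ∀ y z, β (A y) z = -β y (A z)) (b : RealJordanBlock) (hn : 0 < b.mult) {x u : V}
    (hx : aeval A (b.poly ^ b.mult) x = 0)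
    (hu : aeval A (algEquivAevalNegX b.poly ^ b.mult) u = 0)
    (hxx : ∀ t, pairing A β x x t = 0) (huu : ∀ t, pairing A β u u t = 0)
    (hne : pairing A β x u (b.poly ^ (b.mult - 1)) ≠ 0) :
    ∃ (ι : Type) (_ : Fintype ι) (v : ι → V), Nonempty ι ∧
      (∀ i, v i ∈ cyc A x ⊔ cyc A u) ∧ IsBlockFamily A v ∧
      IsMonomial fun i k => β (v i) (v k) := by
  obtain ⟨π, hπ⟩ := exists_isBlockPoly b
  obtain ⟨b', g, ρ, s, hg, hgs, hs1, hdual⟩ := exists_dual_family hA hπ (x := x) (u := u)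
    (fun t => by rw [pairing_apply, mul_comm, map_mul, Module.End.mul_apply, hx]; simp)
    ⟨1, by simpa using hne⟩ hu
  have hmem : ∀ j, g j ∈ cyc A u := fun j => hgs ▸ Submodule.subset_span ⟨j, rfl⟩
  refine ⟨_, inferInstance, Sum.elim (fun i => aeval A (π i) x) g, ?_, ?_, ?_, ?_⟩
  · have : 0 < b.size := by
      rw [← b.natDegree_poly_pow, natDegree_pow]
      exact Nat.mul_pos hn b.prime_poly.irreducible.natDegree_pos
    exact ⟨Sum.inl ⟨0, this⟩⟩
  · rintro (i | i)
    · exact Submodule.mem_sup_left (mem_cyc.mpr ⟨_, rfl⟩)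
    · exact Submodule.mem_sup_right (hmem i)
  · exact (IsBlockFamily.of_block fun j => hπ.family hx j).sum (IsBlockFamily.of_block hg)
  · exact IsMonomial.of_dual hs ρ hs1
      (fun i k => isotropic_cyc hA hxx (mem_cyc.mpr ⟨_, rfl⟩) (mem_cyc.mpr ⟨_, rfl⟩))
      (fun i k => isotropic_cyc hA huu (hmem i) (hmem k)) hdual

/-- Only exponents with sum `n - 1` pair nontrivially, so the Gram matrix is antidiagonal;
reflecting the second factor gives the sign. -/
lemma isMonomial_of_normalised_real {n : ℕ} {l : ℝ[X] →ₗ[ℝ] ℝ} {r : ℝ[X]} {ε : ℝ}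
    (hε : ε = 1 ∨ ε = -1)
    (h : ∀ m, l (algEquivAevalNegX r * r * X ^ m) = if m + 1 = n then ε else 0) :
    IsMonomial fun i k : Fin n => l (algEquivAevalNegX (X ^ (n - 1 - (k : ℕ)) * r) *
      (X ^ (n - 1 - (i : ℕ)) * r)) := by
  refine ⟨Fin.rev, fun i => (-1) ^ (i : ℕ) * ε, ?_, ?_⟩
  · intro i
    rcases neg_one_pow_eq_or ℝ (i : ℕ) with h | h <;> rcases hε with h' | h' <;> simp [h, h']
  · intro i k
    have e : algEquivAevalNegX (X ^ (n - 1 - (k : ℕ)) * r) * (X ^ (n - 1 - (i : ℕ)) * r)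
      = ((-1 : ℝ) ^ (n - 1 - (k : ℕ))) • (algEquivAevalNegX r * r *
        X ^ ((n - 1 - (i : ℕ)) + (n - 1 - (k : ℕ)))) := by
      rw [map_mul, algEquivAevalNegX_X_pow, pow_add, smul_eq_C_mul, smul_eq_C_mul]; ring
    beta_reduce
    rw [e, map_smul, h, smul_eq_mul]
    have hc : n - 1 - (i : ℕ) + (n - 1 - (k : ℕ)) + 1 = n ↔ k = Fin.rev i := by
      rw [Fin.ext_iff, Fin.val_rev]; omega
    refine ⟨fun hk => ?_, fun hk => ?_⟩
    · rw [if_pos (hc.mpr hk), hk, Fin.val_rev]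
      congr 2; omega
    · rw [if_neg (fun h' => hk (hc.mp h')), mul_zero]

/-- Polarisation: a pairing symmetric in `x` and `y` and nonzero there cannot vanish on all three of
`x`, `y`, `x + y`. -/
lemma exists_self_pairing_ne_zero {p : ℝ[X]} {x y : V} (P : V → Prop) (hx : P x) (hy : P y)
    (hxy : P (x + y)) (hsymm : pairing A β y x p = pairing A β x y p)
    (hne : pairing A β x y p ≠ 0) : ∃ z, P z ∧ pairing A β z z p ≠ 0 := by
  by_contra h
  push Not at h
  have := h _ hxy
  rw [pairing_add_left, pairing_add_right, pairing_add_right, h x hx, h y hy, hsymm] at this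
  apply hne
  linarith

/-- A nonzero nondegenerate invariant subspace contains a nonempty monomial Jordan family. -/
lemma exists_monomial_family_in [FiniteDimensional ℝ V] (hs : ∀ y z, β y z = -β z y)
    (hA : ∀ y z, β (A y) z = -β y (A z)) {W : Submodule ℝ V} (hW : ∀ w ∈ W, A w ∈ W)
    (hnd : ∀ w ∈ W, (∀ z ∈ W, β w z = 0) → w = 0) (hW0 : W ≠ ⊥) :
    ∃ (ι : Type) (_ : Fintype ι) (v : ι → V), Nonempty ι ∧ (∀ i, v i ∈ W) ∧ IsBlockFamily A v ∧
      IsMonomial fun i k => β (v i) (v k) := by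
  obtain ⟨m, hm0, hmdeg, hm, hmin⟩ : ∃ m : ℝ[X], m ≠ 0 ∧ 0 < m.natDegree ∧
      (∀ w ∈ W, aeval A m w = 0) ∧ ∀ p : ℝ[X], (∀ w ∈ W, aeval A p w = 0) → m ∣ p := by
    set A' : Module.End ℝ W := A.restrict hW with hA'
    have hcoe : ∀ (p : ℝ[X]) (w : W), ((aeval A' p w : W) : V) = aeval A p w := by
      intro p w
      induction p using Polynomial.induction_on generalizing w with
      | C a => simp [Module.algebraMap_end_apply]
      | add p q hp hq => simp [hp, hq]
      | monomial n a ih =>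
        rw [pow_succ, ← mul_assoc, map_mul (aeval A'), aeval_X, Module.End.mul_apply, ih,
          map_mul (aeval A) (C a * X ^ n) X, aeval_X, Module.End.mul_apply]
        rfl
    have hint : IsIntegral ℝ A' := Algebra.IsIntegral.isIntegral A'
    have : Nontrivial W := (Submodule.nontrivial_iff_ne_bot).mpr hW0
    refine ⟨minpoly ℝ A', minpoly.ne_zero hint, minpoly.natDegree_pos hint, ?_, ?_⟩
    · intro w hw
      have := hcoe (minpoly ℝ A') ⟨w, hw⟩
      rw [minpoly.aeval] at this
      simpa using this.symm
    · intro p hp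
      apply minpoly.dvd
      ext w
      rw [hcoe]
      simpa using hp w w.2
  have hcycW : ∀ x ∈ W, cyc A x ≤ W := by
    intro x hx y hy
    obtain ⟨p, rfl⟩ := mem_cyc.mp hy
    exact aeval_mem_of_invariant hW p hx
  -- The primes not dividing their reflection, treated for real and complex blocks at once; `bl n`
  -- is the block of multiplicity `n` for a fixed prime, since the height is not yet known.
  have hcop : ∀ bl : ℕ → RealJordanBlock, (∀ n, (bl n).mult = n) →
      (∀ n, (bl n).poly = (bl 0).poly) → (bl 0).poly ∣ m →
      ¬ (bl 0).poly ∣ algEquivAevalNegX (bl 0).poly →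
      ∃ (ι : Type) (_ : Fintype ι) (v : ι → V), Nonempty ι ∧ (∀ i, v i ∈ W) ∧
        IsBlockFamily A v ∧ IsMonomial fun i k => β (v i) (v k) := by
    intro bl hmult hpoly hdvd hnd'
    have hq := (bl 0).prime_poly
    obtain ⟨n, hn, ⟨x, hxW, hx, hx1⟩, hE⟩ :=
      exists_primary_generator hs hA hW hnd hm0 hm hmin hq hdvd
    obtain ⟨y, hyW, hy, hxy⟩ := hE x hxW hx hx1
    have hc : IsCoprime (bl 0).poly (algEquivAevalNegX (bl 0).poly) :=
      (hq.irreducible.coprime_iff_not_dvd).mpr hnd'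
    obtain ⟨ι, hι, v, hne, hv, hb, hmon⟩ := exists_family_of_isotropic_pair hs hA (bl n)
      (by rw [hmult]; exact hn) (x := x) (u := y) (by rw [hmult, hpoly]; exact hx)
      (by rw [hmult, hpoly]; exact hy) (pairing_self_eq_zero_of_isCoprime hA hc hx)
      (pairing_self_eq_zero_of_isCoprime hA
        (by rw [algEquivAevalNegX_algEquivAevalNegX]; exact hc.symm) hy)
      (by rw [hmult, hpoly]; exact hxy)
    exact ⟨ι, hι, v, hne, fun i => sup_le (hcycW x hxW) (hcycW y hyW) (hv i), hb, hmon⟩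
  rcases exists_real_or_quadratic_dvd hmdeg with ⟨l, hl⟩ | ⟨a, b, hb, hab⟩
  · by_cases hl0 : l = 0
    · subst hl0
      rw [C_0, sub_zero] at hl
      obtain ⟨n, hn, ⟨x, hxW, hx, hx1⟩, hE⟩ :=
        exists_primary_generator hs hA hW hnd hm0 hm hmin prime_X hl
      obtain ⟨y, hyW, hy, hxy⟩ := hE x hxW hx hx1
      have hy : aeval A (X ^ n : ℝ[X]) y = 0 := by
        rw [← map_pow, algEquivAevalNegX_X_pow, map_smul, LinearMap.smul_apply] at hy
        exact (smul_eq_zero.mp hy).resolve_left (pow_ne_zero _ (by norm_num))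
      have hkill : ∀ z w, aeval A (X ^ n : ℝ[X]) z = 0 → ∀ t, pairing A β z w (X ^ n * t) = 0 := by
        intro z w hz t
        rw [pairing_apply, mul_comm, map_mul, Module.End.mul_apply, hz]; simp
      -- For even `n` the top pairing, through `X ^ (n - 1)`, is symmetric and one chain suffices.
      -- For odd `n` it is skew, every vector is null for it, and two chains are needed.
      rcases Nat.even_or_odd n with he | ho
      · have hodd : Odd (n - 1) := Nat.Even.sub_odd hn he odd_one
        obtain ⟨z, ⟨hzW, hz⟩, hzz⟩ := exists_self_pairing_ne_zero (A := A) (β := β)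
          (p := X ^ (n - 1)) (x := x) (y := y) (fun z => z ∈ W ∧ aeval A (X ^ n : ℝ[X]) z = 0)
          ⟨hxW, hx⟩ ⟨hyW, hy⟩ ⟨W.add_mem hxW hyW, by rw [map_add, hx, hy, add_zero]⟩
          (by rw [pairing_swap hs hA x y, algEquivAevalNegX_X_pow, hodd.neg_one_pow]; simp) hxy
        obtain ⟨r, ε, hε, -, hr⟩ := exists_normalised_real hn he (hkill z z hz)
          ⟨1, by simpa using hzz⟩ (pairing_self_odd hs hA z)
        refine ⟨Fin n, inferInstance,
          fun i => aeval A (X ^ (n - 1 - (i : ℕ)) : ℝ[X]) (aeval A r z), ⟨⟨0, hn⟩⟩, fun i =>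
          aeval_mem_of_invariant hW _ (aeval_mem_of_invariant hW _ hzW), ?_, ?_⟩
        · have hπ := isBlockPoly_real n 0
          simp only [C_0, sub_zero] at hπ
          exact IsBlockFamily.of_block (b := .real n 0) (hπ.family (by
            simp only [RealJordanBlock.poly, RealJordanBlock.mult, C_0, sub_zero]
            rw [← Module.End.mul_apply, ← map_mul, mul_comm, map_mul, Module.End.mul_apply, hz,
              map_zero]))
        · have := isMonomial_of_normalised_real hε hr
          convert this using 3
          beta_reduce
          rw [← Module.End.mul_apply, ← Module.End.mul_apply, ← map_mul, ← map_mul,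
            ← pairing_apply, pairing_aeval_right hA]
      · obtain ⟨x', u', r, p, hu', hx', hx'x', hu'u', -, hx'u'⟩ := exists_isotropic_pair hs hA hn
          (hkill x x hx) (hkill y y hy) (hkill x y hx) hxy (by
            have := pairing_swap hs hA y y (X ^ (n - 1))
            have he : Even (n - 1) := Nat.Odd.sub_odd ho odd_one
            rw [algEquivAevalNegX_X_pow, he.neg_one_pow, one_smul] at this
            linarith)
        have hk : ∀ (z : V) (p : ℝ[X]), aeval A (X ^ n : ℝ[X]) z = 0 →
            aeval A (X ^ n : ℝ[X]) (aeval A p z) = 0 := by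
          intro z p hz
          rw [← Module.End.mul_apply, ← map_mul, mul_comm, map_mul, Module.End.mul_apply, hz,
            map_zero]
        have hu'W : u' ∈ W := by
          rw [hu']; exact W.add_mem hyW (aeval_mem_of_invariant hW _ hxW)
        have hx'W : x' ∈ W := by
          rw [hx']; exact W.add_mem hxW (aeval_mem_of_invariant hW _ hu'W)
        have hu'n : aeval A (X ^ n : ℝ[X]) u' = 0 := by
          rw [hu', map_add, hy, hk _ _ hx, add_zero]
        have hx'n : aeval A (X ^ n : ℝ[X]) x' = 0 := by
          rw [hx', map_add, hx, hk _ _ hu'n, add_zero]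
        obtain ⟨ι, hι, v, hne, hv, hb, hmon⟩ := exists_family_of_isotropic_pair hs hA (.real n 0)
          hn (x := x') (u := u')
          (by simpa only [RealJordanBlock.poly, RealJordanBlock.mult, C_0, sub_zero] using hx'n)
          (by
            simp only [RealJordanBlock.poly, RealJordanBlock.mult, C_0, sub_zero]
            rw [← map_pow, algEquivAevalNegX_X_pow, map_smul, LinearMap.smul_apply, hu'n,
              smul_zero])
          hx'x' hu'u'
          (by simpa only [RealJordanBlock.poly, RealJordanBlock.mult, C_0, sub_zero] using hx'u')
        exact ⟨ι, hι, v, hne, fun i => sup_le (hcycW x' hx'W) (hcycW u' hu'W) (hv i), hb, hmon⟩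
    · refine hcop (fun n => .real n l) (fun _ => rfl) (fun _ => rfl) hl ?_
      simp only [RealJordanBlock.poly]
      rw [dvd_iff_isRoot, map_sub, algEquivAevalNegX_X, algEquivAevalNegX_C]
      intro h
      simp only [IsRoot.def, eval_sub, eval_neg, eval_X, eval_C] at h
      exact hl0 (by linarith)
  · by_cases ha : a = 0
    · subst ha
      have hq := (RealJordanBlock.complex 0 0 b hb).prime_poly
      obtain ⟨n, hn, ⟨x, hxW, hx, hx1⟩, hE⟩ :=
        exists_primary_generator hs hA hW hnd hm0 hm hmin hq hab
      set q := (RealJordanBlock.complex 0 0 b hb).poly with hqdef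
      have hqe : q = X ^ 2 + C (b ^ 2) := by
        simp only [hqdef, RealJordanBlock.poly, C_0, sub_zero]
      have hqneg : algEquivAevalNegX q = q := by
        rw [hqe, map_add, map_pow, algEquivAevalNegX_X, algEquivAevalNegX_C]; ring
      -- Starting from `A x` puts the odd polynomial `q ^ (n - 1) * X` into the pairing of `x` and
      -- `y`, which makes it symmetric. `A x` has the same height as `x` because `X ^ 2 = -b ^ 2`
      -- modulo `q`.
      obtain ⟨y, hyW, hy, hxy⟩ := hE (A x) (hW x hxW)
        (by
          have := aeval_apply_eq_zero_of_dvd (Dvd.intro X rfl : q ^ n ∣ q ^ n * X) hx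
          rwa [map_mul, Module.End.mul_apply, aeval_X] at this)
        (by
          intro h
          have h2 : aeval A (q ^ (n - 1) * X ^ 2) x = 0 := by
            rw [mul_comm, pow_two, mul_assoc, mul_comm X (q ^ (n - 1)), map_mul,
              Module.End.mul_apply, map_mul, Module.End.mul_apply]
            simp only [aeval_X]
            rw [h, map_zero]
          have e : q ^ (n - 1) * X ^ 2 = q ^ n - (b ^ 2) • q ^ (n - 1) := by
            have : q ^ n = q * q ^ (n - 1) := by rw [← pow_succ', Nat.sub_add_cancel hn]
            rw [this, smul_eq_C_mul]
            nth_rw 2 [hqe]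
            ring
          rw [e, map_sub, LinearMap.sub_apply, hx, zero_sub, map_smul, LinearMap.smul_apply,
            neg_eq_zero] at h2
          exact (smul_ne_zero (pow_ne_zero 2 hb.ne') hx1) h2)
      rw [hqneg] at hy
      have hxy' : pairing A β x y (q ^ (n - 1) * X) ≠ 0 := by
        rw [pairing_apply, map_mul, Module.End.mul_apply, aeval_X, ← pairing_apply]
        exact hxy
      obtain ⟨z, ⟨hzW, hz⟩, hzz⟩ := exists_self_pairing_ne_zero (A := A) (β := β)
          (p := q ^ (n - 1) * X) (x := x) (y := y) (fun z => z ∈ W ∧ aeval A (q ^ n) z = 0)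
          ⟨hxW, hx⟩ ⟨hyW, hy⟩ ⟨W.add_mem hxW hyW, by rw [map_add, hx, hy, add_zero]⟩
          (by rw [pairing_swap hs hA x y, map_mul algEquivAevalNegX, map_pow, hqneg,
                algEquivAevalNegX_X, mul_neg, map_neg, neg_neg]) hxy'
      obtain ⟨r, π, hπ, hmon⟩ := exists_normalised_complex hn hb (l := pairing A β z z)
        (fun t => by
          change pairing A β z z (q ^ n * t) = 0
          rw [pairing_apply, mul_comm, map_mul, Module.End.mul_apply, hz]; simp)
        ⟨X, hzz⟩ (pairing_self_odd hs hA z)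
      refine ⟨_, inferInstance, fun i => aeval A (π i) (aeval A r z), ?_, fun i =>
          aeval_mem_of_invariant hW _ (aeval_mem_of_invariant hW _ hzW), ?_, ?_⟩
      · exact ⟨⟨0, Nat.mul_pos hn two_pos⟩⟩
      · refine IsBlockFamily.of_block (b := .complex n 0 b hb) (hπ.family ?_)
        change aeval A (q ^ n) (aeval A r z) = 0
        rw [← Module.End.mul_apply, ← map_mul, mul_comm, map_mul, Module.End.mul_apply, hz,
              map_zero]
      · convert hmon using 3
        beta_reduce
        rw [← Module.End.mul_apply, ← Module.End.mul_apply, ← map_mul, ← map_mul,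
            ← pairing_apply, pairing_aeval_right hA]
    · refine hcop (fun n => .complex n a b hb) (fun _ => rfl) (fun _ => rfl) hab ?_
      intro h
      have hd := RealJordanBlock.natDegree_poly_complex 0 a b hb
      -- The reflection of `q` differs from `q` by `4 a X`, too small in degree to be divisible by
      -- `q` when `a ≠ 0`.
      have h2 : (RealJordanBlock.complex 0 a b hb).poly ∣ C (4 * a) * X := by
        have := dvd_sub h (dvd_refl _)
        convert this using 1
        simp only [RealJordanBlock.poly]
        rw [map_add, map_pow, map_sub, algEquivAevalNegX_X, algEquivAevalNegX_C,
          algEquivAevalNegX_C, C_mul, C_ofNat]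
        ring
      have h5 : (C (4 * a) * X : ℝ[X]) ≠ 0 :=
          mul_ne_zero (C_ne_zero.mpr (mul_ne_zero (by norm_num) ha)) X_ne_zero
      have := natDegree_le_of_dvd h2 h5
      have h6 : (C (4 * a) * X : ℝ[X]).natDegree ≤ 1 :=
        (natDegree_C_mul_le _ _).trans natDegree_X_le
      omega

/-- A nondegenerate invariant subspace is spanned by a monomial Jordan family. -/
theorem exists_monomial_family [FiniteDimensional ℝ V] (hs : ∀ y z, β y z = -β z y)
    (hA : ∀ y z, β (A y) z = -β y (A z)) (W : Submodule ℝ V) (hW : ∀ w ∈ W, A w ∈ W)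
    (hnd : ∀ w ∈ W, (∀ z ∈ W, β w z = 0) → w = 0) :
    ∃ (ι : Type) (_ : Fintype ι) (v : ι → V), Submodule.span ℝ (Set.range v) = W ∧
      IsBlockFamily A v ∧ IsMonomial fun i k => β (v i) (v k) := by
  induction hd : Module.finrank ℝ W using Nat.strong_induction_on generalizing W with
  | _ d ih =>
  by_cases hW0 : W = ⊥
  · subst hW0
    refine ⟨Empty, inferInstance, Empty.elim, by simp, ⟨Empty, inferInstance, Empty.elim,
      ⟨fun k => k.1, Empty.elim, fun k => k.1.elim, fun k => k.elim⟩, fun k => k.elim⟩,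
      ⟨id, Empty.elim, fun i => i.elim, fun i => i.elim⟩⟩
  · obtain ⟨ι, hι, v, ⟨i₀⟩, hvW, hv, hmon⟩ := exists_monomial_family_in hs hA hW hnd hW0
    -- The orthogonal complement of the split-off family in `W`; it inherits invariance from
    -- skewness and nondegeneracy from `W`.
    set U : Submodule ℝ V := W ⊓ ⨅ i, LinearMap.ker (β.flip (v i)) with hU
    have hmemU : ∀ y, y ∈ U ↔ y ∈ W ∧ ∀ i, β y (v i) = 0 := by
      intro y; simp [hU, Submodule.mem_iInf]
    have hspanW : Submodule.span ℝ (Set.range v) ≤ W := by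
      rw [Submodule.span_le]; rintro _ ⟨i, rfl⟩; exact hvW i
    have hUspan : ∀ y ∈ U, ∀ z ∈ Submodule.span ℝ (Set.range v), β y z = 0 := by
      intro y hy z hz
      induction hz using Submodule.span_induction with
      | mem z hz => obtain ⟨i, rfl⟩ := hz; exact ((hmemU y).mp hy).2 i
      | zero => simp
      | add a b _ _ ha hb => rw [map_add, ha, hb, add_zero]
      | smul c a _ ha => rw [map_smul, ha, smul_zero]
    have hlt : Module.finrank ℝ U < d := by
      rw [← hd]
      apply Submodule.finrank_lt_finrank_of_lt
      refine lt_of_le_of_ne inf_le_left fun h => ?_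
      obtain ⟨ρ, s, hs1, h'⟩ := hmon
      have h1 := ((hmemU (v i₀)).mp (h ▸ hvW i₀)).2 (ρ i₀)
      have h2 := (h' i₀ (ρ i₀)).1 rfl
      simp only at h2
      rw [h1] at h2
      rcases hs1 i₀ with h | h <;> rw [h] at h2 <;> norm_num at h2
    have hsup : ∀ w ∈ W, ∃ w' ∈ Submodule.span ℝ (Set.range v), w - w' ∈ U := by
      intro w hw
      obtain ⟨w', hw', h⟩ := hmon.exists_orthogonal_sub hs w
      exact ⟨w', hw', (hmemU _).mpr ⟨W.sub_mem hw (hspanW hw'), h⟩⟩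
    obtain ⟨κ, hκ, u, hu, hub, humon⟩ := ih _ hlt U
      (fun y hy => (hmemU _).mpr ⟨hW _ ((hmemU y).mp hy).1, fun i => by
        rw [hA, hUspan y hy _ (hv.span_invariant (Submodule.subset_span ⟨i, rfl⟩)), neg_zero]⟩)
      (fun y hy h => hnd y ((hmemU y).mp hy).1 fun z hz => by
        obtain ⟨z', hz', hzz⟩ := hsup z hz
        rw [← sub_add_cancel z z', map_add, h _ hzz, hUspan y hy _ hz', add_zero]) rfl
    have huU : ∀ k, u k ∈ U := fun k => hu ▸ Submodule.subset_span ⟨k, rfl⟩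
    refine ⟨ι ⊕ κ, inferInstance, Sum.elim v u, ?_, hv.sum hub, hmon.sum_elim humon
      (fun i k => by rw [hs, ((hmemU _).mp (huU k)).2, neg_zero])
      (fun k i => ((hmemU _).mp (huU k)).2 i)⟩
    rw [Set.Sum.elim_range, Submodule.span_union, hu]
    apply le_antisymm (sup_le hspanW inf_le_left)
    intro w hw
    obtain ⟨w', hw', h⟩ := hsup w hw
    rw [← sub_add_cancel w w', add_comm]
    exact Submodule.add_mem_sup hw' h

end Nondegenerate

/-! ### Monomial Jordan bases for forms with a one-dimensional radical. -/

section Degenerate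

variable {V : Type*} [AddCommGroup V] [Module ℝ V]
  {A : Module.End ℝ V} {β : LinearMap.BilinForm ℝ V}

lemma IsBlockFamily.comp_equiv {ι κ : Type} {v : ι → V} (hv : IsBlockFamily A v) (e : κ ≃ ι) :
    IsBlockFamily A (v ∘ e) := by
  obtain ⟨K, hK, B, ε, h⟩ := hv
  exact ⟨K, hK, B, ε.trans e.symm, fun k j => by simpa using h k j⟩

/-- `Option κ ⊕ ι` and `Option (κ ⊕ ι)` are equivalent. -/
def optionSumEquiv (κ ι : Type) : Option (κ ⊕ ι) ≃ Option κ ⊕ ι where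
  toFun o := o.elim (Sum.inl none) (Sum.map some id)
  invFun := Sum.elim (fun o => o.map Sum.inl) (fun i => some (Sum.inr i))
  left_inv := by rintro (_ | _ | _) <;> rfl
  right_inv := by rintro ((_ | _) | _) <;> rfl

lemma IsBlockFamily.option_sum {ι κ : Type} {v₀ : V} {w : κ → V} {g : ι → V}
    (hw : IsBlockFamily A fun o : Option κ => o.elim v₀ w) (hg : IsBlockFamily A g) :
    IsBlockFamily A fun o : Option (κ ⊕ ι) => o.elim v₀ (Sum.elim w g) := by
  convert (hw.sum hg).comp_equiv (optionSumEquiv κ ι) using 1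
  ext (_ | _ | _) <;> rfl

lemma range_option_elim {E : Type*} {κ : Type} (v₀ : E) (w : κ → E) :
    Set.range (fun o : Option κ => o.elim v₀ w) = insert v₀ (Set.range w) := by
  ext y
  simp [Option.exists, eq_comm]

/-- A Jordan family which contains a radical vector and is otherwise monomial can be extended by
a monomial Jordan family of an orthogonal complement. -/
lemma exists_option_family_of_splitting [FiniteDimensional ℝ V] (hs : ∀ y z, β y z = -β z y)
    (hA : ∀ y z, β (A y) z = -β y (A z)) {v₀ : V} (hv₀ : ∀ y, β v₀ y = 0)
    (hrad : ∀ y, (∀ z, β y z = 0) → ∃ c : ℝ, y = c • v₀)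
    {φ : V →ₗ[ℝ] ℝ} (hφ : φ v₀ ≠ 0) {μ : ℝ} {u : V} (hu : ∀ y, β y u = φ (A y - μ • y))
    {κ : Type} [Fintype κ] {w : κ → V} (hw : IsBlockFamily A fun o : Option κ => o.elim v₀ w)
    (hmon : IsMonomial fun i k => β (w i) (w k))
    (huw : u ∈ Submodule.span ℝ (Set.range fun o : Option κ => o.elim v₀ w)) :
    ∃ (κ' : Type) (_ : Fintype κ') (w' : κ' → V),
      IsBlockFamily A (fun o : Option κ' => o.elim v₀ w') ∧
      Submodule.span ℝ (Set.range fun o : Option κ' => o.elim v₀ w') = ⊤ ∧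
      IsMonomial fun i k => β (w' i) (w' k) := by
  have hv₀' : ∀ y, β y v₀ = 0 := fun y => by rw [hs, hv₀, neg_zero]
  set S := Submodule.span ℝ (Set.range fun o : Option κ => o.elim v₀ w) with hS
  have hwS : ∀ i, w i ∈ S := fun i => Submodule.subset_span ⟨some i, rfl⟩
  have hvS : v₀ ∈ S := Submodule.subset_span ⟨none, rfl⟩
  -- Orthogonality to `v₀` is vacuous, so the condition `φ y = 0` is what separates the complement
  -- from the radical.
  set U : Submodule ℝ V := LinearMap.ker φ ⊓ ⨅ i, LinearMap.ker (β.flip (w i)) with hU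
  have hmemU : ∀ y, y ∈ U ↔ φ y = 0 ∧ ∀ i, β y (w i) = 0 := by
    intro y; simp [hU, Submodule.mem_iInf]
  have hUS : ∀ y ∈ U, ∀ z ∈ S, β y z = 0 := by
    intro y hy z hz
    induction hz using Submodule.span_induction with
    | mem z hz =>
      obtain ⟨o, rfl⟩ := hz
      cases o with
      | none => exact hv₀' y
      | some i => exact ((hmemU y).mp hy).2 i
    | zero => simp
    | add a b _ _ ha hb => rw [map_add, ha, hb, add_zero]
    | smul c a _ ha => rw [map_smul, ha, smul_zero]
  have hsup : ∀ y, ∃ y' ∈ S, y - y' ∈ U := by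
    intro y
    obtain ⟨y₁, hy₁, h⟩ := hmon.exists_orthogonal_sub hs y
    have hy₁S : y₁ ∈ S := by
      refine Submodule.span_le.mpr ?_ hy₁
      rintro _ ⟨i, rfl⟩; exact hwS i
    refine ⟨y₁ + (φ (y - y₁) / φ v₀) • v₀, S.add_mem hy₁S (S.smul_mem _ hvS), ?_⟩
    rw [hmemU, ← sub_sub]
    refine ⟨?_, fun i => ?_⟩
    · rw [map_sub, map_smul, smul_eq_mul, div_mul_cancel₀ _ hφ, sub_self]
    · rw [map_sub, LinearMap.sub_apply, h, map_smul, LinearMap.smul_apply, hv₀, smul_zero,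
        sub_zero]
  obtain ⟨κ', hκ', g, hg, hgb, hgm⟩ := exists_monomial_family hs hA U
    (fun y hy => by
      rw [hmemU]
      refine ⟨?_, fun i => ?_⟩
      -- This is what `u` is for: on `ker φ`, the value `φ (A y)` equals `β y u`, which vanishes
      -- because `u` lies in the span of the family.
      · have h1 := hUS y hy u huw
        rw [hu, map_sub, map_smul, ((hmemU y).mp hy).1, smul_zero, sub_zero] at h1
        exact h1
      · rw [hA, hUS y hy _ (hw.span_invariant (hwS i)), neg_zero])
    (fun y hy h => by
      obtain ⟨c, hc⟩ := hrad y fun z => by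
        obtain ⟨z', hz', hzz⟩ := hsup z
        rw [← sub_add_cancel z z', map_add, h _ hzz, hUS y hy _ hz', add_zero]
      have := ((hmemU y).mp hy).1
      rw [hc, map_smul, smul_eq_mul] at this
      rw [hc, (mul_eq_zero.mp this).resolve_right hφ, zero_smul])
  have hgU : ∀ k, g k ∈ U := fun k => hg ▸ Submodule.subset_span ⟨k, rfl⟩
  refine ⟨κ ⊕ κ', inferInstance, Sum.elim w g, hw.option_sum hgb, ?_, hmon.sum_elim hgm
    (fun i k => by rw [hs, hUS _ (hgU k) _ (hwS i), neg_zero])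
    (fun k i => hUS _ (hgU k) _ (hwS i))⟩
  rw [range_option_elim, Set.Sum.elim_range, ← Set.insert_union, Submodule.span_union, hg,
    ← range_option_elim, eq_top_iff]
  intro y _
  obtain ⟨y', hy', h⟩ := hsup y
  rw [← sub_add_cancel y y', add_comm]
  exact Submodule.add_mem_sup hy' h

/-- A chain of length `l + 1` with its last vector, the eigenvector when nonzero, singled out as
`none`. -/
lemma isBlockFamily_option {l : ℕ} {μ : ℝ} {x : V} (hx : aeval A ((X - C μ) ^ (l + 1)) x = 0) :
    IsBlockFamily A fun o : Option (Fin l) => o.elim (aeval A ((X - C μ) ^ l) x)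
      (fun i : Fin l => aeval A ((X - C μ) ^ (l - 1 - (i : ℕ))) x) := by
  have := (IsBlockFamily.of_block (b := .real (l + 1) μ)
    ((isBlockPoly_real (l + 1) μ).family hx)).comp_equiv (finSuccEquiv l).symm
  convert this using 1
  ext (_ | i)
  · change _ = aeval A ((X - C μ) ^ (l + 1 - 1 - ((finSuccEquiv l).symm none : ℕ))) x
    rw [finSuccEquiv_symm_none]
    rfl
  · change _ = aeval A ((X - C μ) ^ (l + 1 - 1 - ((finSuccEquiv l).symm (some i) : ℕ))) x
    rw [finSuccEquiv_symm_some, Fin.val_succ]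
    simp only [Option.elim_some]
    congr 3; omega

/-- The chain of `x` runs down to `v₀`. Its first `l` vectors pair perfectly with the chain of `u`,
the top pairing being `φ v₀`. Both chains are isotropic, so together without `v₀` they are monomial.
-/
lemma exists_option_family_of_pair [FiniteDimensional ℝ V] (hs : ∀ y z, β y z = -β z y)
    (hA : ∀ y z, β (A y) z = -β y (A z)) {v₀ : V} (hv₀ : ∀ y, β v₀ y = 0)
    (hrad : ∀ y, (∀ z, β y z = 0) → ∃ c : ℝ, y = c • v₀)
    {φ : V →ₗ[ℝ] ℝ} (hφ : φ v₀ ≠ 0) {μ : ℝ} (hAv₀ : A v₀ = μ • v₀)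
    {u : V} (hu : ∀ y, β y u = φ (A y - μ • y)) {l : ℕ} (hl : 0 < l) {x : V}
    (hx : aeval A ((X - C μ) ^ l) x = v₀)
    (hul : aeval A (algEquivAevalNegX (X - C μ) ^ l) u = 0)
    (hxx : ∀ t, pairing A β x x t = 0) (huu : ∀ t, pairing A β u u t = 0) :
    ∃ (κ' : Type) (_ : Fintype κ') (w' : κ' → V),
      IsBlockFamily A (fun o : Option κ' => o.elim v₀ w') ∧
      Submodule.span ℝ (Set.range fun o : Option κ' => o.elim v₀ w') = ⊤ ∧
      IsMonomial fun i k => β (w' i) (w' k) := by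
  have hπ := isBlockPoly_real l μ
  have hrad' : ∀ (t : ℝ[X]) y, β (aeval A t v₀) y = 0 := fun t y => by
    rw [aeval_adjoint hA, hv₀]
  obtain ⟨b', g, ρ, s, hg, hgs, hs1, hdual⟩ := exists_dual_family hA hπ (x := x) (u := u)
    (fun t => by
      change pairing A β x u ((X - C μ) ^ l * t) = 0
      rw [pairing_apply, mul_comm, map_mul, Module.End.mul_apply, hx, hrad'])
    ⟨1, by
      change pairing A β x u ((X - C μ) ^ (l - 1) * 1) ≠ 0
      rw [mul_one, pairing_apply, hu]
      have : A (aeval A ((X - C μ) ^ (l - 1)) x) - μ • aeval A ((X - C μ) ^ (l - 1)) x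
          = aeval A ((X - C μ) ^ l) x := by
        rw [show (X - C μ) ^ l = (X - C μ) * (X - C μ) ^ (l - 1) by
          rw [← pow_succ', Nat.sub_add_cancel hl], map_mul, Module.End.mul_apply]
        simp [Module.algebraMap_end_apply]
      rw [this, hx]
      exact hφ⟩ hul
  have hmem : ∀ j, g j ∈ cyc A u := fun j => hgs ▸ Submodule.subset_span ⟨j, rfl⟩
  have hb := isBlockFamily_option (A := A) (l := l) (μ := μ) (x := x) (by
    rw [pow_succ', map_mul, Module.End.mul_apply, hx]
    simp [Module.algebraMap_end_apply, hAv₀])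
  rw [hx] at hb
  refine exists_option_family_of_splitting hs hA hv₀ hrad hφ hu
    (hb.option_sum (IsBlockFamily.of_block hg)) ?_ ?_
  · exact IsMonomial.of_dual (ι := Fin l) hs ρ hs1
      (fun i k => isotropic_cyc hA hxx (mem_cyc.mpr ⟨_, rfl⟩) (mem_cyc.mpr ⟨_, rfl⟩))
      (fun i k => isotropic_cyc hA huu (hmem i) (hmem k)) hdual
  · have : u ∈ Submodule.span ℝ (Set.range g) := by
      rw [hgs]; exact mem_cyc.mpr ⟨1, by simp⟩
    refine Submodule.span_mono ?_ this
    rintro _ ⟨j, rfl⟩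
    exact ⟨some (Sum.inr j), rfl⟩

/-- A skew form with one-dimensional radical and a skew endomorphism admit a Jordan family
consisting of a radical vector and a monomial family. -/
theorem exists_option_family [FiniteDimensional ℝ V] (hs : ∀ y z, β y z = -β z y)
    (hA : ∀ y z, β (A y) z = -β y (A z)) {v₀ : V} (hv₀0 : v₀ ≠ 0) (hv₀ : ∀ y, β v₀ y = 0)
    (hrad : ∀ y, (∀ z, β y z = 0) → ∃ c : ℝ, y = c • v₀)
    (hrep : ∀ f : V →ₗ[ℝ] ℝ, f v₀ = 0 → ∃ u, ∀ y, β y u = f y) :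
    ∃ (κ : Type) (_ : Fintype κ) (v₁ : V) (w : κ → V), (∀ y, β v₁ y = 0) ∧
      IsBlockFamily A (fun o : Option κ => o.elim v₁ w) ∧
      Submodule.span ℝ (Set.range fun o : Option κ => o.elim v₁ w) = ⊤ ∧
      IsMonomial fun i k => β (w i) (w k) := by
  obtain ⟨μ, hμ⟩ := hrad (A v₀) fun z => by rw [hA, hv₀, neg_zero]
  have hrad' : ∀ (t : ℝ[X]) y, β (aeval A t v₀) y = 0 := fun t y => by
    rw [aeval_adjoint hA, hv₀]
  have hq : ∀ y, aeval A (X - C μ) y = A y - μ • y := fun y => by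
    simp [Module.algebraMap_end_apply]
  have hqv : aeval A (X - C μ) v₀ = 0 := by rw [hq, hμ, sub_self]
  -- The chain ending at `v₀` cannot be arbitrarily long, since kernels of powers stabilise at the
  -- dimension. Its maximal length is `l + 1`.
  have hex : ∃ n, ∀ z, aeval A ((X - C μ) ^ n) z ≠ v₀ := by
    refine ⟨Module.finrank ℝ V, fun z hz => hv₀0 ?_⟩
    have h1 : z ∈ LinearMap.ker (aeval A (X - C μ) ^ (Module.finrank ℝ V + 1)) := by
      rw [LinearMap.mem_ker, ← map_pow, pow_succ', map_mul, Module.End.mul_apply, hz, hqv]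
    rw [Module.End.ker_pow_eq_ker_pow_finrank_of_le (Nat.le_succ _), LinearMap.mem_ker,
      ← map_pow, hz] at h1
    exact h1
  classical
  obtain ⟨l, hlf⟩ : ∃ l, Nat.find hex = l + 1 := by
    refine Nat.exists_eq_succ_of_ne_zero fun h => ?_
    have := Nat.find_spec hex v₀
    rw [h] at this
    simp at this
  have hk : ∀ z, aeval A ((X - C μ) ^ (l + 1)) z ≠ v₀ := hlf ▸ Nat.find_spec hex
  obtain ⟨x, hx⟩ : ∃ x, aeval A ((X - C μ) ^ l) x = v₀ := by
    have := Nat.find_min hex (m := l) (by omega)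
    push Not at this
    exact this
  -- `φ` detects `v₀` and vanishes on the range of the next power. The second property makes the
  -- `l`-th power of the reflected operator send the representing vector `u` into the radical.
  obtain ⟨φ, hφ, hφk⟩ : ∃ φ : V →ₗ[ℝ] ℝ, φ v₀ ≠ 0 ∧
      ∀ z, φ (aeval A ((X - C μ) ^ (l + 1)) z) = 0 := by
    obtain ⟨φ, h1, h2⟩ := Submodule.exists_le_ker_of_notMem
      (p := LinearMap.range (aeval A ((X - C μ) ^ (l + 1)))) (v := v₀)
      (by rintro ⟨z, hz⟩; exact hk z hz)
    exact ⟨φ, h1, fun z => h2 ⟨z, rfl⟩⟩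
  obtain ⟨u, hu⟩ := hrep (φ.comp (aeval A (X - C μ))) (by simp only [LinearMap.comp_apply, hqv,
    map_zero])
  simp only [LinearMap.comp_apply] at hu
  have hu' : ∀ y, β y u = φ (A y - μ • y) := fun y => by rw [hu, hq]
  have hulrad : ∀ z, β (aeval A (algEquivAevalNegX (X - C μ) ^ l) u) z = 0 := by
    intro z
    rw [hs, ← map_pow, ← aeval_adjoint hA, hu, ← Module.End.mul_apply, ← map_mul, ← pow_succ',
      hφk, neg_zero]
  suffices h : ∃ v₁ : V, (∀ y, β v₁ y = 0) ∧ ∃ (κ : Type) (_ : Fintype κ) (w : κ → V),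
      IsBlockFamily A (fun o : Option κ => o.elim v₁ w) ∧
      Submodule.span ℝ (Set.range fun o : Option κ => o.elim v₁ w) = ⊤ ∧
      IsMonomial fun i k => β (w i) (w k) by
    obtain ⟨v₁, h1, κ, hκ, w, h2⟩ := h
    exact ⟨κ, hκ, v₁, w, h1, h2⟩
  rcases Nat.eq_zero_or_pos l with rfl | hl
  · refine ⟨v₀, hv₀, ?_⟩
    have hb := isBlockFamily_option (A := A) (l := 0) (μ := μ) (x := x) (by
      rw [pow_succ', map_mul, Module.End.mul_apply, hx, hqv])
    rw [hx] at hb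
    refine exists_option_family_of_splitting hs hA hv₀ hrad hφ hu' hb
      ⟨id, fun _ => 1, fun i => i.elim0, fun i => i.elim0⟩ ?_
    obtain ⟨c, hc⟩ := hrad u (fun z => by simpa using hulrad z)
    rw [hc]
    exact Submodule.smul_mem _ _ (Submodule.subset_span ⟨none, rfl⟩)
  · by_cases hμ0 : μ = 0
    · subst hμ0
      simp only [C_0, sub_zero] at hx hφk hulrad hqv hu hu' hk
      have hXl : ∀ z, β (aeval A (X ^ l : ℝ[X]) u) z = 0 := by
        intro z
        have := hulrad z
        rw [← map_pow, algEquivAevalNegX_X_pow, map_smul, LinearMap.smul_apply, map_smul,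
          LinearMap.smul_apply, smul_eq_mul] at this
        exact (mul_eq_zero.mp this).resolve_left (pow_ne_zero _ (by norm_num))
      obtain ⟨c, hc⟩ := hrad _ hXl
      have hXl' : aeval A (X : ℝ[X]) (aeval A (X ^ (l - 1) : ℝ[X]) u) = c • v₀ := by
        rw [← hc, ← Module.End.mul_apply, ← map_mul, ← pow_succ', Nat.sub_add_cancel hl]
      have hcφ : pairing A β u u (X ^ (l - 1)) = c * φ v₀ := by
        rw [pairing_apply, hu, hXl', map_smul, smul_eq_mul]
      have huu : ∀ t, pairing A β u u (X ^ l * t) = 0 := by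
        intro t
        rw [pairing_apply, mul_comm, map_mul, Module.End.mul_apply, hc, map_smul, map_smul,
          LinearMap.smul_apply, hrad', smul_zero]
      -- Here `A ^ l u = c v₀`, and the top self-pairing of `u` is `c φ(v₀)`. It vanishes when `u`
      -- is killed by `A ^ l`; otherwise the chain of `u` itself reaches the radical.
      by_cases htop : pairing A β u u (X ^ (l - 1)) = 0
      · have hc0 : c = 0 := by
          rw [hcφ] at htop
          exact (mul_eq_zero.mp htop).resolve_right hφ
        rw [hc0, zero_smul] at hc
        have hxkill : ∀ w t, pairing A β x w (X ^ l * t) = 0 := by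
          intro w t
          rw [pairing_apply, mul_comm, map_mul, Module.End.mul_apply, hx, hrad']
        obtain ⟨x', u', r, p, hu'r, hx'p, hx'x', hu'u', -, -⟩ := exists_isotropic_pair hs hA hl
          (hxkill x) huu (hxkill u) (by
            rw [pairing_apply, hu, ← Module.End.mul_apply, ← map_mul, ← pow_succ',
              Nat.sub_add_cancel hl, hx]
            exact hφ) htop
        have hcomm : ∀ (p s : ℝ[X]) z, aeval A p (aeval A s z) = aeval A s (aeval A p z) := by
          intro p s z
          rw [← Module.End.mul_apply, ← map_mul, mul_comm, map_mul, Module.End.mul_apply]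
        have hu'l : aeval A (X ^ l : ℝ[X]) u' = 0 := by
          rw [hu'r, map_add, hc, zero_add, hcomm, hx, mul_comm, map_mul, Module.End.mul_apply,
            hqv, map_zero]
        -- Replacing `u` by `u + A r(A) x` changes the functional it represents; by skewness the
        -- correction to `φ` is `-β (·, r(A) x)`, which leaves the value at `v₀` unchanged.
        refine ⟨v₀, hv₀, exists_option_family_of_pair hs hA hv₀ hrad
          (φ := φ - β.flip (aeval A r x)) (μ := 0) (u := u') (l := l) (x := x')
          ?_ hμ ?_ hl ?_ ?_ hx'x' hu'u'⟩
        · simpa [hv₀] using hφ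
        · intro y
          rw [hu'r, map_add, hu', map_mul, aeval_X, Module.End.mul_apply]
          simp only [zero_smul, sub_zero, LinearMap.sub_apply, LinearMap.BilinForm.flip_apply]
          have h1 := hA y (aeval A r x)
          rw [h1]; ring
        · rw [C_0, sub_zero, hx'p, map_add, hx, hcomm, hu'l, map_zero, add_zero]
        · rw [C_0, sub_zero, ← map_pow, algEquivAevalNegX_X_pow, map_smul, LinearMap.smul_apply,
            hu'l, smul_zero]
      · have hodd : Even l := by
          by_contra ho
          have ho : Even (l - 1) := Nat.Odd.sub_odd (Nat.not_even_iff_odd.mp ho) odd_one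
          apply htop
          have := pairing_swap hs hA u u (X ^ (l - 1))
          rw [algEquivAevalNegX_X_pow, ho.neg_one_pow, one_smul] at this
          linarith
        have hc0 : c ≠ 0 := by
          rintro rfl
          rw [zero_mul] at hcφ
          exact htop hcφ
        -- Now one chain of length `l + 1`, generated by `r(A) u`, is monomial off its end. That end
        -- is a nonzero multiple of `v₀`, which is why the radical vector of the basis may differ
        -- from `v₀`.
        obtain ⟨r, ε, hε, hr, hrm⟩ := exists_normalised_real hl hodd huu
          ⟨1, by simpa using htop⟩ (pairing_self_odd hs hA u)
        have hu1 : aeval A (X ^ (l + 1) : ℝ[X]) u = 0 := by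
          rw [pow_succ', map_mul, Module.End.mul_apply, hc, map_smul, hqv, smul_zero]
        have hru1 : aeval A (X ^ (l + 1) : ℝ[X]) (aeval A r u) = 0 := by
          rw [← Module.End.mul_apply, ← map_mul, mul_comm, map_mul, Module.End.mul_apply, hu1,
            map_zero]
        have hv1 : aeval A (X ^ l : ℝ[X]) (aeval A r u) = (r.coeff 0 * c) • v₀ := by
          rw [← Module.End.mul_apply, ← map_mul, mul_comm, map_mul, Module.End.mul_apply, hc,
            map_smul]
          have : aeval A r v₀ = r.coeff 0 • v₀ := by
            have h := X_mul_divX_add r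
            conv_lhs => rw [← h]
            rw [map_add, LinearMap.add_apply, mul_comm, map_mul, Module.End.mul_apply, hqv,
              map_zero, zero_add, aeval_C, Module.algebraMap_end_apply]
          rw [this, smul_smul, mul_comm]
        have hr0 : r.coeff 0 ≠ 0 := fun h => hr (X_dvd_iff.mpr h)
        have hb := isBlockFamily_option (A := A) (l := l) (μ := 0) (x := aeval A r u)
          (by rw [C_0, sub_zero]; exact hru1)
        simp only [C_0, sub_zero] at hb
        refine ⟨aeval A (X ^ l : ℝ[X]) (aeval A r u), fun y => by
          rw [hv1, map_smul, LinearMap.smul_apply, hv₀, smul_zero],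
          exists_option_family_of_splitting hs hA
          (fun y => by rw [hv1, map_smul, LinearMap.smul_apply, hv₀, smul_zero]) ?_
          (φ := φ) ?_ (μ := 0) (by simpa using hu') hb ?_ ?_⟩
        · intro y hy
          obtain ⟨d, hd⟩ := hrad y hy
          refine ⟨d / (r.coeff 0 * c), ?_⟩
          rw [hv1, smul_smul, div_mul_cancel₀ _ (mul_ne_zero hr0 hc0), hd]
        · rw [hv1, map_smul, smul_eq_mul]
          exact mul_ne_zero (mul_ne_zero hr0 hc0) hφ
        · have := isMonomial_of_normalised_real hε hrm
          convert this using 3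
          rw [← Module.End.mul_apply, ← Module.End.mul_apply, ← map_mul, ← map_mul,
            ← pairing_apply, pairing_aeval_right hA]
        -- `r` is invertible modulo `X ^ (l + 1)`, so `r(A) u` generates the same cyclic space as
        -- `u`.
        · have h1 : IsCoprime r (X ^ (l + 1)) :=
            ((prime_X.irreducible.coprime_iff_not_dvd).mpr hr).symm.pow_right
          obtain ⟨a, b, hab⟩ := h1
          have hcycu : u ∈ cyc A (aeval A r u) := by
            refine mem_cyc.mpr ⟨a, ?_⟩
            have := congrArg (fun p => aeval A p u) hab
            simp only [map_add, LinearMap.add_apply, map_one, Module.End.one_apply] at this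
            rw [map_mul (aeval A) b, Module.End.mul_apply, hu1, map_zero, add_zero, map_mul,
              Module.End.mul_apply] at this
            exact this
          have h2 := (isBlockPoly_real (l + 1) 0).2.span_eq_cyc (A := A) (x := aeval A r u)
            (by change aeval A ((X - C 0) ^ (l + 1)) _ = 0; rw [C_0, sub_zero]; exact hru1)
          rw [← h2] at hcycu
          refine Submodule.span_mono ?_ hcycu
          rintro _ ⟨i, rfl⟩
          obtain ⟨o, rfl⟩ : ∃ o, (finSuccEquiv l).symm o = i := (finSuccEquiv l).symm.surjective i
          refine ⟨o, ?_⟩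
          cases o with
          | none => simp
          | some i =>
            simp only [Option.elim_some, finSuccEquiv_symm_some, Fin.val_succ, C_0, sub_zero]
            congr 3; omega
    · obtain ⟨c, hc⟩ := hrad _ hulrad
      have hneg : ∀ y, aeval A (algEquivAevalNegX (X - C μ)) y = -(A y) - μ • y := fun y => by
        rw [map_sub, algEquivAevalNegX_X, algEquivAevalNegX_C]
        simp [Module.algebraMap_end_apply]
      have hnegv : ∀ n, aeval A (algEquivAevalNegX (X - C μ) ^ n) v₀ = (-2 * μ) ^ n • v₀ := by
        intro n
        induction n with
        | zero => simp
        | succ n ih =>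
          rw [pow_succ, map_mul, Module.End.mul_apply, hneg, hμ,
            show -(μ • v₀) - μ • v₀ = (-2 * μ) • v₀ by module, map_smul, ih, smul_smul,
            pow_succ, mul_comm]
      have hμ2 : (-2 * μ) ^ l ≠ 0 := pow_ne_zero _ (mul_ne_zero (by norm_num) hμ0)
      have hcop : IsCoprime (X - C μ) (algEquivAevalNegX (X - C μ)) := by
        refine ((prime_X_sub_C μ).irreducible.coprime_iff_not_dvd).mpr fun h => hμ0 ?_
        rw [dvd_iff_isRoot, map_sub, algEquivAevalNegX_X, algEquivAevalNegX_C] at h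
        simp only [IsRoot.def, eval_sub, eval_neg, eval_X, eval_C] at h
        linarith
      -- For `μ ≠ 0` the reflected operator acts on `v₀` by the nonzero scalar `-2 μ`, so the
      -- radical error can be removed without changing the functional represented by `u`.
      have hul : aeval A (algEquivAevalNegX (X - C μ) ^ l) (u - (c / (-2 * μ) ^ l) • v₀) = 0 := by
        rw [map_sub, map_smul, hnegv, hc, smul_smul, div_mul_cancel₀ _ hμ2, sub_self]
      refine ⟨v₀, hv₀, exists_option_family_of_pair hs hA hv₀ hrad hφ hμ
        (u := u - (c / (-2 * μ) ^ l) • v₀) ?_ hl hx hul ?_ ?_⟩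
      · intro y
        rw [map_sub, map_smul, hs y v₀, hv₀, hu']; simp
      · exact pairing_self_eq_zero_of_isCoprime hA hcop (n := l + 1)
          (by rw [pow_succ', map_mul, Module.End.mul_apply, hx, hqv])
      · exact pairing_self_eq_zero_of_isCoprime hA
          (by rw [algEquivAevalNegX_algEquivAevalNegX]; exact hcop.symm) hul

end Degenerate

/-! ### Uniqueness of the real Jordan form. -/

section Uniqueness

/-- The sign condition `b > 0` lets the quadratic determine `a` and `b`; the degree separates real
from complex blocks. -/
lemma RealJordanBlock.eq_of_poly_eq {b b' : RealJordanBlock} (hp : b.poly = b'.poly)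
    (hm : b.mult = b'.mult) : b = b' := by
  cases b with
  | real n l =>
    cases b' with
    | real n' l' =>
      simp only [poly, mult] at hp hm
      rw [hm, C_injective (sub_right_injective hp)]
    | complex n' a' b' hb' =>
      have := congrArg natDegree hp
      rw [natDegree_poly_complex] at this
      simp [poly] at this
  | complex n a b hb =>
    cases b' with
    | real n' l' =>
      have := congrArg natDegree hp
      rw [natDegree_poly_complex] at this
      simp [poly] at this
    | complex n' a' b' hb' =>
      simp only [poly, mult] at hp hm
      have h1 := congrArg (eval a) hp
      have h2 := congrArg (eval a') hp
      simp only [eval_add, eval_pow, eval_sub, eval_X, eval_C] at h1 h2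
      have ha : a = a' := by
        have : (a - a') ^ 2 = 0 := by nlinarith
        linarith [pow_eq_zero_iff (two_ne_zero) |>.mp this]
      subst ha
      have hbb : b = b' := by
        have : b ^ 2 = b' ^ 2 := by nlinarith
        exact (pow_left_inj₀ hb.le hb'.le two_ne_zero).mp this
      subst hbb
      subst hm
      rfl

lemma finrank_cyc {V : Type*} [AddCommGroup V] [Module ℝ V] {A : Module.End ℝ V} {y : V}
    {g : ℝ[X]} (hg : g.Monic) (h : ∀ p, aeval A p y = 0 ↔ g ∣ p) :
    Module.finrank ℝ (cyc A y) = g.natDegree := by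
  let Φ : degreeLT ℝ g.natDegree →ₗ[ℝ] V :=
    ((LinearMap.applyₗ y).comp (aeval A).toLinearMap).comp (degreeLT ℝ g.natDegree).subtype
  have hΦ : ∀ p, Φ p = aeval A (p : ℝ[X]) y := fun p => rfl
  have hinj : Function.Injective Φ := by
    rw [injective_iff_map_eq_zero]
    rintro ⟨p, hp⟩ h0
    rw [hΦ, h] at h0
    refine Subtype.ext (eq_zero_of_dvd_of_degree_lt h0 ?_)
    rw [mem_degreeLT] at hp
    rwa [degree_eq_natDegree hg.ne_zero]
  have hrange : LinearMap.range Φ = cyc A y := by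
    ext z
    rw [mem_cyc]
    constructor
    · rintro ⟨p, rfl⟩; exact ⟨p, rfl⟩
    · rintro ⟨p, rfl⟩
      refine ⟨⟨p %ₘ g, ?_⟩, ?_⟩
      · rw [mem_degreeLT, ← degree_eq_natDegree hg.ne_zero]
        exact degree_modByMonic_lt _ hg
      · rw [hΦ]
        have h1 : aeval A (p - p %ₘ g) y = 0 :=
          (h _).mpr ⟨p /ₘ g, by linear_combination -(modByMonic_add_div p g)⟩
        rw [map_sub, LinearMap.sub_apply, sub_eq_zero] at h1
        exact h1.symm
  rw [← hrange, LinearMap.finrank_range_of_inj hinj, (degreeLTEquiv ℝ _).finrank_eq]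
  simp

/-- The endomorphism of `ℝ ^ n` given by a block. -/
noncomputable def blockEnd (b : RealJordanBlock) : Module.End ℝ (Fin b.size → ℝ) :=
  Matrix.toLin' b.matrix

/-- A block is cyclic, with annihilator generated by `poly ^ mult`. -/
lemma blockEnd_cyclic (b : RealJordanBlock) : ∃ x, (∀ c, ∃ p : ℝ[X], aeval (blockEnd b) p x = c) ∧
    ∀ p : ℝ[X], aeval (blockEnd b) p x = 0 ↔ b.poly ^ b.mult ∣ p := by
  obtain ⟨π, hπ⟩ := exists_isBlockPoly b
  set g := b.poly ^ b.mult with hg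
  have hgm : g.Monic := b.monic_poly.pow _
  let Q := ℝ[X] ⧸ Ideal.span {g}
  let mk : ℝ[X] →ₐ[ℝ] Q := Ideal.Quotient.mkₐ ℝ (Ideal.span {g})
  have hmk : ∀ p, mk p = 0 ↔ g ∣ p := fun p => by
    change Ideal.Quotient.mk _ p = 0 ↔ _
    rw [Ideal.Quotient.eq_zero_iff_mem, Ideal.mem_span_singleton]
  -- Sending the standard basis to the `π i` identifies the block with multiplication by `X` on
  -- `ℝ[X] / (g)`.
  let Φ : (Fin b.size → ℝ) →ₗ[ℝ] Q := Fintype.linearCombination ℝ (fun i => mk (π i))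
  have hΦ : ∀ c, Φ c = mk (∑ i, C (c i) * π i) := by
    intro c
    rw [Fintype.linearCombination_apply, map_sum]
    refine Finset.sum_congr rfl fun i _ => ?_
    rw [← smul_eq_C_mul, map_smul]
  have hsurj : Function.Surjective Φ := by
    intro z
    obtain ⟨t, rfl⟩ := Ideal.Quotient.mkₐ_surjective ℝ (Ideal.span {g}) z
    obtain ⟨c, hc⟩ := hπ.2 t
    refine ⟨c, ?_⟩
    rw [hΦ]
    have := (hmk _).mpr hc
    rw [map_sub, sub_eq_zero] at this
    exact this.symm
  have hfin : Module.finrank ℝ (Fin b.size → ℝ) = Module.finrank ℝ Q := by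
    rw [finrank_quotient_span_eq_natDegree, hg, b.natDegree_poly_pow]; simp
  have : FiniteDimensional ℝ Q := Module.Finite.of_surjective Φ hsurj
  have hinj : Function.Injective Φ :=
    (LinearMap.injective_iff_surjective_of_finrank_eq_finrank hfin).mpr hsurj
  have hX : ∀ c, Φ (blockEnd b c) = mk X * Φ c := by
    intro c
    have : Φ ∘ₗ blockEnd b = (LinearMap.mulLeft ℝ (mk X)) ∘ₗ Φ := by
      refine (Pi.basisFun ℝ (Fin b.size)).ext fun j => ?_
      simp only [LinearMap.comp_apply, Pi.basisFun_apply, LinearMap.mulLeft_apply]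
      have e1 : blockEnd b (Pi.single j 1) = fun i => b.matrix i j := by
        rw [blockEnd, Matrix.toLin'_apply, Matrix.mulVec_single_one]; rfl
      have e2 : Φ (Pi.single j 1) = mk (π j) := by
        rw [Fintype.linearCombination_apply_single, one_smul]
      rw [e1, e2, hΦ, ← map_mul, eq_comm, ← sub_eq_zero, ← map_sub, hmk]
      simpa only [smul_eq_C_mul] using hπ.1 j
    exact LinearMap.congr_fun this c
  have hp : ∀ (p : ℝ[X]) c, Φ (aeval (blockEnd b) p c) = mk p * Φ c := by
    intro p
    induction p using Polynomial.induction_on with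
    | C a =>
      intro c
      rw [aeval_C, Module.algebraMap_end_apply, map_smul]
      have : mk (C a) = algebraMap ℝ Q a := mk.commutes a
      rw [this]
      exact Algebra.smul_def a (Φ c)
    | add p q hp hq => intro c; rw [map_add, LinearMap.add_apply, map_add, hp, hq, map_add, add_mul]
    | monomial n a ih =>
      intro c
      rw [pow_succ, ← mul_assoc, map_mul (aeval (blockEnd b)) (C a * X ^ n) X, aeval_X,
        Module.End.mul_apply, ih, hX, map_mul mk (C a * X ^ n) X, mul_assoc]
  obtain ⟨x, hx⟩ := hsurj (mk 1)
  have hx1 : Φ x = 1 := by rw [hx, map_one]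
  refine ⟨x, fun c => ?_, fun p => ?_⟩
  · obtain ⟨t, ht⟩ := Ideal.Quotient.mkₐ_surjective ℝ (Ideal.span {g}) (Φ c)
    refine ⟨t, hinj ?_⟩
    rw [hp, hx1, mul_one]
    exact ht
  · rw [← hmk, ← map_eq_zero_iff Φ hinj, hp, hx1, mul_one]

/-- On `ℝ[X] / (q ^ n)` with `m < n` the kernel of `q ^ m` is generated by `q ^ (n - m)`; for `m ≥
n` it is everything. A different monic prime acts invertibly. -/
lemma finrank_ker_blockEnd (b b' : RealJordanBlock) (m : ℕ) [Decidable (b'.poly = b.poly)] :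
    Module.finrank ℝ (LinearMap.ker (aeval (blockEnd b) (b'.poly ^ m))) =
      if b'.poly = b.poly then b'.poly.natDegree * min b.mult m else 0 := by
  obtain ⟨x, hx1, hx2⟩ := blockEnd_cyclic b
  have hkill : ∀ c, aeval (blockEnd b) (b.poly ^ b.mult) c = 0 := by
    intro c
    obtain ⟨p, rfl⟩ := hx1 c
    rw [← Module.End.mul_apply, ← map_mul, hx2]
    exact Dvd.intro _ rfl
  split_ifs with h
  · rw [h]
    rcases Nat.lt_or_ge m b.mult with hm | hm
    · have hk : LinearMap.ker (aeval (blockEnd b) (b.poly ^ m)) =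
          cyc (blockEnd b) (aeval (blockEnd b) (b.poly ^ (b.mult - m)) x) := by
        ext c
        rw [LinearMap.mem_ker, mem_cyc]
        have e : b.poly ^ b.mult = b.poly ^ m * b.poly ^ (b.mult - m) := by
          rw [← pow_add]; congr 1; omega
        constructor
        · intro hc
          obtain ⟨p, rfl⟩ := hx1 c
          rw [← Module.End.mul_apply, ← map_mul, hx2, e] at hc
          obtain ⟨s, hs⟩ := (mul_dvd_mul_iff_left (pow_ne_zero m b.prime_poly.ne_zero)).mp hc
          refine ⟨s, ?_⟩
          rw [← Module.End.mul_apply, ← map_mul, hs, mul_comm]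
        · rintro ⟨p, rfl⟩
          rw [← Module.End.mul_apply, ← Module.End.mul_apply, ← map_mul, ← map_mul, hx2, e]
          exact ⟨p, by ring⟩
      rw [hk, finrank_cyc (b.monic_poly.pow m), natDegree_pow, min_eq_right hm.le, mul_comm]
      intro p
      rw [← Module.End.mul_apply, ← map_mul, hx2]
      have e : b.poly ^ b.mult = b.poly ^ m * b.poly ^ (b.mult - m) := by
        rw [← pow_add]; congr 1; omega
      rw [e, mul_dvd_mul_iff_right (pow_ne_zero _ b.prime_poly.ne_zero)]
    · have hk : LinearMap.ker (aeval (blockEnd b) (b.poly ^ m)) = ⊤ := by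
        rw [eq_top_iff]
        intro c _
        rw [LinearMap.mem_ker]
        exact aeval_apply_eq_zero_of_dvd (pow_dvd_pow _ hm) (hkill c)
      rw [hk, finrank_top, min_eq_left hm, Module.finrank_fintype_fun_eq_card, Fintype.card_fin,
        b.size_eq, mul_comm]
  · have hk : LinearMap.ker (aeval (blockEnd b) (b'.poly ^ m)) = ⊥ := by
      rw [eq_bot_iff]
      intro c hc
      rw [LinearMap.mem_ker] at hc
      have hco : IsCoprime b'.poly b.poly := by
        rw [b'.prime_poly.irreducible.coprime_iff_not_dvd]
        intro hd
        exact h (eq_of_monic_of_associated b'.monic_poly b.monic_poly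
          (b'.prime_poly.irreducible.associated_of_dvd b.prime_poly.irreducible hd))
      obtain ⟨u, v, huv⟩ := hco.pow (m := m) (n := b.mult)
      have := congrArg (fun p => aeval (blockEnd b) p c) huv
      simp only [map_add, LinearMap.add_apply, map_one, Module.End.one_apply] at this
      rw [map_mul, Module.End.mul_apply, hc, map_mul, Module.End.mul_apply, hkill, map_zero,
        map_zero, add_zero] at this
      exact this.symm
    rw [hk, finrank_bot]

variable {V : Type*} [AddCommGroup V] [Module ℝ V] {A : Module.End ℝ V}

lemma finrank_ker_aeval_eq_sum {κ : Type} [Fintype κ] {B : κ → RealJordanBlock}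
    (v : Module.Basis (Σ k, Fin (B k).size) ℝ V)
    (h : ∀ k j, A (v ⟨k, j⟩) = ∑ i, (B k).matrix i j • v ⟨k, i⟩) (p : ℝ[X]) :
    Module.finrank ℝ (LinearMap.ker (aeval A p)) =
      ∑ k, Module.finrank ℝ (LinearMap.ker (aeval (blockEnd (B k)) p)) := by
  let Ψ : (∀ k, Fin (B k).size → ℝ) ≃ₗ[ℝ] V :=
    (LinearEquiv.piCurry ℝ (fun (k : κ) (_ : Fin (B k).size) => ℝ)).symm.trans v.equivFun.symm
  have hΨ : ∀ c, Ψ c = ∑ k, ∑ i, c k i • v ⟨k, i⟩ := by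
    intro c
    simp only [Ψ, LinearEquiv.trans_apply, Module.Basis.equivFun_symm_apply]
    rw [Fintype.sum_sigma]
    rfl
  have hA : ∀ c : (∀ k, Fin (B k).size → ℝ), Ψ (fun k => blockEnd (B k) (c k)) = A (Ψ c) := by
    intro c
    rw [hΨ, hΨ, map_sum]
    refine Finset.sum_congr rfl fun k _ => ?_
    rw [map_sum]
    simp_rw [map_smul, h, Finset.smul_sum]
    rw [Finset.sum_comm]
    refine Finset.sum_congr rfl fun i _ => ?_
    simp_rw [blockEnd, Matrix.toLin'_apply, Matrix.mulVec, dotProduct, Finset.sum_smul, smul_smul,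
      mul_comm]
  have hp : ∀ (p : ℝ[X]) (c : (∀ k, Fin (B k).size → ℝ)),
      Ψ (fun k => aeval (blockEnd (B k)) p (c k)) = aeval A p (Ψ c) := by
    intro p
    induction p using Polynomial.induction_on with
    | C a =>
      intro c
      simp only [aeval_C, Module.algebraMap_end_apply]
      rw [← map_smul]; rfl
    | add p q hp hq =>
      intro c
      simp only [map_add, LinearMap.add_apply, ← hp, ← hq]
      rw [← map_add]; rfl
    | monomial n a ih =>
      intro c
      rw [pow_succ, ← mul_assoc, map_mul (aeval A) (C a * X ^ n) X, aeval_X,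
        Module.End.mul_apply, ← hA, ← ih]
      congr 1
      ext1 k
      rw [map_mul (aeval _) (C a * X ^ n) X, aeval_X, Module.End.mul_apply]
  let e : (∀ k, LinearMap.ker (aeval (blockEnd (B k)) p)) →ₗ[ℝ] LinearMap.ker (aeval A p) :=
    { toFun := fun c => ⟨Ψ (fun k => c k), by
        rw [LinearMap.mem_ker, ← hp, show (fun k => aeval (blockEnd (B k)) p (c k)) = 0 from
          funext fun k => (c k).2, map_zero]⟩
      map_add' := fun c c' => Subtype.ext (by
        change Ψ _ = Ψ _ + Ψ _
        rw [← map_add]; rfl)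
      map_smul' := fun r c => Subtype.ext (by
        change Ψ _ = r • Ψ _
        rw [← map_smul]; rfl) }
  have he : Function.Bijective e := by
    constructor
    · intro c c' hcc
      have := Ψ.injective (congrArg Subtype.val hcc)
      funext k
      exact Subtype.ext (congrFun this k)
    · rintro ⟨y, hy⟩
      obtain ⟨c, rfl⟩ := Ψ.surjective y
      rw [LinearMap.mem_ker, ← hp, map_eq_zero_iff Ψ Ψ.injective] at hy
      exact ⟨fun k => ⟨c k, congrFun hy k⟩, rfl⟩
  rw [← (LinearEquiv.ofBijective e he).finrank_eq, Module.finrank_pi_fintype]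

/-- The number of Jordan blocks of each type is determined by the endomorphism. -/
lemma card_blocks_eq {κ κ' : Type} [Fintype κ] [Fintype κ'] {B : κ → RealJordanBlock}
    {B' : κ' → RealJordanBlock} (v : Module.Basis (Σ k, Fin (B k).size) ℝ V)
    (h : ∀ k j, A (v ⟨k, j⟩) = ∑ i, (B k).matrix i j • v ⟨k, i⟩)
    (v' : Module.Basis (Σ k, Fin (B' k).size) ℝ V)
    (h' : ∀ k j, A (v' ⟨k, j⟩) = ∑ i, (B' k).matrix i j • v' ⟨k, i⟩)
    (b : RealJordanBlock) (hb : 0 < b.size) :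
    Nat.card {k // B k = b} = Nat.card {k // B' k = b} := by
  classical
  -- The second difference in `m` of `min n m` is nonzero only at `m = n`, so kernel dimensions of
  -- consecutive powers count the blocks of exactly this size.
  have key : ∀ {κ : Type} [Fintype κ] {B : κ → RealJordanBlock}
      (v : Module.Basis (Σ k, Fin (B k).size) ℝ V)
      (_ : ∀ k j, A (v ⟨k, j⟩) = ∑ i, (B k).matrix i j • v ⟨k, i⟩),
      (b.poly.natDegree : ℤ) * Nat.card {k // B k = b} =
        2 * Module.finrank ℝ (LinearMap.ker (aeval A (b.poly ^ b.mult)))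
        - Module.finrank ℝ (LinearMap.ker (aeval A (b.poly ^ (b.mult - 1))))
        - Module.finrank ℝ (LinearMap.ker (aeval A (b.poly ^ (b.mult + 1)))) := by
    intro κ _ B v h
    have hm : 0 < b.mult := by
      rw [b.size_eq] at hb
      exact Nat.pos_of_mul_pos_right hb
    simp_rw [finrank_ker_aeval_eq_sum v h, finrank_ker_blockEnd]
    push_cast
    rw [Finset.mul_sum, ← Finset.sum_sub_distrib, ← Finset.sum_sub_distrib,
      Nat.card_eq_fintype_card, Fintype.card_subtype, Finset.card_filter]
    push_cast
    rw [Finset.mul_sum]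
    refine Finset.sum_congr rfl fun k _ => ?_
    by_cases hk : B k = b
    · rw [hk]
      simp only [if_true]
      rw [min_self, min_eq_right (by exact_mod_cast Nat.sub_le _ _), min_eq_left (by linarith)]
      push_cast [Nat.cast_sub hm]
      ring
    · rw [if_neg hk]
      by_cases hpk : b.poly = (B k).poly
      · simp only [if_pos hpk]
        have hne : (B k).mult ≠ b.mult := fun h' => hk (RealJordanBlock.eq_of_poly_eq hpk.symm h')
        rcases lt_or_gt_of_ne hne with hlt | hlt
        · rw [min_eq_left (by exact_mod_cast hlt.le), min_eq_left (by
            have : (B k).mult ≤ b.mult - 1 := by omega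
            exact_mod_cast this), min_eq_left (by exact_mod_cast (hlt.le.trans (Nat.le_succ _)))]
          ring
        · rw [min_eq_right (by exact_mod_cast hlt.le), min_eq_right (by
            have : b.mult - 1 ≤ (B k).mult := by omega
            exact_mod_cast this), min_eq_right (by exact_mod_cast hlt)]
          push_cast [Nat.cast_sub hm]
          ring
      · simp [if_neg hpk]
  have e := (key v h).trans (key v' h').symm
  have hd : (b.poly.natDegree : ℤ) ≠ 0 := by
    exact_mod_cast b.prime_poly.irreducible.natDegree_pos.ne'
  exact_mod_cast mul_left_cancel₀ hd e

/-- Two Jordan bases of the same endomorphism differ by a permutation and a commuting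
automorphism. -/
theorem IsBlockFamily.exists_equiv {ι ι' : Type} (v : Module.Basis ι ℝ V)
    (v' : Module.Basis ι' ℝ V) (hv : IsBlockFamily A v) (hv' : IsBlockFamily A v') :
    ∃ τ : ι ≃ ι', ∀ F : V →ₗ[ℝ] V, (∀ i, F (v i) = v' (τ i)) →
      ∀ y, F (A y) = A (F y) := by
  classical
  obtain ⟨K, hK, B, ε, h⟩ := hv
  obtain ⟨K', hK', B', ε', h'⟩ := hv'
  have hcard := card_blocks_eq (v.reindex ε.symm) (by simpa using h) (v'.reindex ε'.symm)
    (by simpa using h')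
  let S : ∀ {κ : Type} (B : κ → RealJordanBlock),
      (Σ k, Fin (B k).size) ≃ Σ b, {k // B k = b} × Fin b.size := fun {κ} B =>
    { toFun := fun x => ⟨B x.1, ⟨x.1, rfl⟩, x.2⟩
      invFun := fun x => ⟨x.2.1.1, Fin.cast (by rw [x.2.1.2]) x.2.2⟩
      left_inv := fun x => rfl
      right_inv := by rintro ⟨b, ⟨k, rfl⟩, j⟩; rfl }
  let f : ∀ b : RealJordanBlock, 0 < b.size → ({k // B k = b} ≃ {k // B' k = b}) :=
    fun b hb => Fintype.equivOfCardEq (by simpa only [Nat.card_eq_fintype_card] using hcard b hb)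
  -- Blocks of size zero are invisible to `A` and may differ in number, but they contribute no basis
  -- vectors.
  let T : ∀ b : RealJordanBlock, ({k // B k = b} × Fin b.size) ≃ ({k // B' k = b} × Fin b.size) :=
    fun b => if hb : 0 < b.size then (f b hb).prodCongr (Equiv.refl _) else
      (have : IsEmpty (Fin b.size) := ⟨fun i => hb i.pos⟩
       Equiv.equivOfIsEmpty _ _)
  have hT : ∀ b (k : {k // B k = b}) , 0 < b.size → ∃ k' : {k // B' k = b},
      ∀ j, T b (k, j) = (k', j) := by
    intro b k hb
    refine ⟨f b hb k, fun j => ?_⟩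
    simp only [T]
    rw [dif_pos hb]
    rfl
  let τ : ι ≃ ι' := ((ε.symm.trans (S B)).trans (Equiv.sigmaCongrRight T)).trans
    ((S B').symm.trans ε')
  refine ⟨τ, fun F hF => ?_⟩
  have hτ : ∀ k j, τ (ε ⟨k, j⟩) = ε' ((S B').symm ⟨B k, T (B k) (⟨k, rfl⟩, j)⟩) := by
    intro k j
    simp [τ, S]
  have key : ∀ i, F (A (v i)) = A (F (v i)) := by
    intro i
    obtain ⟨⟨k, j⟩, rfl⟩ := ε.surjective i
    obtain ⟨⟨k', hk'⟩, hkT⟩ := hT (B k) ⟨k, rfl⟩ j.pos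
    have hgen : ∀ (b : RealJordanBlock) (hk : B' k' = b) (j : Fin b.size),
        A (v' (ε' ((S B').symm ⟨b, ⟨k', hk⟩, j⟩))) =
          ∑ i, b.matrix i j • v' (ε' ((S B').symm ⟨b, ⟨k', hk⟩, i⟩)) := by
      rintro _ rfl j
      exact h' k' j
    rw [h, map_sum]
    simp_rw [map_smul, hF, hτ, hkT]
    exact (hgen _ _ _).symm
  have : F ∘ₗ A = A ∘ₗ F := v.ext fun i => key i
  exact fun y => LinearMap.congr_fun this y

end Uniqueness

/-! ### Semidirect presentations and adapted monomial bases. -/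

section Frame

open Module

/-- Pairing the combination with the partner of `v i` isolates the coefficient `a i`. -/
lemma IsMonomial.linearIndependent {V : Type*} [AddCommGroup V] [Module ℝ V]
    {β : LinearMap.BilinForm ℝ V} {ι : Type*} [Fintype ι] (hs : ∀ y z, β y z = -β z y)
    {v : ι → V} (hv : IsMonomial fun i k => β (v i) (v k)) (a : ι → ℝ)
    (ha : ∀ k, β (v k) (∑ i, a i • v i) = 0) : a = 0 := by
  classical
  obtain ⟨ρ, s, hs1, h⟩ := hv
  beta_reduce at h
  have hs0 : ∀ i, s i ≠ 0 := fun i => by rcases hs1 i with h | h <;> rw [h] <;> norm_num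
  have hρ : ∀ i, ρ (ρ i) = i := by
    intro i
    by_contra hi
    have h1 := (h i (ρ i)).1 rfl
    rw [hs, (h (ρ i) i).2 (Ne.symm hi), neg_zero] at h1
    exact hs0 i h1.symm
  funext i
  have := ha (ρ i)
  rw [map_sum, Finset.sum_eq_single i, map_smul, (h (ρ i) i).1 (hρ i).symm, smul_eq_mul] at this
  · exact (mul_eq_zero.mp this).resolve_right (hs0 _)
  · intro j _ hj
    rw [map_smul, (h (ρ i) j).2 (by rwa [hρ]), smul_zero]
  · simp

/-- A presentation of a Lie algebra as `ℝ e ⋉ ker lam` with abelian ideal `ker lam`. -/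
structure Frame (g : Type*) [LieRing g] [LieAlgebra ℝ g] where
  /-- The linear form whose kernel is the abelian ideal. -/
  lam : Dual ℝ g
  /-- The vector complementing the ideal. -/
  vec : g
  lam_vec : lam vec = 1
  abelian : ∀ x y, lam x = 0 → lam y = 0 → ⁅x, y⁆ = 0
  ideal : ∀ y, lam y = 0 → lam ⁅vec, y⁆ = 0

variable {g : Type*} [LieRing g] [LieAlgebra ℝ g]

/-- The action of the distinguished vector on the abelian ideal. -/
def Frame.adVec (F : Frame g) : Module.End ℝ (LinearMap.ker F.lam) :=
  (LieAlgebra.ad ℝ g F.vec).restrict fun y hy => F.ideal y hy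

lemma Frame.coe_adVec (F : Frame g) (y : LinearMap.ker F.lam) :
    (F.adVec y : g) = ⁅F.vec, (y : g)⁆ := rfl

lemma Frame.sub_mem (F : Frame g) (x : g) : F.lam (x - F.lam x • F.vec) = 0 := by
  rw [map_sub, map_smul, F.lam_vec, smul_eq_mul, mul_one, sub_self]

/-- A linear map compatible with a frame is a homomorphism of Lie algebras. -/
lemma Frame.map_lie (F : Frame g) (φ : g →ₗ[ℝ] g) {a : g} (ha : F.lam a = 0)
    (hvec : φ F.vec = F.vec - a) (hφ : ∀ y, F.lam y = 0 → F.lam (φ y) = 0)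
    (hcomm : ∀ y, F.lam y = 0 → φ ⁅F.vec, y⁆ = ⁅F.vec, φ y⁆) (x y : g) :
    φ ⁅x, y⁆ = ⁅φ x, φ y⁆ := by
  have key : ∀ (s t : ℝ) (y z : g), F.lam y = 0 → F.lam z = 0 →
      φ ⁅s • F.vec + y, t • F.vec + z⁆ = ⁅φ (s • F.vec + y), φ (t • F.vec + z)⁆ := by
    intro s t y z hy hz
    have e1 : ⁅s • F.vec + y, t • F.vec + z⁆ = s • ⁅F.vec, z⁆ - t • ⁅F.vec, y⁆ := by
      rw [lie_add, add_lie, add_lie, smul_lie, lie_smul, lie_self, smul_lie, lie_smul,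
        F.abelian y z hy hz, ← lie_skew F.vec y]
      simp only [smul_zero, smul_neg]
      abel
    have e2 : ⁅s • (F.vec - a) + φ y, t • (F.vec - a) + φ z⁆ =
        s • ⁅F.vec, φ z⁆ - t • ⁅F.vec, φ y⁆ := by
      rw [lie_add, add_lie, add_lie, smul_lie, lie_smul, lie_self, smul_lie, lie_smul,
        F.abelian _ _ (hφ y hy) (hφ z hz), sub_lie, F.abelian _ _ ha (hφ z hz), sub_zero,
        lie_sub, F.abelian _ _ (hφ y hy) ha, sub_zero, ← lie_skew F.vec (φ y)]
      simp only [smul_zero, smul_neg]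
      abel
    rw [e1, map_add φ (s • F.vec), map_add φ (t • F.vec), map_smul φ s F.vec,
      map_smul φ t F.vec, hvec, e2, map_sub, map_smul, map_smul, hcomm y hy, hcomm z hz]
  have := key (F.lam x) (F.lam y) _ _ (F.sub_mem x) (F.sub_mem y)
  simpa only [add_sub_cancel] using this

/-- A symplectic form on an almost abelian Lie algebra is monomial in a suitable adapted Jordan
basis. -/
theorem Frame.exists_monomial_basis [FiniteDimensional ℝ g] (F : Frame g)
    {ω : LinearMap.BilinForm ℝ g} (hω : ω ∈ symplecticForms g) :
    ∃ (κ : Type) (_ : Fintype κ) (v : Basis (Option κ) ℝ (LinearMap.ker F.lam)) (a : g) (c : ℝ),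
      F.lam a = 0 ∧ c ≠ 0 ∧ IsBlockFamily F.adVec v ∧ ω (c⁻¹ • (F.vec - a)) (v none) = 1 ∧
      IsMonomial fun i k : Option (Option κ) =>
        ω (i.elim (c⁻¹ • (F.vec - a)) fun o => (v o : g))
          (k.elim (c⁻¹ • (F.vec - a)) fun o => (v o : g)) := by
  classical
  obtain ⟨halt, hnd, hcl⟩ := hω
  have hs : ∀ y z, ω y z = -ω z y := fun y z => (halt.neg_eq z y).symm
  have hsep : ∀ y, (∀ z, ω y z = 0) → y = 0 := hnd.1
  let β : LinearMap.BilinForm ℝ (LinearMap.ker F.lam) := ω.restrict _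
  have hβ : ∀ y z, β y z = ω y z := fun _ _ => rfl
  have hrep : ∀ f : Dual ℝ g, ∃ u, ∀ y, ω u y = f y := fun f =>
    ⟨(ω.toDual hnd).symm f, fun y => LinearMap.BilinForm.apply_toDual_symm_apply f y⟩
  -- The vector dual to `lam` lies in the ideal because the form is alternating, and it spans the
  -- radical of the restricted form.
  obtain ⟨x₀, hx₀⟩ := hrep F.lam
  have hlx₀ : F.lam x₀ = 0 := by rw [← hx₀, halt]
  let v₀ : LinearMap.ker F.lam := ⟨x₀, hlx₀⟩
  obtain ⟨κ, hκ, v₁, w, hv₁, hblock, hspan, hmon⟩ :=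
    exists_option_family (A := F.adVec) (β := β) (v₀ := v₀) (fun y z => hs y z)
    -- Closedness on `F.vec, y, z`, with the bracket of `y` and `z` zero, is skewness of `F.adVec`.
    (fun y z => by
      have h := hcl F.vec y z
      rw [F.abelian y z y.2 z.2, map_zero, zero_add] at h
      rw [← lie_skew (z : g), map_neg, ← sub_eq_add_neg] at h
      rw [hβ, hβ, F.coe_adVec, F.coe_adVec, hs, sub_eq_zero.mp h])
    (fun h => by
      have : F.lam F.vec = 0 := by
        rw [← hx₀, show x₀ = 0 from congrArg Subtype.val h, map_zero, LinearMap.zero_apply]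
      rw [F.lam_vec] at this
      exact one_ne_zero this)
    (fun y => (hx₀ y).trans y.2)
    (fun y hy => by
      refine ⟨ω y F.vec, Subtype.ext (sub_eq_zero.mp (hsep _ fun z => ?_))⟩
      have hz : ω (y : g) z = ω y (z - F.lam z • F.vec) + F.lam z * ω y F.vec := by
        rw [map_sub, map_smul, smul_eq_mul, sub_add_cancel]
      have h0 : ω (y : g) (z - F.lam z • F.vec) = 0 := hy ⟨_, F.sub_mem z⟩
      change ω ((y : g) - ω y F.vec • x₀) z = 0
      rw [map_sub, LinearMap.sub_apply, hz, h0, map_smul, LinearMap.smul_apply, hx₀, smul_eq_mul]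
      ring)
    -- A functional on the ideal is represented by some vector of `g`; vanishing at `v₀` puts that
    -- vector back in the ideal.
    (fun f hf => by
      obtain ⟨f', hf'⟩ := f.exists_extend
      obtain ⟨u, hu⟩ := hrep f'
      refine ⟨⟨-u, ?_⟩, fun y => ?_⟩
      · have : f' x₀ = 0 := (LinearMap.congr_fun hf' v₀).trans hf
        rw [LinearMap.mem_ker, map_neg, ← hx₀, hs, hu, this, neg_zero, neg_zero]
      · rw [hβ, hs]
        change -ω (-u) y = f y
        rw [map_neg, LinearMap.neg_apply, neg_neg, hu]
        exact LinearMap.congr_fun hf' y)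
  -- Pairing with the monomial part shows that `v₀` is a multiple of `v₁`, while `ω F.vec x₀ = -1`.
  have hc : ω F.vec v₁ ≠ 0 := by
    intro hc
    have hv₀ : v₀ ∈ Submodule.span ℝ (Set.range fun o : Option κ => o.elim v₁ w) :=
      hspan ▸ Submodule.mem_top
    obtain ⟨b, hb⟩ := (Submodule.mem_span_range_iff_exists_fun ℝ).mp hv₀
    rw [Fintype.sum_option] at hb
    have hb0 : (fun i => b (some i)) = 0 := by
      refine IsMonomial.linearIndependent (β := β) (fun y z => hs y z) hmon _ fun k => ?_
      have e : ∑ i, b (some i) • w i = v₀ - b none • v₁ := by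
        rw [← hb]; simp
      rw [e, map_sub, map_smul, hβ, hs, hβ (w k) v₁, hs (w k) v₁]
      rw [← hβ v₁, hv₁, hx₀, (w k).2]
      simp
    have hv : b none • v₁ = v₀ := by
      rw [← hb]
      simp [fun i => congrFun hb0 i]
    have : ω F.vec x₀ = 0 := by
      rw [show x₀ = b none • (v₁ : g) from (congrArg Subtype.val hv).symm, map_smul, hc, smul_zero]
    rw [hs, hx₀, F.lam_vec] at this
    norm_num at this
  set c : ℝ := ω F.vec v₁ with hcdef
  obtain ⟨a, hamem, ha⟩ := IsMonomial.exists_orthogonal_sub (β := ω) hs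
    (v := fun i => (w i : g)) hmon F.vec
  have hla : F.lam a = 0 := by
    have : Submodule.span ℝ (Set.range fun i => (w i : g)) ≤ LinearMap.ker F.lam := by
      rw [Submodule.span_le]
      rintro _ ⟨i, rfl⟩
      exact (w i).2
    exact this hamem
  have hcv : ω (c⁻¹ • (F.vec - a)) v₁ = 1 := by
    have : ω a v₁ = 0 := by
      rw [hs, show ω (v₁ : g) a = 0 from hv₁ ⟨a, hla⟩, neg_zero]
    rw [map_smul, map_sub, LinearMap.smul_apply, LinearMap.sub_apply, this, sub_zero, ← hcdef,
      smul_eq_mul, inv_mul_cancel₀ hc]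
  have hcw : ∀ i, ω (c⁻¹ • (F.vec - a)) (w i) = 0 := fun i => by
    rw [map_smul, LinearMap.smul_apply, ha, smul_zero]
  have hM : IsMonomial fun i k : Option (Option κ) =>
        ω (i.elim (c⁻¹ • (F.vec - a)) fun o => ((o.elim v₁ w : LinearMap.ker F.lam) : g))
          (k.elim (c⁻¹ • (F.vec - a)) fun o => ((o.elim v₁ w : LinearMap.ker F.lam) : g)) := by
    obtain ⟨ρ, s, hs1, h⟩ := hmon
    -- The new first vector and the radical vector are each other's partners, forming a hyperbolic
    -- plane; the remaining indices keep theirs.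
    refine ⟨fun o => o.elim (some none) fun o => o.elim none fun i => some (some (ρ i)),
      fun o => o.elim 1 fun o => o.elim (-1) s, ?_, ?_⟩
    · rintro (_ | _ | i)
      · exact Or.inl rfl
      · exact Or.inr rfl
      · exact hs1 i
    · rintro (_ | _ | i) (_ | _ | k)
      · exact ⟨fun h => by simp at h, fun _ => halt _⟩
      · exact ⟨fun _ => hcv, fun h => absurd rfl h⟩
      · exact ⟨fun h => by simp at h, fun _ => hcw k⟩
      · exact ⟨fun _ => (hs _ _).trans (congrArg Neg.neg hcv), fun h => absurd rfl h⟩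
      · exact ⟨fun h => by simp at h, fun _ => halt _⟩
      · exact ⟨fun h => by simp at h, fun _ => hv₁ _⟩
      · exact ⟨fun h => by simp at h, fun _ => (hs _ _).trans
          ((congrArg Neg.neg (hcw i)).trans neg_zero)⟩
      · exact ⟨fun h => by simp at h, fun _ => (hs _ _).trans
          ((congrArg Neg.neg (hv₁ (w i))).trans neg_zero)⟩
      · exact ⟨fun hk => (h i k).1 (by simpa using hk), fun hk => (h i k).2 (by simpa using hk)⟩
  have hli : LinearIndependent ℝ fun o : Option κ => o.elim v₁ w := by
    rw [Fintype.linearIndependent_iff]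
    intro b hb
    have := IsMonomial.linearIndependent hs hM (fun o => o.elim 0 b) fun k => by
      rw [Fintype.sum_option]
      have e : ∑ i, b i • ((i.elim v₁ w : LinearMap.ker F.lam) : g) = 0 := by
        have := congrArg (Submodule.subtype _) hb
        rw [map_sum, map_zero] at this
        exact this
      simp only [Option.elim_none, zero_smul, zero_add, Option.elim_some]
      rw [e, map_zero]
    exact fun i => congrFun this (some i)
  refine ⟨κ, hκ, Basis.mk hli hspan.ge, a, c, hla, hc, ?_, ?_, ?_⟩
  · rwa [Basis.coe_mk]
  · rwa [Basis.mk_apply]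
  · simpa only [Basis.mk_apply] using hM

end Frame

/-! ### Abelian ideals of codimension one, and Jordan bases of the Lie algebra. -/

section Existence

open Module

variable {g : Type*} [LieRing g] [LieAlgebra ℝ g]

/-- An almost abelian Lie algebra contains an abelian ideal of codimension one. -/
theorem IsAlmostAbelian.nonempty_frame (hg : IsAlmostAbelian g) : Nonempty (Frame g) := by
  obtain ⟨-, L, hL, hfin⟩ := hg
  have : FiniteDimensional ℝ (g ⧸ L.toSubmodule) := FiniteDimensional.of_finrank_eq_succ hfin
  have hiso := LinearEquiv.ofFinrankEq (g ⧸ L.toSubmodule) ℝ (hfin.trans (finrank_self ℝ).symm)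
  obtain ⟨lam, hlam, e, he⟩ : ∃ lam : Dual ℝ g, (∀ x, lam x = 0 ↔ x ∈ L) ∧ ∃ e, lam e = 1 := by
    refine ⟨hiso.toLinearMap ∘ₗ L.toSubmodule.mkQ, fun x => ?_, ?_⟩
    · rw [LinearMap.comp_apply, LinearEquiv.coe_coe, map_eq_zero_iff _ hiso.injective,
        Submodule.mkQ_apply, Submodule.Quotient.mk_eq_zero]
      rfl
    · obtain ⟨x, hx⟩ := (hiso.surjective.comp L.toSubmodule.mkQ_surjective) 1
      exact ⟨x, hx⟩
  have hab : ∀ x y, lam x = 0 → lam y = 0 → ⁅x, y⁆ = 0 := fun x y hx hy =>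
    congrArg Subtype.val (hL.trivial ⟨x, (hlam x).mp hx⟩ ⟨y, (hlam y).mp hy⟩)
  by_cases hid : ∀ y, lam y = 0 → lam ⁅e, y⁆ = 0
  · exact ⟨⟨lam, e, he, hab, hid⟩⟩
  push Not at hid
  obtain ⟨y₁, hy₁, hf⟩ := hid
  obtain ⟨y₀, hy₀, hfy₀⟩ : ∃ y₀, lam y₀ = 0 ∧ lam ⁅e, y₀⁆ = 1 :=
    ⟨(lam ⁅e, y₁⁆)⁻¹ • y₁, by rw [map_smul, hy₁, smul_zero], by
      rw [lie_smul, map_smul, smul_eq_mul, inv_mul_cancel₀ hf]⟩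
  have hlie : ∀ x y, lam y = 0 → ⁅x, y⁆ = lam x • ⁅e, y⁆ := by
    intro x y hy
    have h : ⁅x - lam x • e, y⁆ = 0 := hab _ _ (by simp [he]) hy
    rwa [sub_lie, smul_lie, sub_eq_zero] at h
  -- When the abelian subalgebra is not an ideal, this `w` lies outside it. The Jacobi identity then
  -- makes every `⁅w, x⁆` a multiple of `w`.
  set w := ⁅e, y₀⁆ with hw
  have hwy : ∀ y, lam y = 0 → ⁅w, y⁆ = lam ⁅w, y⁆ • w := by
    intro y hy
    have hJ := leibniz_lie e y₀ y
    rw [hab y₀ y hy₀ hy, lie_zero, ← hw, ← lie_skew y₀, hlie ⁅e, y⁆ y₀ hy₀, ← hw] at hJ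
    have hewy : ⁅e, y⁆ = ⁅w, y⁆ := by rw [hlie w y hy, hfy₀, one_smul]
    rwa [hewy, eq_comm, ← sub_eq_add_neg, sub_eq_zero] at hJ
  have hwall : ∀ x, ⁅w, x⁆ = lam ⁅w, x⁆ • w := by
    intro x
    have hx : x = lam x • w + (x - lam x • w) := by abel
    rw [hx, lie_add, lie_smul, lie_self, smul_zero, zero_add]
    exact hwy _ (by rw [map_sub, map_smul, hfy₀, smul_eq_mul, mul_one, sub_self])
  have hwy₀ : ⁅w, y₀⁆ = w := by rw [hlie w y₀ hy₀, hfy₀, one_smul]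
  -- The kernel of this form is the centraliser of `w`. It is abelian, since modulo multiples of `w`
  -- its elements lie in the abelian subalgebra.
  refine ⟨⟨lam ∘ₗ (LieAlgebra.ad ℝ g w : g →ₗ[ℝ] g), y₀, ?_, fun x y hx hy => ?_, fun y hy => ?_⟩⟩
  · rw [LinearMap.comp_apply, LieAlgebra.ad_apply, hwy₀, hfy₀]
  · rw [LinearMap.comp_apply, LieAlgebra.ad_apply] at hx hy
    have hwx : ⁅w, x⁆ = 0 := by rw [hwall, hx, zero_smul]
    have hwy : ⁅w, y⁆ = 0 := by rw [hwall, hy, zero_smul]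
    have h : ⁅x - lam x • w, y - lam y • w⁆ = 0 := hab _ _ (by simp [hfy₀]) (by simp [hfy₀])
    rw [lie_sub, sub_lie, sub_lie, smul_lie, smul_lie, lie_smul, lie_smul, hwy, lie_self,
      ← lie_skew x w, hwx] at h
    simpa using h
  · rw [LinearMap.comp_apply, LieAlgebra.ad_apply] at hy ⊢
    have hwy : ⁅w, y⁆ = 0 := by rw [hwall, hy, zero_smul]
    rw [leibniz_lie, hwy₀, hwy, lie_zero, add_zero, map_zero]

/-- The indices of a direct sum of blocks. -/
def jordanIndex {p : ℕ} (B : Fin p → RealJordanBlock) :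
    (Σ k, Fin (B k).size) ≃ Fin (jordanSize B) := finSigmaFinEquiv

lemma sum_jordanMatrix_smul {V : Type*} [AddCommGroup V] [Module ℝ V] {p : ℕ}
    (B : Fin p → RealJordanBlock) (v : Fin (jordanSize B) → V) (k : Fin p)
    (j : Fin (B k).size) :
    ∑ i, jordanMatrix B i (jordanIndex B ⟨k, j⟩) • v i =
      ∑ i, (B k).matrix i j • v (jordanIndex B ⟨k, i⟩) := by
  have hM : ∀ x y, jordanMatrix B (jordanIndex B x) (jordanIndex B y) =
      Matrix.blockDiagonal' (fun k => (B k).matrix) x y := fun x y => by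
    change Matrix.blockDiagonal' (fun k => (B k).matrix) ((jordanIndex B).symm (jordanIndex B x))
      ((jordanIndex B).symm (jordanIndex B y)) = _
    rw [Equiv.symm_apply_apply, Equiv.symm_apply_apply]
  rw [← (jordanIndex B).sum_comp, Fintype.sum_sigma, Finset.sum_eq_single k]
  · refine Finset.sum_congr rfl fun i _ => ?_
    rw [hM, Matrix.blockDiagonal'_apply_eq]
  · intro k' _ hk'
    refine Finset.sum_eq_zero fun i _ => ?_
    rw [hM, Matrix.blockDiagonal'_apply_ne _ _ _ hk', zero_smul]
  · simp

/-- A Jordan basis of the abelian ideal of a frame extends to a Jordan basis. -/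
theorem Frame.exists_isJordanBasis (F : Frame g) {ι : Type}
    (v : Basis ι ℝ (LinearMap.ker F.lam)) (hv : IsBlockFamily F.adVec v) :
    ∃ (p : ℕ) (B : Fin p → RealJordanBlock) (e : Basis (Fin (jordanSize B + 1)) ℝ g),
      IsJordanBasis B e := by
  obtain ⟨κ, _, B, ε, h⟩ := hv
  let q := (Fintype.equivFin κ).symm
  let B' : Fin (Fintype.card κ) → RealJordanBlock := fun k => B (q k)
  let τ : Fin (jordanSize B') ≃ ι :=
    ((jordanIndex B').symm.trans (Equiv.sigmaCongrLeft (β := fun k => Fin (B k).size) q)).trans ε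
  have hτ : ∀ k i, τ (jordanIndex B' ⟨k, i⟩) = ε ⟨q k, i⟩ := fun k i => by
    change ε (Equiv.sigmaCongrLeft q ((jordanIndex B').symm (jordanIndex B' ⟨k, i⟩))) = _
    rw [Equiv.symm_apply_apply]
    rfl
  let e : Basis (Fin (jordanSize B' + 1)) ℝ g := Basis.mkFinCons F.vec (v.reindex τ.symm)
    (fun c x hx h0 => by
      have := congrArg F.lam h0
      rwa [map_add, map_smul, F.lam_vec, LinearMap.mem_ker.mp hx, add_zero, smul_eq_mul, mul_one,
        map_zero] at this)
    (fun z => ⟨-F.lam z, by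
      rw [LinearMap.mem_ker, map_add, map_smul, F.lam_vec, smul_eq_mul, mul_one, add_neg_cancel]⟩)
  have he0 : e 0 = F.vec := by simp [e]
  have hes : ∀ i : Fin (jordanSize B'), e i.succ = v (τ i) := fun i => by simp [e]
  refine ⟨_, B', e, fun i j => ?_, fun j => ?_⟩
  · rw [hes, hes]
    exact F.abelian _ _ (v _).2 (v _).2
  · obtain ⟨⟨k, j⟩, rfl⟩ := (jordanIndex B').surjective j
    rw [sum_jordanMatrix_smul]
    rw [he0, hes, hτ]
    simp_rw [hes, hτ]
    rw [← F.coe_adVec, h, Submodule.coe_sum]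
    rfl

variable {p : ℕ} {B : Fin p → RealJordanBlock} {e : Basis (Fin (jordanSize B + 1)) ℝ g}

/-- The frame of a Jordan basis. -/
noncomputable def IsJordanBasis.frame (he : IsJordanBasis B e) : Frame g where
  lam := e.coord 0
  vec := e 0
  lam_vec := by simp
  abelian x y hx hy := by
    have h : ∀ x, e.coord 0 x = 0 → x = ∑ i : Fin (jordanSize B), e.repr x i.succ • e i.succ := by
      intro x hx
      conv_lhs => rw [← e.sum_repr x, Fin.sum_univ_succ]
      rw [show e.repr x 0 = 0 from hx, zero_smul, zero_add]
    rw [h x hx, h y hy]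
    simp [sum_lie, he.abelian, lie_sum]
  ideal := by
    intro y hy
    have : y = ∑ i : Fin (jordanSize B), e.repr y i.succ • e i.succ := by
      conv_lhs => rw [← e.sum_repr y, Fin.sum_univ_succ]
      rw [show e.repr y 0 = 0 from hy, zero_smul, zero_add]
    rw [this]
    simp [he.ad, lie_sum]

/-- The part of a Jordan basis which lies in the abelian ideal. -/
theorem IsJordanBasis.exists_basis (he : IsJordanBasis B e) :
    ∃ v : Basis (Fin (jordanSize B)) ℝ (LinearMap.ker he.frame.lam),
      (∀ i, (v i : g) = e i.succ) ∧ IsBlockFamily he.frame.adVec v := by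
  have hmem : ∀ i : Fin (jordanSize B), he.frame.lam (e i.succ) = 0 := fun i => by
    change e.coord 0 _ = 0
    simp
  let w : Fin (jordanSize B) → LinearMap.ker he.frame.lam := fun i => ⟨e i.succ, hmem i⟩
  have hli : LinearIndependent ℝ w := by
    refine LinearIndependent.of_comp (Submodule.subtype _) ?_
    exact e.linearIndependent.comp _ (Fin.succ_injective _)
  have hsp : ⊤ ≤ Submodule.span ℝ (Set.range w) := by
    rintro ⟨y, hy⟩ _
    refine (Submodule.mem_span_range_iff_exists_fun ℝ).mpr ⟨fun i => e.repr y i.succ, ?_⟩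
    refine Subtype.ext ?_
    rw [Submodule.coe_sum]
    have := e.sum_repr y
    rwa [Fin.sum_univ_succ, show e.repr y 0 = 0 from hy, zero_smul, zero_add] at this
  refine ⟨Basis.mk hli hsp, fun i => by rw [Basis.mk_apply], Fin p, inferInstance, B,
    jordanIndex B, fun k j => ?_⟩
  rw [Basis.coe_mk]
  refine Subtype.ext ?_
  rw [he.frame.coe_adVec, Submodule.coe_sum]
  exact (he.ad _).trans (sum_jordanMatrix_smul B (fun i => e i.succ) k j)

end Existence

/-! ### Monomial alternating forms as permutations of the canonical form. -/

section Combinatorics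

open Module

variable {g : Type*} [LieRing g] [LieAlgebra ℝ g]

lemma canonicalForm_apply {D r : ℕ} (h : D = 2 * r) (e : Basis (Fin D) ℝ g) (i k : Fin D) :
    canonicalForm h e (e i) (e k) =
      if (k : ℕ) = r + i then 1 else if (i : ℕ) = r + k then -1 else 0 := by
  have hterm : ∀ t : Fin r, wedge (e.coord ⟨t, by omega⟩) (e.coord ⟨r + t, by omega⟩) (e i) (e k) =
      (if (i : ℕ) = t ∧ (k : ℕ) = r + t then 1 else 0) -
        (if (k : ℕ) = t ∧ (i : ℕ) = r + t then 1 else 0) := by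
    intro t
    simp only [wedge, LinearMap.sub_apply, LinearMap.BilinForm.linMulLin_apply, Basis.coord_apply,
      Basis.repr_self, Finsupp.single_apply, Fin.ext_iff, ite_and, mul_ite, mul_one, mul_zero]
    split_ifs <;> rfl
  rw [canonicalForm, LinearMap.sum_apply, LinearMap.sum_apply]
  simp_rw [hterm]
  rw [Finset.sum_sub_distrib]
  have h1 : ∀ a b : Fin D, (∑ t : Fin r, if (a : ℕ) = t ∧ (b : ℕ) = r + t then (1 : ℝ) else 0) =
      if (b : ℕ) = r + a then 1 else 0 := by
    intro a b
    split_ifs with hab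
    · rw [Finset.sum_eq_single ⟨a, by omega⟩]
      · simp [hab]
      · intro t _ ht
        rw [if_neg]
        rintro ⟨h1, -⟩
        exact ht (Fin.ext h1.symm)
      · simp
    · refine Finset.sum_eq_zero fun t _ => if_neg ?_
      rintro ⟨h1, h2⟩
      exact hab (by omega)
  rw [h1, h1]
  split_ifs <;> first | omega | simp

lemma act_permEquiv_apply {D : ℕ} (e : Basis (Fin D) ℝ g) (σ : Equiv.Perm (Fin D))
    (ω : LinearMap.BilinForm ℝ g) (i k : Fin D) :
    act (permEquiv e σ) ω (e (σ i)) (e (σ k)) = ω (e i) (e k) := by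
  have h : ∀ i, (permEquiv e σ).symm (e (σ i)) = e i := fun i => by
    rw [LinearEquiv.symm_apply_eq, permEquiv, Basis.equiv_apply]
  rw [act, LinearMap.BilinForm.congr_apply, h, h]

/-- An alternating form which is monomial in a basis is, up to a permutation of the basis, the
canonical form. -/
theorem IsMonomial.exists_perm {d : ℕ} (e : Basis (Fin (d + 1)) ℝ g)
    {η : LinearMap.BilinForm ℝ g} (hs : ∀ y z, η y z = -η z y)
    (hη : IsMonomial fun i k => η (e i) (e k)) (h0 : ∃ j, η (e 0) (e j) = 1) :
    ∃ (r : ℕ) (hr : d + 1 = 2 * r) (σ : Equiv.Perm (Fin (d + 1))),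
      σ 0 = 0 ∧ η = act (permEquiv e σ) (canonicalForm hr e) := by
  classical
  obtain ⟨ρ, s, hs1, h⟩ := hη
  beta_reduce at h
  have hs0 : ∀ i, s i ≠ 0 := fun i => by rcases hs1 i with h | h <;> rw [h] <;> norm_num
  have hρ : ∀ i, ρ (ρ i) = i := by
    intro i
    by_contra hi
    have h1 := (h i (ρ i)).1 rfl
    rw [hs, (h (ρ i) i).2 (Ne.symm hi), neg_zero] at h1
    exact hs0 i h1.symm
  have hsρ : ∀ i, s (ρ i) = -s i := fun i => by
    rw [← (h i (ρ i)).1 rfl, ← (h (ρ i) i).1 (hρ i).symm, hs]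
  have hs00 : s 0 = 1 := by
    obtain ⟨j, hj⟩ := h0
    by_cases hjρ : j = ρ 0
    · rw [← (h 0 j).1 hjρ, hj]
    · rw [(h 0 j).2 hjρ] at hj
      exact absurd hj zero_ne_one
  -- The involution `ρ` exchanges the rows of sign `1` with those of sign `-1`, so `P` is a half
  -- system. Listing it first and its partners second gives the canonical form.
  let P : Finset (Fin (d + 1)) := Finset.univ.filter fun i => s i = 1
  have hP : ∀ i, i ∈ P ↔ s i = 1 := fun i => by simp [P]
  let r := P.card
  let u : Fin r ↪o Fin (d + 1) := P.orderEmbOfFin rfl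
  have hu : ∀ a, s (u a) = 1 := fun a => (hP _).mp (Finset.orderEmbOfFin_mem P rfl a)
  have husurj : ∀ i, s i = 1 → ∃ a, u a = i := fun i hi => by
    have : i ∈ Set.range u := by
      rw [Finset.range_orderEmbOfFin]
      exact (hP i).mpr hi
    exact this
  let f : Fin r ⊕ Fin r → Fin (d + 1) := Sum.elim u (fun a => ρ (u a))
  have hf : Function.Bijective f := by
    constructor
    · rintro (a | a) (b | b) hab
      · exact congrArg Sum.inl (u.injective hab)
      · have := congrArg s (show u a = ρ (u b) from hab)
        rw [hsρ, hu, hu] at this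
        norm_num at this
      · have := congrArg s (show ρ (u a) = u b from hab)
        rw [hsρ, hu, hu] at this
        norm_num at this
      · have := congrArg ρ (show ρ (u a) = ρ (u b) from hab)
        rw [hρ, hρ] at this
        exact congrArg Sum.inr (u.injective this)
    · intro i
      rcases hs1 i with hi | hi
      · obtain ⟨a, ha⟩ := husurj i hi
        exact ⟨Sum.inl a, ha⟩
      · obtain ⟨a, ha⟩ := husurj (ρ i) (by rw [hsρ, hi, neg_neg])
        refine ⟨Sum.inr a, ?_⟩
        change ρ (u a) = i
        rw [ha, hρ]
  have hcard : d + 1 = r + r := by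
    simpa using (Fintype.card_of_bijective hf).symm
  have hr : d + 1 = 2 * r := by omega
  let σ : Equiv.Perm (Fin (d + 1)) :=
    ((finCongr hcard).trans finSumFinEquiv.symm).trans (Equiv.ofBijective f hf)
  have hσl : ∀ (a : Fin r) (ha : (a : ℕ) < d + 1), σ ⟨a, ha⟩ = u a := by
    intro a ha
    have : (finCongr hcard) ⟨a, ha⟩ = finSumFinEquiv (Sum.inl a) := Fin.ext rfl
    simp only [σ, Equiv.trans_apply, this, Equiv.symm_apply_apply]
    rfl
  have hσr : ∀ (a : Fin r) (ha : r + a < d + 1), σ ⟨r + a, ha⟩ = ρ (u a) := by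
    intro a ha
    have : (finCongr hcard) ⟨r + a, ha⟩ = finSumFinEquiv (Sum.inr a) := Fin.ext rfl
    simp only [σ, Equiv.trans_apply, this, Equiv.symm_apply_apply]
    rfl
  refine ⟨r, hr, σ, ?_, ?_⟩
  · obtain ⟨a, ha⟩ := husurj 0 hs00
    have hr0 : 0 < r := a.pos
    -- Because `P` is listed increasingly and contains `0`, the permutation fixes `0`.
    have h1 : u ⟨0, hr0⟩ ≤ u a := u.monotone (Nat.zero_le _)
    rw [ha] at h1
    exact (hσl ⟨0, hr0⟩ (Nat.succ_pos d)).trans (Fin.le_zero_iff.mp h1)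
  · have key : ∀ i k, η (e (σ i)) (e (σ k)) = canonicalForm hr e (e i) (e k) := by
      intro i k
      have hη' : ∀ i k, η (e i) (e k) = if k = ρ i then s i else 0 := fun i k => by
        split_ifs with hk
        exacts [(h i k).1 hk, (h i k).2 hk]
      have hcases : ∀ i : Fin (d + 1), (∃ (a : Fin r) (ha : (a : ℕ) < d + 1), i = ⟨a, ha⟩) ∨
          ∃ (a : Fin r) (ha : r + a < d + 1), i = ⟨r + a, ha⟩ := by
        intro i
        rcases lt_or_ge (i : ℕ) r with hi | hi
        · exact Or.inl ⟨⟨i, hi⟩, i.2, rfl⟩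
        · exact Or.inr ⟨⟨i - r, by omega⟩, by simp only; omega, Fin.ext (by simp only; omega)⟩
      rw [canonicalForm_apply, hη']
      have hne : ∀ a b, u a ≠ ρ (u b) := fun a b hab => by
        have := congrArg s hab
        rw [hsρ, hu, hu] at this
        norm_num at this
      rcases hcases i with ⟨a, ha, rfl⟩ | ⟨a, ha, rfl⟩ <;>
        rcases hcases k with ⟨b, hb, rfl⟩ | ⟨b, hb, rfl⟩
      · rw [hσl, hσl, if_neg (hne _ _), if_neg (by simp only; omega), if_neg (by simp only; omega)]
      · rw [hσl, hσr, hu]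
        by_cases hab : a = b
        · subst hab; simp
        · rw [if_neg, if_neg, if_neg]
          · simp only; omega
          · simp only; omega
          · intro h'
            have := congrArg ρ h'
            rw [hρ, hρ] at this
            exact hab (u.injective this).symm
      · rw [hσr, hσl, hρ, hsρ, hu]
        by_cases hab : a = b
        · subst hab
          rw [if_pos rfl, if_neg (by simp only; omega), if_pos rfl]
        · rw [if_neg, if_neg, if_neg]
          · simp only; omega
          · simp only; omega
          · exact fun h' => hab (u.injective h').symm
      · rw [hσr, hσr, hρ, if_neg (hne _ _).symm, if_neg (by simp only; omega),
          if_neg (by simp only; omega)]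
    refine LinearMap.BilinForm.ext_basis e fun i k => ?_
    obtain ⟨i, rfl⟩ := σ.surjective i
    obtain ⟨k, rfl⟩ := σ.surjective k
    rw [key, act_permEquiv_apply]

end Combinatorics

/-! ### Orbits of symplectic forms. -/

section Main

open Module

variable {g : Type*} [LieRing g] [LieAlgebra ℝ g] {p : ℕ} {B : Fin p → RealJordanBlock}
  {e : Basis (Fin (jordanSize B + 1)) ℝ g}

lemma formClass_act {ψ : g ≃ₗ[ℝ] g} (hψ : ψ ∈ scaledAut g) (ω : LinearMap.BilinForm ℝ g) :
    formClass (act ψ ω) = formClass ω := by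
  have hmul : ∀ ψ₁ ψ₂ : g ≃ₗ[ℝ] g, act ψ₁ (act ψ₂ ω) = act (ψ₁ * ψ₂) ω := fun _ _ => rfl
  ext η
  constructor
  · rintro ⟨χ, hχ, rfl⟩
    exact ⟨χ * ψ, mul_mem hχ hψ, hmul _ _⟩
  · rintro ⟨χ, hχ, rfl⟩
    exact ⟨χ * ψ⁻¹, mul_mem hχ (inv_mem hψ), by rw [hmul, inv_mul_cancel_right]⟩

/-- Any Jordan basis can be moved by a scaled automorphism to a basis in which a given symplectic
form is monomial. -/
theorem IsJordanBasis.exists_scaledAut [FiniteDimensional ℝ g] (he : IsJordanBasis B e)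
    {ω : LinearMap.BilinForm ℝ g} (hω : ω ∈ symplecticForms g) :
    ∃ ψ ∈ scaledAut g, (∃ j, ω (ψ (e 0)) (ψ (e j)) = 1) ∧
      IsMonomial fun i k => ω (ψ (e i)) (ψ (e k)) := by
  classical
  have hs : ∀ y z, ω y z = -ω z y := fun y z => (hω.1.neg_eq z y).symm
  obtain ⟨v, hv, hvblock⟩ := he.exists_basis
  obtain ⟨κ, _, v', a, c, ha, hc, hvblock', h1, hmon⟩ := he.frame.exists_monomial_basis hω
  obtain ⟨τ, hτ⟩ := IsBlockFamily.exists_equiv v v' hvblock hvblock'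
  let E := (finSuccEquiv (jordanSize B)).trans (Equiv.optionCongr τ)
  let w : Option (Option κ) → g := fun o => o.elim (c⁻¹ • (e 0 - a)) fun o => (v' o : g)
  have hE : IsMonomial fun i k => ω (w (E i)) (w (E k)) := hmon.comp_equiv E
  have hli : LinearIndependent ℝ (w ∘ E) := by
    rw [Fintype.linearIndependent_iff]
    intro b hb
    refine congrFun (IsMonomial.linearIndependent hs hE b fun k => ?_)
    rw [show ∑ i, b i • w (E i) = 0 from hb, map_zero]
  let f : Basis (Fin (jordanSize B + 1)) ℝ g := basisOfLinearIndependentOfCardEqFinrank hli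
    (by rw [finrank_eq_card_basis e])
  let ψ : g ≃ₗ[ℝ] g := e.equiv f (Equiv.refl _)
  have hψ : ∀ i, ψ (e i) = w (E i) := fun i => by
    simp [ψ, f]
  have hψ0 : ψ (e 0) = c⁻¹ • (e 0 - a) := by
    rw [hψ]; simp [E, w]
  have hψs : ∀ i : Fin (jordanSize B), ψ (e i.succ) = v' (τ i) := fun i => by
    rw [hψ]; simp [E, w]
  have hψV : ∀ y : LinearMap.ker he.frame.lam, ψ y = v.equiv v' τ y := by
    have : ψ.toLinearMap ∘ₗ Submodule.subtype _ =
        Submodule.subtype _ ∘ₗ (v.equiv v' τ).toLinearMap :=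
      v.ext fun i => by
        change ψ (v i : g) = v.equiv v' τ (v i)
        rw [Basis.equiv_apply, hv, hψs]
    exact fun y => LinearMap.congr_fun this y
  have hcomm := hτ (v.equiv v' τ).toLinearMap fun i => Basis.equiv_apply _ _ _ _
  refine ⟨ψ, ?_, ⟨(τ.symm none).succ, ?_⟩, ?_⟩
  -- `c ψ` sends `e 0` to `e 0 - a` and commutes with `ad (e 0)` on the ideal, hence is an
  -- automorphism; `ψ` itself is one only up to the scalar `c`.
  · let φ : g ≃ₗ[ℝ] g := ψ.trans (LinearEquiv.smulOfNeZero ℝ g c hc)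
    have hφ : ∀ x, φ x = c • ψ x := fun _ => rfl
    have hmap := he.frame.map_lie φ.toLinearMap ha
      (by
        change c • ψ (e 0) = e 0 - a
        rw [hψ0, smul_smul, mul_inv_cancel₀ hc, one_smul])
      (fun y hy => by
        change he.frame.lam (c • ψ y) = 0
        rw [hψV ⟨y, hy⟩, map_smul, (v.equiv v' τ ⟨y, hy⟩).2, smul_zero])
      (fun y hy => by
        change c • ψ ⁅_, y⁆ = ⁅_, c • ψ y⁆
        rw [lie_smul, hψV ⟨y, hy⟩, ← he.frame.coe_adVec ⟨y, hy⟩, hψV,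
          ← he.frame.coe_adVec (v.equiv v' τ ⟨y, hy⟩)]
        exact congrArg (fun z : LinearMap.ker he.frame.lam => c • (z : g)) (hcomm ⟨y, hy⟩))
    refine ⟨(Units.mk0 c hc)⁻¹, { φ with map_lie' := fun {x y} => hmap x y }, fun x => ?_⟩
    change ψ x = ((Units.mk0 c hc)⁻¹ : ℝˣ) • (c • ψ x)
    rw [Units.smul_def, Units.val_inv_eq_inv_val, Units.val_mk0, smul_smul, inv_mul_cancel₀ hc,
      one_smul]
  · rw [hψ0, hψs, Equiv.apply_symm_apply]
    exact h1
  · simp_rw [hψ]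
    exact hE

/-- The class of a symplectic form contains a permutation of the canonical form. -/
theorem IsJordanBasis.exists_perm [FiniteDimensional ℝ g] (he : IsJordanBasis B e)
    {ω : LinearMap.BilinForm ℝ g} (hω : ω ∈ symplecticForms g) :
    ∃ (r : ℕ) (hr : jordanSize B + 1 = 2 * r) (σ : Equiv.Perm (Fin (jordanSize B + 1))),
      σ 0 = 0 ∧ formClass ω = formClass (act (permEquiv e σ) (canonicalForm hr e)) := by
  obtain ⟨ψ, hψ, h0, hmon⟩ := he.exists_scaledAut hω
  have hη : ∀ y z, act ψ⁻¹ ω y z = ω (ψ y) (ψ z) := fun _ _ => rfl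
  obtain ⟨r, hr, σ, hσ, h⟩ := IsMonomial.exists_perm (η := act ψ⁻¹ ω) e
    (fun y z => by rw [hη, hη]; exact (hω.1.neg_eq _ _).symm) hmon h0
  exact ⟨r, hr, σ, hσ, by rw [← h, formClass_act (inv_mem hψ)]⟩

/-- The moduli space of symplectic forms on an almost abelian Lie algebra is finite. -/
theorem IsAlmostAbelian.finite_symplecticModuli [FiniteDimensional ℝ g] (hg : IsAlmostAbelian g) :
    (symplecticModuli g).Finite := by
  by_cases h : ∃ ω, ω ∈ symplecticForms g
  · obtain ⟨ω₀, hω₀⟩ := h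
    obtain ⟨F⟩ := hg.nonempty_frame
    -- One symplectic form already supplies a Jordan basis. All other forms are then compared in
    -- this fixed basis, where finitely many permutations remain and the dimension fixes `r`.
    obtain ⟨κ, _, v, -, -, -, -, hv, -, -⟩ := F.exists_monomial_basis hω₀
    obtain ⟨p, B, e, he⟩ := F.exists_isJordanBasis v hv
    obtain ⟨r, hr, -⟩ := he.exists_perm hω₀
    refine (Set.finite_range fun σ : Equiv.Perm (Fin (jordanSize B + 1)) =>
      formClass (act (permEquiv e σ) (canonicalForm hr e))).subset ?_
    rintro _ ⟨ω, hω, rfl⟩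
    obtain ⟨r', hr', σ, -, h⟩ := he.exists_perm hω
    obtain rfl : r' = r := by omega
    exact ⟨σ, h.symm⟩
  · refine Set.Finite.subset Set.finite_empty ?_
    rintro _ ⟨ω, hω, -⟩
    exact h ⟨ω, hω⟩

end Main

end AlmostAbelian

theorem theorem6p3 {g : Type*} [LieRing g] [LieAlgebra ℝ g] [FiniteDimensional ℝ g]
    (hg : AlmostAbelian.IsAlmostAbelian g) :
    (AlmostAbelian.symplecticModuli g).Finite ∧
    ∀ (p : ℕ) (B : Fin p → AlmostAbelian.RealJordanBlock)
      (e : Module.Basis (Fin (AlmostAbelian.jordanSize B + 1)) ℝ g),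
      AlmostAbelian.IsJordanBasis B e →
      ∀ ω ∈ AlmostAbelian.symplecticForms g,
        ∃ (r : ℕ) (hr : AlmostAbelian.jordanSize B + 1 = 2 * r)
          (σ : Equiv.Perm (Fin (AlmostAbelian.jordanSize B + 1))),
          σ 0 = 0 ∧
          AlmostAbelian.formClass ω =
            AlmostAbelian.formClass
              (AlmostAbelian.act (AlmostAbelian.permEquiv e σ)
                (AlmostAbelian.canonicalForm hr e)) :=
  ⟨hg.finite_symplecticModuli, fun _ _ _ he _ hω => he.exists_perm hω⟩
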